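/- Let $N\ge 0$, $D=2N$, $\theta\in\mathbb R\setminus\{0\}$, $\Theta=\theta\,\mathrm{diag}(J,\dots,J)$ with $J=\begin{pmatrix}0&-1\\1&0\end{pmatrix}$ ($N$ blocks). On Schwartz space $\mathcal S=\mathcal S(\mathbb R^{D},\mathbb C)$ let $$(a\star b)(x)=\frac1{(\pi\theta)^{D}}\int\!\!\int a(x+y)\,b(x+z)\,e^{-2i\,y\Theta^{-1}z}\,dy\,dz .$$ For $T\in\mathcal S'$ and $a,b\in\mathcal S$ put $\langle T\star a,b\rangle=\langle T,a\star b\rangle$ and $\langle a\star T,b\rangle=\langle T,b\star a\rangle$. The Moyal algebra is $$\mathcal M=\{T\in\mathcal S' : a\star T\in\mathcal S \text{ and } T\star a\in\mathcal S\ \text{ for all } a\in\mathcal S\},$$ a unital $*$-algebra for the product $\langle S\star T,b\rangle=\langle S,T\star b\rangle$ and the involution $\dagger$ extending complex conjugation, $\langle T^\dagger,b\rangle=\overline{\langle T,\bar b\rangle}$. Let $\mathcal G_2=\{\mathrm{ad}_P=[P,\cdot]_\star : P \text{ a polynomial function of degree}\le 2\}$, a Lie algebra of derivations of $\mathcal M$,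 and $\eta(\mathrm{ad}_P)=P-P(0)$. Put $\xi_\mu=-\sum_\nu\Theta^{-1}_{\mu\nu}x_\nu$, $\partial_\mu=\mathrm{ad}_{i\xi_\mu}$ and $X_{(\mu\nu)}=\mathrm{ad}_{i\xi_\mu\xi_\nu}$, where $\xi_\mu\xi_\nu$ is the pointwise product. Let $n\ge0$. A connection on the right module $\mathcal M^n$ is a family of linear maps $\nabla_X:\mathcal M^n\to\mathcal M^n$, linear in $X\in\mathcal G_2$, with $\nabla_X(ma)=m\,X(a)+\nabla_X(m)\,a$, and $\nabla_{fX}(m)=\nabla_X(m)f$ for central $f$. It is hermitean if $X(h_0(m_1,m_2))=h_0(\nabla_Xm_1,m_2)+h_0(m_1,\nabla_Xm_2)$ for every real $X\in\mathcal G_2$ (that is, $X(a)^\dagger=X(a^\dagger)$ for all $a$), where $h_0(m_1,m_2)=\sum_i (m_1^i)^\dagger\star m_2^i$. The canonical connection is $\nabla^{inv}_X(m)=X(m)-\eta(X)\star m$ (with $X$ acting componentwise), the tensor form is $\mathcal A(X)=\nabla_X-\nabla^{inv}_X$, and the curvature is $F(X,Y)=[\nabla_X,\nabla_Y]-\nabla_{[X,Y]}$.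 Let $T^A$, $A=0,\dots,n^2-1$, be generators of $\mathfrak u(n)$, that is, a real basis of the hermitian $n\times n$ matrices. For every hermitean connection $\nabla$ on $\mathcal M^n$, $\mathcal A(X)$ and $F(X,Y)$ ($X,Y\in\mathcal G_2$) act on $\mathcal M^n$ as matrices in $M_n(\mathcal M)$. The components $\tilde{\mathcal A}_\mu=\mathcal A(\partial_\mu)$, $\tilde{\mathcal A}_{(\mu\nu)}=\mathcal A(X_{(\mu\nu)})$, $F_{\mu\nu}=F(\partial_\mu,\partial_\nu)$, $F_{\mu(\rho\sigma)}=F(\partial_\mu,X_{(\rho\sigma)})$ and $F_{(\mu\nu)(\rho\sigma)}=F(X_{(\mu\nu)},X_{(\rho\sigma)})$ are $\mathfrak u(n)$-valued: each has the form $\sum_A b^A T^A$ with $b^A\in\mathcal M$, $(b^A)^\dagger=-b^A$. Moreover, for all indices, $$F_{\mu\nu}=[\tilde{\mathcal A}_\mu,\tilde{\mathcal A}_\nu]_\star-i\Theta^{-1}_{\mu\nu}\,\mathbb 1_n,$$ $$F_{\mu(\rho\sigma)}=[\tilde{\mathcal A}_\mu,\tilde{\mathcal A}_{(\rho\sigma)}]_\star-\Theta^{-1}_{\mu\rho}\tilde{\mathcal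 A}_\sigma-\Theta^{-1}_{\mu\sigma}\tilde{\mathcal A}_\rho,$$ $$F_{(\mu\nu)(\rho\sigma)}=[\tilde{\mathcal A}_{(\mu\nu)},\tilde{\mathcal A}_{(\rho\sigma)}]_\star+\Theta^{-1}_{\rho\nu}\tilde{\mathcal A}_{(\mu\sigma)}+\Theta^{-1}_{\sigma\nu}\tilde{\mathcal A}_{(\mu\rho)}+\Theta^{-1}_{\rho\mu}\tilde{\mathcal A}_{(\nu\sigma)}+\Theta^{-1}_{\sigma\mu}\tilde{\mathcal A}_{(\nu\rho)}.$$ -/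

import Mathlib

open MeasureTheory Filter Topology SchwartzMap LineDeriv
open scoped FourierTransform RealInnerProductSpace ContDiff

noncomputable section

set_option linter.unusedSectionVars false

section TwistedProduct

variable {V : Type*} [NormedAddCommGroup V] [InnerProductSpace ℝ V] [FiniteDimensional ℝ V]
  [MeasurableSpace V] [BorelSpace V]

/-- The phase `t ↦ exp (2πit)`. -/
def phase (t : ℝ) : ℂ := Complex.exp (↑(2 * Real.pi * t) * Complex.I)

theorem phase_add (s t : ℝ) : phase (s + t) = phase s * phase t := by
  simp only [phase, ← Complex.exp_add]; congr 1; push_cast; ring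

theorem norm_phase (t : ℝ) : ‖phase t‖ = 1 := Complex.norm_exp_ofReal_mul_I _

theorem phase_zero : phase 0 = 1 := by simp [phase]

@[fun_prop]
theorem continuous_phase : Continuous phase := by unfold phase; fun_prop

/-- Twisted product `∫ 𝓕a(v) exp(2πi⟨x,v⟩) b(x + Kv) dv`. -/
def twisted (K : V →L[ℝ] V) (a b : 𝓢(V, ℂ)) (x : V) : ℂ :=
  ∫ v, 𝓕 a v * (phase ⟪x, v⟫ * b (x + K v))

theorem schwartz_integrable_mul (f : 𝓢(V, ℂ)) {g : V → ℂ} (hg : Continuous g) {C : ℝ}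
    (hC : ∀ v, ‖g v‖ ≤ C) : Integrable (fun v => f v * g v) :=
  f.integrable.mul_bdd hg.aestronglyMeasurable (Eventually.of_forall hC)

theorem twisted_integrable (K : V →L[ℝ] V) (a b : 𝓢(V, ℂ)) (x : V) :
    Integrable (fun v => 𝓕 a v * (phase ⟪x, v⟫ * b (x + K v))) := by
  refine schwartz_integrable_mul (𝓕 a) (by fun_prop) (C := SchwartzMap.seminorm ℝ 0 0 b) fun v => ?_
  rw [norm_mul, norm_phase, one_mul]; exact b.norm_le_seminorm ℝ _

theorem norm_twisted_le (K : V →L[ℝ] V) (a b : 𝓢(V, ℂ)) (x : V) :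
    ‖twisted K a b x‖ ≤ (∫ v, ‖𝓕 a v‖) * SchwartzMap.seminorm ℝ 0 0 b := by
  rw [← integral_mul_const]
  refine norm_integral_le_of_norm_le ((𝓕 a).integrable.norm.mul_const _) (Eventually.of_forall ?_)
  intro v
  rw [norm_mul, norm_mul, norm_phase, one_mul]
  gcongr
  exact b.norm_le_seminorm ℝ _

/-- Multiplication by the linear function `⟨·, m⟩` on Schwartz space. -/
def coordMul (m : V) : 𝓢(V, ℂ) →L[ℂ] 𝓢(V, ℂ) :=
  SchwartzMap.smulLeftCLM ℂ (fun x : V => ((⟪x, m⟫ : ℝ) : ℂ))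

theorem coordMul_apply (m : V) (f : 𝓢(V, ℂ)) (x : V) : coordMul m f x = ⟪x, m⟫ * f x := by
  rw [coordMul, SchwartzMap.smulLeftCLM_apply_apply (by fun_prop), smul_eq_mul]

theorem fourier_lineDeriv_apply (a : 𝓢(V, ℂ)) (m v : V) :
    𝓕 (∂_{m} a) v = 2 * Real.pi * Complex.I * ⟪v, m⟫ * 𝓕 a v := by
  rw [SchwartzMap.fourier_lineDerivOp_eq, smul_apply,
    SchwartzMap.smulLeftCLM_apply_apply (by fun_prop)]
  simp; ring

theorem hasFDerivAt_phase_inner (v x : V) :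
    HasFDerivAt (fun x : V => phase ⟪x, v⟫)
      ((2 * Real.pi * Complex.I * phase ⟪x, v⟫) •
        (Complex.ofRealCLM.comp (innerSL ℝ v))) x := by
  have h1 : HasFDerivAt (fun x : V => ((⟪x, v⟫ : ℝ) : ℂ))
      (Complex.ofRealCLM.comp (innerSL ℝ v)) x :=
    by simpa [real_inner_comm] using! (Complex.ofRealCLM.comp (innerSL ℝ v)).hasFDerivAt (x := x)
  have h2 := ((h1.const_mul (2 * Real.pi * Complex.I)).cexp)
  convert h2 using 1
  · ext y; simp only [phase]; congr 1; push_cast; ring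
  · ext m
    simp only [phase]
    simp
    ring_nf

theorem hasFDerivAt_twisted (K : V →L[ℝ] V) (a b : 𝓢(V, ℂ)) (x : V) :
    ∃ L : V →L[ℝ] ℂ, HasFDerivAt (twisted K a b) L x ∧
      ∀ m, L m = twisted K (∂_{m} a) b x + twisted K a (∂_{m} b) x := by
  let F' : V → V → (V →L[ℝ] ℂ) := fun x v =>
    (𝓕 a v) • (phase ⟪x, v⟫ • fderiv ℝ b (x + K v) +
      b (x + K v) • ((2 * Real.pi * Complex.I * phase ⟪x, v⟫) •
        (Complex.ofRealCLM.comp (innerSL ℝ v))))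
  have hF' : ∀ x v m, F' x v m = 𝓕 (∂_{m} a) v * (phase ⟪x, v⟫ * b (x + K v)) +
      𝓕 a v * (phase ⟪x, v⟫ * (∂_{m} b) (x + K v)) := by
    intro x v m
    rw [fourier_lineDeriv_apply, SchwartzMap.lineDerivOp_apply_eq_fderiv]
    simp [F']
    ring
  have hcont : ∀ x, Continuous (F' x) := by
    intro x
    have : Continuous (fun y => fderiv ℝ b y) := (b.smooth 1).continuous_fderiv (by simp)
    have h2 : Continuous fun v : V => (Complex.ofRealCLM.comp (innerSL ℝ v)) := by
      have : Continuous fun v : V => innerSL ℝ (E := V) v :=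
        (innerSL ℝ (E := V)).continuous
      exact (continuous_const.clm_comp this)
    have h3 : Continuous fun v : V => phase ⟪x, v⟫ := by fun_prop
    have h4 : Continuous fun v : V => b (x + K v) := by fun_prop
    exact (𝓕 a).continuous.smul ((h3.smul (this.comp (g := fun y => fderiv ℝ b y) (f := fun v => x + K v) (by fun_prop))).add
      (h4.smul ((continuous_const.mul h3).smul h2)))
  let C0 := SchwartzMap.seminorm ℝ 0 0 b
  let C1 := SchwartzMap.seminorm ℝ 0 1 b
  have hbound : ∀ v x, ‖F' x v‖ ≤ ‖𝓕 a v‖ * C1 + 2 * Real.pi * C0 * (‖v‖ * ‖𝓕 a v‖) := by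
    intro v x
    have e1 : ‖phase ⟪x, v⟫ • fderiv ℝ b (x + K v)‖ ≤ C1 := by
      rw [norm_smul, norm_phase, one_mul]
      have := b.norm_iteratedFDeriv_le_seminorm ℝ 1 (x + K v)
      rwa [norm_iteratedFDeriv_one] at this
    have e2 : ‖Complex.ofRealCLM.comp (innerSL ℝ v)‖ ≤ ‖v‖ := by
      refine ContinuousLinearMap.opNorm_le_bound _ (norm_nonneg _) fun y => ?_
      simpa using abs_real_inner_le_norm v y
    have e3 : ‖b (x + K v) • ((2 * Real.pi * Complex.I * phase ⟪x, v⟫) •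
        (Complex.ofRealCLM.comp (innerSL ℝ v)))‖ ≤ C0 * (2 * Real.pi * ‖v‖) := by
      rw [norm_smul, norm_smul]
      have : ‖(2 * Real.pi * Complex.I * phase ⟪x, v⟫ : ℂ)‖ = 2 * Real.pi := by
        simp [norm_phase, abs_of_pos Real.pi_pos]
      rw [this]
      gcongr
      exact b.norm_le_seminorm ℝ _
    calc ‖F' x v‖ ≤ ‖𝓕 a v‖ * (C1 + C0 * (2 * Real.pi * ‖v‖)) := by
          simp only [F']; rw [norm_smul]
          gcongr
          exact (norm_add_le _ _).trans (add_le_add e1 e3)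
      _ = _ := by ring
  have hint : Integrable fun v => ‖𝓕 a v‖ * C1 + 2 * Real.pi * C0 * (‖v‖ * ‖𝓕 a v‖) := by
    refine ((𝓕 a).integrable.norm.mul_const _).add (Integrable.const_mul ?_ _)
    exact ((𝓕 a).integrable_pow_mul volume 1).congr (Eventually.of_forall fun v => by simp)
  have hdiff := hasFDerivAt_integral_of_dominated_of_fderiv_le (μ := (volume : Measure V)) (𝕜 := ℝ)
    (F := fun x v => 𝓕 a v * (phase ⟪x, v⟫ * b (x + K v))) (F' := F') (x₀ := x) (s := Set.univ)
    (bound := fun v => ‖𝓕 a v‖ * C1 + 2 * Real.pi * C0 * (‖v‖ * ‖𝓕 a v‖)) univ_mem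
    (Eventually.of_forall fun y => (twisted_integrable K a b y).aestronglyMeasurable)
    (twisted_integrable K a b x) (hcont x).aestronglyMeasurable
    (Eventually.of_forall fun v y _ => hbound v y) hint
    (Eventually.of_forall fun v y _ => by
      have h1 : HasFDerivAt (fun y => b (y + K v)) (fderiv ℝ b (y + K v)) y := by
        have := (b.hasFDerivAt (y + K v)).comp y ((hasFDerivAt_id y).add_const (K v))
        simpa [Function.comp_def] using! this
      exact (((hasFDerivAt_phase_inner v y).mul h1).const_mul (𝓕 a v)))
  refine ⟨∫ v, F' x v, hdiff, fun m => ?_⟩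
  have hFi : Integrable (F' x) := hint.mono' (hcont x).aestronglyMeasurable
    (Eventually.of_forall fun v => hbound v x)
  rw [ContinuousLinearMap.integral_apply hFi]
  simp only [hF']
  exact integral_add (twisted_integrable K (∂_{m} a) b x) (twisted_integrable K a (∂_{m} b) x)

theorem inner_mul_twisted (K : V →L[ℝ] V) (hK : ∀ v w, ⟪K v, w⟫ = -⟪v, K w⟫) (a b : 𝓢(V, ℂ))
    (m x : V) :
    ⟪x, m⟫ * twisted K a b x = twisted K a (coordMul m b) x +
      (2 * Real.pi * Complex.I)⁻¹ * twisted K (∂_{K m} a) b x := by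
  simp only [twisted]
  rw [← integral_const_mul, ← integral_const_mul, ← integral_add (twisted_integrable K a _ x)
    ((twisted_integrable K (∂_{K m} a) b x).const_mul _)]
  congr 1; ext v
  rw [fourier_lineDeriv_apply, coordMul_apply, inner_add_left, hK]
  have : (2 * Real.pi * Complex.I : ℂ) ≠ 0 := by simp [Real.pi_ne_zero]
  push_cast
  field_simp
  ring


/-- A class of functions closed under directional derivatives and multiplication by linear
functions, all of whose members are bounded, consists of Schwartz functions. -/
theorem schwartz_decay_of_class (P : (V → ℂ) → Prop)
    (hd : ∀ f, P f → ∀ x, ∃ L : V →L[ℝ] ℂ, HasFDerivAt f L x)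
    (hD : ∀ f, P f → ∀ m, P fun x => fderiv ℝ f x m)
    (hX : ∀ f, P f → ∀ m : V, P fun x => ((⟪x, m⟫ : ℝ) : ℂ) * f x)
    (hB : ∀ f, P f → ∃ C, ∀ x, ‖f x‖ ≤ C) {f : V → ℂ} (hf : P f) :
    ContDiff ℝ ∞ f ∧ ∀ k n : ℕ, ∃ C, ∀ x, ‖x‖ ^ k * ‖iteratedFDeriv ℝ n f x‖ ≤ C := by
  have hc : ∀ (n : ℕ) f, P f → ContDiff ℝ n f := by
    intro n
    induction n with
    | zero => exact fun f hf => contDiff_zero.2 <| continuous_iff_continuousAt.2 fun x =>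
        (hd f hf x).choose_spec.continuousAt
    | succ n ih =>
      intro f hf
      have := (contDiff_succ_iff_fderiv_apply (𝕜 := ℝ) (n := n) (f := f)).2
        ⟨fun x => (hd f hf x).choose_spec.differentiableAt, by simp, fun y => ih _ (hD f hf y)⟩
      exact_mod_cast this
  refine ⟨contDiff_infty.2 fun n => hc n f hf, ?_⟩
  let e := stdOrthonormalBasis ℝ V
  have h0 : ∀ (k : ℕ) f, P f → ∃ C, ∀ x, ‖x‖ ^ k * ‖f x‖ ≤ C := by
    intro k
    induction k with
    | zero => intro f hf; simpa using hB f hf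
    | succ k ih =>
      intro f hf
      choose C hC using fun i => ih _ (hX f hf (e i))
      refine ⟨∑ i, C i, fun x => ?_⟩
      have hx : ‖x‖ ≤ ∑ i, |⟪x, e i⟫| := by
        calc ‖x‖ = ‖∑ i, ⟪e i, x⟫ • e i‖ := by rw [e.sum_repr' x]
          _ ≤ ∑ i, ‖⟪e i, x⟫ • e i‖ := norm_sum_le _ _
          _ = _ := by simp [norm_smul, real_inner_comm]
      calc ‖x‖ ^ (k + 1) * ‖f x‖ = ‖x‖ * (‖x‖ ^ k * ‖f x‖) := by ring
        _ ≤ (∑ i, |⟪x, e i⟫|) * (‖x‖ ^ k * ‖f x‖) := by gcongr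
        _ = ∑ i, ‖x‖ ^ k * ‖((⟪x, e i⟫ : ℝ) : ℂ) * f x‖ := by
            rw [Finset.sum_mul]; congr 1; ext i
            rw [norm_mul, Complex.norm_real, Real.norm_eq_abs]; ring
        _ ≤ _ := Finset.sum_le_sum fun i _ => hC i x
  intro k n
  induction n generalizing f with
  | zero => simpa using h0 k f hf
  | succ n ih =>
    choose C hC using fun i => ih (hD f hf (e i))
    refine ⟨∑ i, C i, fun x => ?_⟩
    have hfe : fderiv ℝ f = fun x => ∑ i, ContinuousLinearMap.smulRightL ℝ V ℂ (innerSL ℝ (e i))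
        (fderiv ℝ f x (e i)) := by
      ext x y
      conv_lhs => rw [← e.sum_repr' y]
      simp
    have hcd : ∀ i, ContDiff ℝ n fun x => fderiv ℝ f x (e i) := fun i => hc n _ (hD f hf (e i))
    rw [← norm_iteratedFDeriv_fderiv]
    have key : ‖iteratedFDeriv ℝ n (fderiv ℝ f) x‖ ≤
        ∑ i, ‖iteratedFDeriv ℝ n (fun x => fderiv ℝ f x (e i)) x‖ := by
      conv_lhs => rw [hfe]
      rw [iteratedFDeriv_fun_sum_apply]
      · refine (norm_sum_le _ _).trans (Finset.sum_le_sum fun i _ => ?_)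
        refine (ContinuousLinearMap.norm_iteratedFDeriv_comp_left _ (hcd i).contDiffAt le_rfl).trans ?_
        refine mul_le_of_le_one_left
          (norm_nonneg (iteratedFDeriv ℝ n (fun x => fderiv ℝ f x (e i)) x)) ?_
        refine ContinuousLinearMap.opNorm_le_bound _ zero_le_one fun z => ?_
        simp
      · exact fun i _ => ((ContinuousLinearMap.contDiff _).comp (hcd i)).contDiffAt
    calc ‖x‖ ^ k * ‖iteratedFDeriv ℝ n (fderiv ℝ f) x‖
        ≤ ‖x‖ ^ k * ∑ i, ‖iteratedFDeriv ℝ n (fun x => fderiv ℝ f x (e i)) x‖ := by gcongr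
      _ = ∑ i, ‖x‖ ^ k * ‖iteratedFDeriv ℝ n (fun x => fderiv ℝ f x (e i)) x‖ := Finset.mul_sum ..
      _ ≤ _ := Finset.sum_le_sum fun i _ => hC i x

/-- A family of Schwartz functions converges to zero as soon as it belongs to a class of families
that is closed under directional derivatives and multiplication by linear functions and all of
whose members converge to zero uniformly. -/
theorem schwartz_tendsto_zero_of_class {ι : Type*} {l : Filter ι} (P : (ι → 𝓢(V, ℂ)) → Prop)
    (hD : ∀ f, P f → ∀ m : V, P fun i => ∂_{m} (f i))
    (hX : ∀ f, P f → ∀ m : V, P fun i => coordMul m (f i))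
    (hB : ∀ f, P f → Tendsto (fun i => SchwartzMap.seminorm ℝ 0 0 (f i)) l (𝓝 0))
    {f : ι → 𝓢(V, ℂ)} (hf : P f) : Tendsto f l (𝓝 0) := by
  let e := stdOrthonormalBasis ℝ V
  have h0 : ∀ (k : ℕ) f, P f → Tendsto (fun i => SchwartzMap.seminorm ℝ k 0 (f i)) l (𝓝 0) := by
    intro k
    induction k with
    | zero => exact hB
    | succ k ih =>
      intro f hf
      have hs : Tendsto (fun i => ∑ j, SchwartzMap.seminorm ℝ k 0 (coordMul (e j) (f i))) l (𝓝 0) := by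
        simpa using tendsto_finsetSum Finset.univ fun j _ => ih _ (hX f hf (e j))
      refine squeeze_zero (fun i => apply_nonneg _ _) (fun i => ?_) hs
      refine SchwartzMap.seminorm_le_bound ℝ _ _ _ (Finset.sum_nonneg fun j _ => apply_nonneg _ _) fun x => ?_
      have hx : ‖x‖ ≤ ∑ i, |⟪x, e i⟫| := by
        calc ‖x‖ = ‖∑ i, ⟪e i, x⟫ • e i‖ := by rw [e.sum_repr' x]
          _ ≤ ∑ i, ‖⟪e i, x⟫ • e i‖ := norm_sum_le _ _
          _ = _ := by simp [norm_smul, real_inner_comm]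
      rw [norm_iteratedFDeriv_zero]
      calc ‖x‖ ^ (k + 1) * ‖f i x‖ = ‖x‖ * (‖x‖ ^ k * ‖f i x‖) := by ring
        _ ≤ (∑ i, |⟪x, e i⟫|) * (‖x‖ ^ k * ‖f i x‖) := by gcongr
        _ = ∑ j, ‖x‖ ^ k * ‖coordMul (e j) (f i) x‖ := by
            rw [Finset.sum_mul]; congr 1; ext j
            rw [coordMul_apply, norm_mul, Complex.norm_real, Real.norm_eq_abs]; ring
        _ ≤ _ := Finset.sum_le_sum fun j _ => SchwartzMap.norm_pow_mul_le_seminorm ℝ _ k x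
  have h1 : ∀ (n k : ℕ) f, P f → Tendsto (fun i => SchwartzMap.seminorm ℝ k n (f i)) l (𝓝 0) := by
    intro n k
    induction n with
    | zero => exact h0 k
    | succ n ih =>
      intro f hf
      have hs : Tendsto (fun i => ∑ j, SchwartzMap.seminorm ℝ k n (∂_{e j} (f i))) l (𝓝 0) := by
        simpa using tendsto_finsetSum Finset.univ fun j _ => ih _ (hD f hf (e j))
      refine squeeze_zero (fun i => apply_nonneg _ _) (fun i => ?_) hs
      refine SchwartzMap.seminorm_le_bound ℝ _ _ _ (Finset.sum_nonneg fun j _ => apply_nonneg _ _) fun x => ?_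
      have hfe : fderiv ℝ (f i) = fun x => ∑ j, ContinuousLinearMap.smulRightL ℝ V ℂ
          (innerSL ℝ (e j)) (∂_{e j} (f i) x) := by
        ext x y
        conv_lhs => rw [← e.sum_repr' y]
        simp [SchwartzMap.lineDerivOp_apply_eq_fderiv]
      have hcd : ∀ j, ContDiff ℝ n (∂_{e j} (f i) : 𝓢(V, ℂ)) := fun j =>
        (∂_{e j} (f i) : 𝓢(V, ℂ)).smooth n
      rw [← norm_iteratedFDeriv_fderiv]
      have key : ‖iteratedFDeriv ℝ n (fderiv ℝ (f i)) x‖ ≤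
          ∑ j, ‖iteratedFDeriv ℝ n (∂_{e j} (f i) : 𝓢(V, ℂ)) x‖ := by
        rw [hfe, iteratedFDeriv_fun_sum_apply]
        · refine (norm_sum_le _ _).trans (Finset.sum_le_sum fun j _ => ?_)
          refine (ContinuousLinearMap.norm_iteratedFDeriv_comp_left _ (hcd j).contDiffAt
            le_rfl).trans ?_
          refine mul_le_of_le_one_left (by positivity) ?_
          refine ContinuousLinearMap.opNorm_le_bound _ zero_le_one fun z => ?_
          simp
        · exact fun j _ => ((ContinuousLinearMap.contDiff _).comp (hcd j)).contDiffAt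
      calc ‖x‖ ^ k * ‖iteratedFDeriv ℝ n (fderiv ℝ (f i)) x‖
          ≤ ‖x‖ ^ k * ∑ j, ‖iteratedFDeriv ℝ n (∂_{e j} (f i) : 𝓢(V, ℂ)) x‖ := by gcongr
        _ = ∑ j, ‖x‖ ^ k * ‖iteratedFDeriv ℝ n (∂_{e j} (f i) : 𝓢(V, ℂ)) x‖ := Finset.mul_sum ..
        _ ≤ _ := Finset.sum_le_sum fun j _ => SchwartzMap.le_seminorm ℝ _ _ _ x
  rw [(schwartz_withSeminorms ℝ V ℂ).tendsto_nhds]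
  rintro ⟨k, n⟩ ε hε
  have := (h1 n k f hf).eventually (gt_mem_nhds hε)
  simpa using this

theorem twisted_schwartz (K : V →L[ℝ] V) (hK : ∀ v w, ⟪K v, w⟫ = -⟪v, K w⟫)
    (a b : 𝓢(V, ℂ)) :
    ContDiff ℝ ∞ (twisted K a b) ∧
      ∀ k n : ℕ, ∃ C, ∀ x, ‖x‖ ^ k * ‖iteratedFDeriv ℝ n (twisted K a b) x‖ ≤ C := by
  let S : Submodule ℂ (V → ℂ) := Submodule.span ℂ (Set.range fun p : 𝓢(V, ℂ) × 𝓢(V, ℂ) =>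
    twisted K p.1 p.2)
  have hmem : ∀ a b, twisted K a b ∈ S := fun a b => Submodule.subset_span ⟨(a, b), rfl⟩
  have hdS : ∀ f ∈ S, ∀ x, ∃ L : V →L[ℝ] ℂ, HasFDerivAt f L x := by
    intro f hf
    induction hf using Submodule.span_induction with
    | mem f hf =>
      obtain ⟨p, rfl⟩ := hf
      exact fun x => (hasFDerivAt_twisted K p.1 p.2 x).imp fun _ h => h.1
    | zero => exact fun x => ⟨0, hasFDerivAt_const _ _⟩
    | add f g _ _ hf hg =>
      intro x
      obtain ⟨L, hL⟩ := hf x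
      obtain ⟨L', hL'⟩ := hg x
      exact ⟨_, hL.add hL'⟩
    | smul c f _ hf => exact fun x => ⟨_, (hf x).choose_spec.const_smul c⟩
  refine schwartz_decay_of_class (· ∈ S) hdS ?_ ?_ ?_ (hmem a b)
  · intro f hf m
    induction hf using Submodule.span_induction with
    | mem f hf =>
      obtain ⟨p, rfl⟩ := hf
      convert S.add_mem (hmem (∂_{m} p.1) p.2) (hmem p.1 (∂_{m} p.2)) using 1
      ext x
      obtain ⟨L, hL, h⟩ := hasFDerivAt_twisted K p.1 p.2 x
      rw [hL.fderiv, h]; rfl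
    | zero => 
      convert S.zero_mem using 1
      ext x
      have : HasFDerivAt (0 : V → ℂ) (0 : V →L[ℝ] ℂ) x := hasFDerivAt_const _ _
      rw [this.fderiv]; rfl
    | add f g hf' hg' hf hg =>
      convert S.add_mem hf hg using 1
      ext x
      obtain ⟨L, hL⟩ := hdS f hf' x
      obtain ⟨L', hL'⟩ := hdS g hg' x
      rw [(hL.add hL').fderiv, Pi.add_apply, hL.fderiv, hL'.fderiv]; rfl
    | smul c f hf' hf =>
      convert S.smul_mem c hf using 1
      ext x
      obtain ⟨L, hL⟩ := hdS f hf' x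
      rw [(hL.const_smul c).fderiv, Pi.smul_apply, hL.fderiv]; rfl
  · intro f hf m
    induction hf using Submodule.span_induction with
    | mem f hf =>
      obtain ⟨p, rfl⟩ := hf
      convert S.add_mem (hmem p.1 (coordMul m p.2)) (S.smul_mem (2 * Real.pi * Complex.I)⁻¹
        (hmem (∂_{K m} p.1) p.2)) using 1
      ext x
      exact inner_mul_twisted K hK p.1 p.2 m x
    | zero => 
      convert S.zero_mem using 1
      ext x
      simp
    | add f g hf' hg' hf hg =>
      convert S.add_mem hf hg using 1
      ext x
      simp [mul_add]
    | smul c f hf' hf =>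
      convert S.smul_mem c hf using 1
      ext x
      simp [mul_left_comm]
  · intro f hf
    induction hf using Submodule.span_induction with
    | mem f hf =>
      obtain ⟨p, rfl⟩ := hf
      exact ⟨_, norm_twisted_le K p.1 p.2⟩
    | zero => exact ⟨0, by simp⟩
    | add f g _ _ hf hg =>
      obtain ⟨C, hC⟩ := hf
      obtain ⟨C', hC'⟩ := hg
      exact ⟨C + C', fun x => (norm_add_le _ _).trans (add_le_add (hC x) (hC' x))⟩
    | smul c f _ hf =>
      obtain ⟨C, hC⟩ := hf
      exact ⟨‖c‖ * C, fun x => by rw [Pi.smul_apply, norm_smul]; gcongr; exact hC x⟩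

/-- The twisted product as a Schwartz function, for skew-symmetric `K`. -/
def twistedProd (K : V →L[ℝ] V) (hK : ∀ v w, ⟪K v, w⟫ = -⟪v, K w⟫) (a b : 𝓢(V, ℂ)) : 𝓢(V, ℂ) where
  toFun := twisted K a b
  smooth' := (twisted_schwartz K hK a b).1
  decay' := (twisted_schwartz K hK a b).2

variable (K : V →L[ℝ] V) (hK : ∀ v w, ⟪K v, w⟫ = -⟪v, K w⟫)

theorem twistedProd_apply (a b : 𝓢(V, ℂ)) (x : V) :
    twistedProd K hK a b x = ∫ v, 𝓕 a v * (phase ⟪x, v⟫ * b (x + K v)) := rfl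

theorem twistedProd_add_left (a a' b : 𝓢(V, ℂ)) :
    twistedProd K hK (a + a') b = twistedProd K hK a b + twistedProd K hK a' b := by
  ext x
  rw [add_apply]
  simp only [twistedProd_apply]
  rw [← integral_add (twisted_integrable K a b x) (twisted_integrable K a' b x), FourierAdd.fourier_add]
  simp [add_mul]

theorem twistedProd_add_right (a b b' : 𝓢(V, ℂ)) :
    twistedProd K hK a (b + b') = twistedProd K hK a b + twistedProd K hK a b' := by
  ext x
  rw [add_apply]
  simp only [twistedProd_apply]
  rw [← integral_add (twisted_integrable K a b x) (twisted_integrable K a b' x)]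
  simp [mul_add]

theorem twistedProd_smul_left (c : ℂ) (a b : 𝓢(V, ℂ)) :
    twistedProd K hK (c • a) b = c • twistedProd K hK a b := by
  ext x
  rw [smul_apply]
  simp only [twistedProd_apply]
  rw [smul_eq_mul, ← integral_const_mul, FourierTransform.fourier_smul]
  simp [mul_assoc]

theorem twistedProd_smul_right (c : ℂ) (a b : 𝓢(V, ℂ)) :
    twistedProd K hK a (c • b) = c • twistedProd K hK a b := by
  ext x
  rw [smul_apply]
  simp only [twistedProd_apply]
  rw [smul_eq_mul, ← integral_const_mul]
  congr 1; ext v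
  simp; ring

theorem lineDeriv_twistedProd (a b : 𝓢(V, ℂ)) (m : V) :
    ∂_{m} (twistedProd K hK a b) =
      twistedProd K hK (∂_{m} a) b + twistedProd K hK a (∂_{m} b) := by
  ext x
  obtain ⟨L, hL, h⟩ := hasFDerivAt_twisted K a b x
  rw [SchwartzMap.lineDerivOp_apply_eq_fderiv]
  exact (congrArg (· m) hL.fderiv).trans (h m)

theorem coordMul_twistedProd (a b : 𝓢(V, ℂ)) (m : V) :
    coordMul m (twistedProd K hK a b) = twistedProd K hK a (coordMul m b) +
      (2 * Real.pi * Complex.I)⁻¹ • twistedProd K hK (∂_{K m} a) b := by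
  ext x
  rw [coordMul_apply]
  exact inner_mul_twisted K hK a b m x

theorem tendsto_twistedProd_zero {ι : Type*} {l : Filter ι} {u w : ι → 𝓢(V, ℂ)} {u₀ w₀ : 𝓢(V, ℂ)}
    (hu : Tendsto u l (𝓝 u₀)) (hw : Tendsto w l (𝓝 w₀)) (h : u₀ = 0 ∨ w₀ = 0) :
    Tendsto (fun i => twistedProd K hK (u i) (w i)) l (𝓝 0) := by
  let G : Set (ι → 𝓢(V, ℂ)) := {f | ∃ u w : ι → 𝓢(V, ℂ), ∃ u₀ w₀ : 𝓢(V, ℂ), Tendsto u l (𝓝 u₀) ∧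
    Tendsto w l (𝓝 w₀) ∧ (u₀ = 0 ∨ w₀ = 0) ∧ f = fun i => twistedProd K hK (u i) (w i)}
  let S : Submodule ℂ (ι → 𝓢(V, ℂ)) := Submodule.span ℂ G
  have hS : ∀ {u w : ι → 𝓢(V, ℂ)} {u₀ w₀ : 𝓢(V, ℂ)}, Tendsto u l (𝓝 u₀) → Tendsto w l (𝓝 w₀) →
      (u₀ = 0 ∨ w₀ = 0) → (fun i => twistedProd K hK (u i) (w i)) ∈ S :=
    fun hu hw h => Submodule.subset_span ⟨_, _, _, _, hu, hw, h, rfl⟩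
  have hder : ∀ (m : V) {u : ι → 𝓢(V, ℂ)} {u₀ : 𝓢(V, ℂ)}, Tendsto u l (𝓝 u₀) →
      Tendsto (fun i => ∂_{m} (u i)) l (𝓝 (∂_{m} u₀)) := fun m u u₀ hu =>
    ((lineDerivOpCLM ℂ 𝓢(V, ℂ) m).continuous.tendsto u₀).comp hu
  have hco : ∀ (m : V) {u : ι → 𝓢(V, ℂ)} {u₀ : 𝓢(V, ℂ)}, Tendsto u l (𝓝 u₀) →
      Tendsto (fun i => coordMul m (u i)) l (𝓝 (coordMul m u₀)) := fun m u u₀ hu =>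
    ((coordMul m).continuous.tendsto u₀).comp hu
  have hd0 : ∀ m : V, ∂_{m} (0 : 𝓢(V, ℂ)) = 0 := fun m => (lineDerivOpCLM ℂ 𝓢(V, ℂ) m).map_zero
  refine schwartz_tendsto_zero_of_class (· ∈ S) ?_ ?_ ?_ (hS hu hw h)
  · intro f hf m
    induction hf using Submodule.span_induction with
    | mem f hf =>
      obtain ⟨u, w, u₀, w₀, hu, hw, h, rfl⟩ := hf
      simp only [lineDeriv_twistedProd]
      refine S.add_mem (hS (hder m hu) hw ?_) (hS hu (hder m hw) ?_)
      · exact h.imp (fun h => by rw [h, hd0]) id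
      · exact h.imp id (fun h => by rw [h, hd0])
    | zero => 
      convert S.zero_mem using 1
      ext1 i
      exact hd0 m
    | add f g _ _ hf hg =>
      convert S.add_mem hf hg using 1
      ext1 i
      exact (lineDerivOpCLM ℂ 𝓢(V, ℂ) m).map_add _ _
    | smul c f _ hf =>
      convert S.smul_mem c hf using 1
      ext1 i
      exact (lineDerivOpCLM ℂ 𝓢(V, ℂ) m).map_smul _ _
  · intro f hf m
    induction hf using Submodule.span_induction with
    | mem f hf =>
      obtain ⟨u, w, u₀, w₀, hu, hw, h, rfl⟩ := hf
      simp only [coordMul_twistedProd]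
      refine S.add_mem (hS hu (hco m hw) ?_) (S.smul_mem (2 * Real.pi * Complex.I)⁻¹
        (hS (hder (K m) hu) hw ?_))
      · exact h.imp id (fun h => by rw [h, map_zero])
      · exact h.imp (fun h => by rw [h, hd0]) id
    | zero => 
      convert S.zero_mem using 1
      ext1 i
      exact map_zero _
    | add f g _ _ hf hg =>
      convert S.add_mem hf hg using 1
      ext1 i
      exact map_add _ _ _
    | smul c f _ hf =>
      convert S.smul_mem c hf using 1
      ext1 i
      exact map_smul (coordMul m) _ _
  · intro f hf
    induction hf using Submodule.span_induction with
    | mem f hf =>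
      obtain ⟨u, w, u₀, w₀, hu, hw, h, rfl⟩ := hf
      have h1 : Continuous fun a : 𝓢(V, ℂ) => ∫ v, ‖𝓕 a v‖ := by
        have : Continuous fun a : 𝓢(V, ℂ) => ‖(𝓕 a).toLp 1‖ :=
          ((SchwartzMap.continuous_toLp (p := 1)).comp
            (FourierTransform.continuous_fourier (F := 𝓢(V, ℂ)))).norm
        simpa only [SchwartzMap.norm_toLp_one] using this
      have h2 : Continuous (SchwartzMap.seminorm ℝ 0 0 : Seminorm ℝ 𝓢(V, ℂ)) :=
        (schwartz_withSeminorms ℝ V ℂ).continuous_seminorm (0, 0)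
      have h3 := ((h1.tendsto u₀).comp hu).mul ((h2.tendsto w₀).comp hw)
      have h4 : (∫ v, ‖𝓕 u₀ v‖) * SchwartzMap.seminorm ℝ 0 0 w₀ = 0 := by
        rcases h with rfl | rfl
        · have : 𝓕 (0 : 𝓢(V, ℂ)) = 0 := (FourierTransform.fourierCLM ℂ 𝓢(V, ℂ)).map_zero
          simp [this]
        · simp
      rw [h4] at h3
      refine squeeze_zero (fun i => apply_nonneg _ _) (fun i => ?_) h3
      refine SchwartzMap.seminorm_le_bound ℝ _ _ _ (mul_nonneg (integral_nonneg fun _ => norm_nonneg _)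
        (apply_nonneg _ _)) fun x => ?_
      simpa using! norm_twisted_le K (u i) (w i) x
    | zero => simpa using tendsto_const_nhds
    | add f g _ _ hf hg =>
      refine squeeze_zero (fun i => apply_nonneg _ _) (fun i => map_add_le_add _ _ _) ?_
      simpa using hf.add hg
    | smul c f _ hf =>
      have : ∀ i, SchwartzMap.seminorm ℝ 0 0 ((c • f) i) = ‖c‖ * SchwartzMap.seminorm ℝ 0 0 (f i) :=
        fun i => map_smul_eq_mul (SchwartzMap.seminorm ℂ 0 0 : Seminorm ℂ 𝓢(V, ℂ)) c (f i)
      simp only [this]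
      simpa using hf.const_mul ‖c‖

/-- Left and right multiplication are continuous. -/
theorem continuous_twistedProd_right (a : 𝓢(V, ℂ)) : Continuous (twistedProd K hK a) := by
  let L : 𝓢(V, ℂ) →+ 𝓢(V, ℂ) := AddMonoidHom.mk' (twistedProd K hK a) (twistedProd_add_right K hK a)
  refine continuous_of_continuousAt_zero L ?_
  have : Tendsto L (𝓝 0) (𝓝 0) :=
    tendsto_twistedProd_zero K hK tendsto_const_nhds tendsto_id (Or.inr rfl)
  simpa [ContinuousAt] using this

theorem continuous_twistedProd_left (b : 𝓢(V, ℂ)) : Continuous (twistedProd K hK · b) := by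
  let L : 𝓢(V, ℂ) →+ 𝓢(V, ℂ) := AddMonoidHom.mk' (twistedProd K hK · b)
    (twistedProd_add_left K hK · · b)
  refine continuous_of_continuousAt_zero L ?_
  have : Tendsto L (𝓝 0) (𝓝 0) :=
    tendsto_twistedProd_zero K hK tendsto_id tendsto_const_nhds (Or.inl rfl)
  simpa [ContinuousAt] using this

theorem integrable_shear (f g : 𝓢(V, ℂ)) (A : V →L[ℝ] V) {φ : V × V → ℂ} (hφ : Continuous φ) {C : ℝ}
    (hC : ∀ p, ‖φ p‖ ≤ C) :
    Integrable (fun p : V × V => f p.2 * (φ p * g (p.1 + A p.2))) (volume.prod volume) := by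
  have h1 : Integrable (fun p : V × V => f p.2 * g (p.1 + A p.2)) (volume.prod volume) := by
    refine (integrable_prod_iff' (Continuous.aestronglyMeasurable (by fun_prop))).2 ⟨?_, ?_⟩
    · exact Eventually.of_forall fun v => (g.integrable.comp_add_right (A v)).const_mul (f v)
    · have : ∀ v, ∫ x, ‖f v * g (x + A v)‖ = ‖f v‖ * ∫ x, ‖g x‖ := by
        intro v
        simp_rw [norm_mul]
        rw [integral_const_mul, integral_add_right_eq_self (fun x => ‖g x‖) (A v)]
      simp only [this]
      exact f.integrable.norm.mul_const _
  refine (h1.mul_bdd hφ.aestronglyMeasurable (Eventually.of_forall hC)).congr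
    (Eventually.of_forall fun p => ?_)
  simp only; ring

theorem fourier_eq_integral_phase (f : 𝓢(V, ℂ)) (u : V) : 𝓕 f u = ∫ x, phase (-⟪x, u⟫) * f x := by
  rw [SchwartzMap.fourier_coe, Real.fourier_eq']
  congr 1; ext x
  simp [phase]

theorem inner_skew_self (K : V →L[ℝ] V) (hK : ∀ v w, ⟪K v, w⟫ = -⟪v, K w⟫) (v : V) : ⟪K v, v⟫ = 0 := by
  have := hK v v
  rw [real_inner_comm] at this
  have h2 := real_inner_comm (K v) v
  linarith

theorem fourier_twistedProd (a b : 𝓢(V, ℂ)) (u : V) :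
    𝓕 (twistedProd K hK a b) u = ∫ v, 𝓕 a v * (phase ⟪K v, u⟫ * 𝓕 b (u - v)) := by
  rw [fourier_eq_integral_phase]
  simp only [twistedProd_apply, ← integral_const_mul]
  have hi := integrable_shear (𝓕 a) b K (φ := fun p => phase (-⟪p.1, u⟫ + ⟪p.1, p.2⟫))
    (by fun_prop) (C := 1) (fun p => (norm_phase _).le)
  rw [integral_integral_swap (hi.congr (Eventually.of_forall fun p => by
    simp only [phase_add, Function.uncurry]; ring))]
  congr 1; ext v
  rw [fourier_eq_integral_phase b, ← integral_const_mul, ← integral_const_mul,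
    ← integral_add_right_eq_self (fun x => 𝓕 a v * (phase ⟪K v, u⟫ * (phase (-⟪x, u - v⟫) * b x))) (K v)]
  congr 1; ext x
  have : phase (-⟪x, u⟫) * phase ⟪x, v⟫ = phase ⟪K v, u⟫ * phase (-⟪x + K v, u - v⟫) := by
    rw [← phase_add, ← phase_add]; congr 1
    simp only [inner_add_left, inner_sub_right, inner_skew_self K hK]; ring
  linear_combination 𝓕 a v * b (x + K v) * this

theorem twistedProd_assoc (a b c : 𝓢(V, ℂ)) :
    twistedProd K hK (twistedProd K hK a b) c = twistedProd K hK a (twistedProd K hK b c) := by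
  ext x
  rw [twistedProd_apply, twistedProd_apply]
  simp only [fourier_twistedProd, twistedProd_apply K hK b c, ← integral_mul_const]
  have hi := integrable_shear (𝓕 a) (𝓕 b) (-ContinuousLinearMap.id ℝ V)
    (φ := fun p => phase ⟪K p.2, p.1⟫ * phase ⟪x, p.1⟫ * c (x + K p.1)) (by fun_prop)
    (C := SchwartzMap.seminorm ℝ 0 0 c) (fun p => by
      rw [norm_mul, norm_mul, norm_phase, norm_phase, one_mul, one_mul]
      exact c.norm_le_seminorm ℝ _)
  rw [integral_integral_swap (hi.congr (Eventually.of_forall fun p => by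
    simp [Function.uncurry, sub_eq_add_neg]; ring))]
  congr 1; ext v
  rw [← integral_const_mul, ← integral_const_mul, ← integral_add_right_eq_self _ v]
  congr 1; ext w
  have : phase ⟪K v, w + v⟫ * phase ⟪x, w + v⟫ = phase ⟪x, v⟫ * phase ⟪x + K v, w⟫ := by
    rw [← phase_add, ← phase_add]; congr 1
    simp only [inner_add_left, inner_add_right, inner_skew_self K hK]; ring
  rw [add_sub_cancel_right, K.map_add, add_comm (K w), ← add_assoc]
  linear_combination 𝓕 a v * 𝓕 b w * c (x + K v + K w) * this

theorem integral_twistedProd (a b : 𝓢(V, ℂ)) : ∫ x, twistedProd K hK a b x = ∫ x, a x * b x := by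
  have h1 : ∫ x, twistedProd K hK a b x = 𝓕 (twistedProd K hK a b) 0 := by
    rw [fourier_eq_integral_phase]; simp [phase_zero]
  have h2 : ∀ v, 𝓕 b (-v) = 𝓕⁻ b v := by
    intro v
    rw [SchwartzMap.fourier_coe, SchwartzMap.fourierInv_coe, Real.fourierInv_eq_fourier_neg]
  rw [h1, fourier_twistedProd]
  simp only [inner_zero_right, phase_zero, one_mul, zero_sub, h2]
  rw [SchwartzMap.integral_fourier_mul_eq, FourierTransform.fourier_fourierInv_eq]

theorem fourier_inversion_phase (b : 𝓢(V, ℂ)) (y : V) : ∫ w, 𝓕 b w * phase ⟪y, w⟫ = b y := by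
  conv_rhs => rw [← FourierTransform.fourierInv_fourier_eq (F := 𝓢(V, ℂ)) b]
  rw [SchwartzMap.fourierInv_coe, Real.fourierInv_eq']
  congr 1; ext w
  simp [phase, real_inner_comm, mul_comm]

theorem twisted_neg (a b : 𝓢(V, ℂ)) (x : V) :
    ∫ v, 𝓕 a v * (phase ⟪x, v⟫ * b (x - K v)) = twistedProd K hK b a x := by
  rw [twistedProd_apply]
  simp only [← fourier_inversion_phase b (x - _), ← fourier_inversion_phase a (x + _),
    ← integral_const_mul]
  have hi : Integrable (fun p : V × V => 𝓕 a p.1 * (phase ⟪x, p.1⟫ * (𝓕 b p.2 *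
      phase ⟪x - K p.1, p.2⟫))) (volume.prod volume) := by
    refine (((𝓕 a).integrable.mul_prod (𝓕 b).integrable).mul_bdd
      (g := fun p : V × V => phase ⟪x, p.1⟫ * phase ⟪x - K p.1, p.2⟫) (c := 1)
      (Continuous.aestronglyMeasurable (by fun_prop))
      (Eventually.of_forall fun p => ?_)).congr (Eventually.of_forall fun p => ?_)
    · rw [norm_mul, norm_phase, norm_phase, one_mul]
    · simp only; ring
  rw [integral_integral_swap hi]
  congr 1; ext w
  congr 1; ext v
  have : phase ⟪x, v⟫ * phase ⟪x - K v, w⟫ = phase ⟪x, w⟫ * phase ⟪x + K w, v⟫ := by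
    rw [← phase_add, ← phase_add]; congr 1
    have := hK v w
    rw [real_inner_comm] at this
    simp only [inner_add_left, inner_sub_left]
    linarith [real_inner_comm w (K v), hK v w, hK w v, real_inner_comm v (K w)]
  linear_combination 𝓕 a v * 𝓕 b w * this

/-- Complex conjugation on Schwartz space. -/
def schwartzConj : 𝓢(V, ℂ) →L[ℝ] 𝓢(V, ℂ) :=
  SchwartzMap.postcompCLM (𝕜 := ℝ) (Complex.conjCLE : ℂ →L[ℝ] ℂ)

theorem schwartzConj_apply (a : 𝓢(V, ℂ)) (x : V) : schwartzConj a x = star (a x) := by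
  simp [schwartzConj]

theorem star_phase (t : ℝ) : star (phase t) = phase (-t) := by
  simp only [phase, RCLike.star_def, ← Complex.exp_conj, map_mul, Complex.conj_ofReal, Complex.conj_I]
  congr 1; push_cast; ring

theorem fourier_schwartzConj (a : 𝓢(V, ℂ)) (v : V) :
    𝓕 (schwartzConj a) v = star (𝓕 a (-v)) := by
  rw [fourier_eq_integral_phase, fourier_eq_integral_phase]
  simp only [schwartzConj_apply]
  change _ = (starRingEnd ℂ) _
  rw [← integral_conj]
  congr 1; ext x
  rw [map_mul, inner_neg_right, neg_neg, ← star_phase]; rfl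

theorem schwartzConj_twistedProd (a b : 𝓢(V, ℂ)) :
    schwartzConj (twistedProd K hK a b) =
      twistedProd K hK (schwartzConj b) (schwartzConj a) := by
  ext x
  rw [← twisted_neg, schwartzConj_apply, twistedProd_apply]
  simp only [fourier_schwartzConj, schwartzConj_apply]
  rw [← integral_neg_eq_self]
  change (starRingEnd ℂ) _ = _
  rw [← integral_conj]
  congr 1; ext v
  have := star_phase ⟪x, -v⟫
  simp only [inner_neg_right, neg_neg] at this
  simp only [map_mul, ← this, RCLike.star_def, map_neg, inner_neg_right, sub_eq_add_neg]

/-- Dilation of a Schwartz function by a nonzero factor. -/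
def dilate (ε : ℝˣ) : 𝓢(V, ℂ) →L[ℂ] 𝓢(V, ℂ) :=
  SchwartzMap.compCLMOfContinuousLinearEquiv ℂ (ContinuousLinearEquiv.smulLeft ε)

theorem dilate_apply (ε : ℝˣ) (f : 𝓢(V, ℂ)) (x : V) : dilate ε f x = f ((ε : ℝ) • x) := rfl

theorem lineDeriv_dilate (ε : ℝˣ) (f : 𝓢(V, ℂ)) (m : V) :
    ∂_{m} (dilate ε f) = ((ε : ℝ) : ℂ) • dilate ε (∂_{m} f) := by
  ext x
  rw [SchwartzMap.lineDerivOp_apply_eq_fderiv, smul_apply, dilate_apply,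
    SchwartzMap.lineDerivOp_apply_eq_fderiv]
  have h := (f.hasFDerivAt ((ε : ℝ) • x)).comp x ((hasFDerivAt_id x).const_smul (ε : ℝ))
  have h2 : HasFDerivAt (dilate ε f) _ x := h
  rw [h2.fderiv]
  simp

theorem twistedProd_dilate (ε : ℝˣ) (a b : 𝓢(V, ℂ)) (x : V) :
    twistedProd K hK (dilate ε a) b x =
      ∫ v, 𝓕 a v * (phase ((ε : ℝ) * ⟪x, v⟫) * b (x + (ε : ℝ) • K v)) := by
  have hε : (ε : ℝ) ≠ 0 := ε.ne_zero
  set c : ℝ := |((ε : ℝ) ^ Module.finrank ℝ V)⁻¹| with hc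
  have hc0 : c ≠ 0 := by simp [hc]
  have h1 : ∀ v, 𝓕 a v = (c : ℂ)⁻¹ * 𝓕 (dilate ε a) ((ε : ℝ) • v) := by
    intro v
    rw [fourier_eq_integral_phase, fourier_eq_integral_phase]
    have := Measure.integral_comp_smul (volume : Measure V) (fun x => phase (-⟪x, v⟫) * a x) (ε : ℝ)
    rw [← hc] at this
    have h3 : ∀ x : V, phase (-⟪x, (ε : ℝ) • v⟫) * dilate ε a x =
        phase (-⟪(ε : ℝ) • x, v⟫) * a ((ε : ℝ) • x) := by
      intro x; rw [dilate_apply, inner_smul_left, inner_smul_right]; simp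
    simp only [h3, this, Complex.real_smul]
    rw [inv_mul_cancel_left₀ (by exact_mod_cast hc0)]
  rw [twistedProd_apply]
  have := Measure.integral_comp_smul (volume : Measure V)
    (fun v => 𝓕 (dilate ε a) v * (phase ⟪x, v⟫ * b (x + K v))) (ε : ℝ)
  rw [← hc] at this
  simp only [h1, mul_assoc]
  rw [integral_const_mul]
  simp only [inner_smul_right, K.map_smul] at this
  rw [this, Complex.real_smul, inv_mul_cancel_left₀ (by exact_mod_cast hc0)]

theorem norm_phase_sub_one_le (t : ℝ) : ‖phase t - 1‖ ≤ 2 * Real.pi * |t| := by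
  have := Real.norm_exp_I_mul_ofReal_sub_one_le (x := 2 * Real.pi * t)
  rw [mul_comm Complex.I] at this
  refine this.trans ?_
  rw [Real.norm_eq_abs, abs_mul, abs_of_pos Real.two_pi_pos]

theorem norm_twistedProd_dilate_sub (a b : 𝓢(V, ℂ)) : ∃ C : ℝ, ∀ (ε : ℝˣ) (x : V),
    ‖twistedProd K hK (dilate ε a) b x - a 0 * b x‖ ≤ |(ε : ℝ)| * C := by
  set p10 := SchwartzMap.seminorm ℝ 1 0 b
  set p01 := SchwartzMap.seminorm ℝ 0 1 b
  refine ⟨∫ v, ‖v‖ ^ 1 * ‖𝓕 a v‖ * (2 * Real.pi * p10 + ‖K‖ * p01), fun ε x => ?_⟩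
  have h0 : a 0 * b x = ∫ v, 𝓕 a v * b x := by
    rw [integral_mul_const]
    congr 1
    simpa [phase_zero] using (fourier_inversion_phase a 0).symm
  have hi1 : Integrable fun v => 𝓕 a v * (phase ((ε : ℝ) * ⟪x, v⟫) * b (x + (ε : ℝ) • K v)) := by
    refine schwartz_integrable_mul (𝓕 a) (by fun_prop) (C := SchwartzMap.seminorm ℝ 0 0 b) fun v => ?_
    rw [norm_mul, norm_phase, one_mul]; exact b.norm_le_seminorm ℝ _
  rw [twistedProd_dilate, h0, ← integral_sub hi1 ((𝓕 a).integrable.mul_const _), ← integral_const_mul]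
  refine norm_integral_le_of_norm_le ((((𝓕 a).integrable_pow_mul volume 1).mul_const _).const_mul _)
    (Eventually.of_forall fun v => ?_)
  have hx : ⟪x, v⟫ = ⟪x + (ε : ℝ) • K v, v⟫ := by
    rw [inner_add_left, inner_smul_left, inner_skew_self K hK]; simp
  set y := x + (ε : ℝ) • K v with hy
  have e1 : ‖(phase ((ε : ℝ) * ⟪x, v⟫) - 1) * b y‖ ≤ |(ε : ℝ)| * (‖v‖ * (2 * Real.pi * p10)) := by
    rw [norm_mul]
    calc _ ≤ 2 * Real.pi * |(ε : ℝ) * ⟪x, v⟫| * ‖b y‖ := by gcongr; exact norm_phase_sub_one_le _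
      _ ≤ 2 * Real.pi * (|(ε : ℝ)| * (‖y‖ * ‖v‖)) * ‖b y‖ := by
        rw [abs_mul, hx]; gcongr; exact abs_real_inner_le_norm _ _
      _ = |(ε : ℝ)| * (‖v‖ * (2 * Real.pi * (‖y‖ ^ 1 * ‖b y‖))) := by ring
      _ ≤ _ := by gcongr; exact b.norm_pow_mul_le_seminorm ℝ 1 y
  have e2 : ‖b y - b x‖ ≤ |(ε : ℝ)| * (‖v‖ * (‖K‖ * p01)) := by
    have := Convex.norm_image_sub_le_of_norm_fderiv_le (𝕜 := ℝ) (f := b) (s := Set.univ) (C := p01)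
      (x := x) (y := y) (fun z _ => b.differentiableAt) (fun z _ => by
        have := b.norm_iteratedFDeriv_le_seminorm ℝ 1 z
        rwa [norm_iteratedFDeriv_one] at this) convex_univ trivial trivial
    refine this.trans ?_
    rw [hy, add_sub_cancel_left, norm_smul, Real.norm_eq_abs]
    calc p01 * (|(ε : ℝ)| * ‖K v‖) ≤ p01 * (|(ε : ℝ)| * (‖K‖ * ‖v‖)) := by
          gcongr
          exact K.le_opNorm v
      _ = _ := by ring
  have e3 : 𝓕 a v * (phase ((ε : ℝ) * ⟪x, v⟫) * b y) - 𝓕 a v * b x =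
      𝓕 a v * ((phase ((ε : ℝ) * ⟪x, v⟫) - 1) * b y + (b y - b x)) := by ring
  rw [e3, norm_mul]
  calc _ ≤ ‖𝓕 a v‖ * (|(ε : ℝ)| * (‖v‖ * (2 * Real.pi * p10)) + |(ε : ℝ)| * (‖v‖ * (‖K‖ * p01))) := by
        gcongr
        exact (norm_add_le _ _).trans (add_le_add e1 e2)
    _ = _ := by ring

/-- Dilating a Schwartz function with value one at the origin yields approximate units. -/
theorem tendsto_twistedProd_dilate (ε : ℕ → ℝˣ) (hε : Tendsto (fun n => (ε n : ℝ)) atTop (𝓝 0))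
    (χ b : 𝓢(V, ℂ)) (hχ : χ 0 = 1) :
    Tendsto (fun n => twistedProd K hK (dilate (ε n) χ) b) atTop (𝓝 b) := by
  let G : Set (ℕ → 𝓢(V, ℂ)) := {f | (∃ (a b : 𝓢(V, ℂ)) (c : ℕ → ℂ) (C : ℝ), (∀ n, ‖c n‖ ≤ C) ∧
    f = fun n => c n • (twistedProd K hK (dilate (ε n) a) b - a 0 • b)) ∨
    ∃ (b : 𝓢(V, ℂ)) (c : ℕ → ℂ), Tendsto c atTop (𝓝 0) ∧ f = fun n => c n • b}
  let S : AddSubmonoid (ℕ → 𝓢(V, ℂ)) := AddSubmonoid.closure G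
  have hε' : Tendsto (fun n => ((ε n : ℝ) : ℂ)) atTop (𝓝 0) := by
    simpa using! (Complex.continuous_ofReal.tendsto 0).comp hε
  obtain ⟨E, hE⟩ : ∃ E, ∀ n, ‖((ε n : ℝ) : ℂ)‖ ≤ E := by
    obtain ⟨E, hE⟩ := hε'.norm.bddAbove_range
    exact ⟨E, fun n => hE ⟨n, rfl⟩⟩
  have hE0 : 0 ≤ E := (norm_nonneg _).trans (hE 0)
  have S1 : ∀ (a b : 𝓢(V, ℂ)) (c : ℕ → ℂ) (C : ℝ), (∀ n, ‖c n‖ ≤ C) →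
      (fun n => c n • (twistedProd K hK (dilate (ε n) a) b - a 0 • b)) ∈ S := fun a b c C hC =>
    AddSubmonoid.subset_closure (Or.inl ⟨a, b, c, C, hC, rfl⟩)
  have S2 : ∀ (b : 𝓢(V, ℂ)) (c : ℕ → ℂ), Tendsto c atTop (𝓝 0) → (fun n => c n • b) ∈ S :=
    fun b c hc => AddSubmonoid.subset_closure (Or.inr ⟨b, c, hc, rfl⟩)
  have S3 : ∀ (a b : 𝓢(V, ℂ)) (c : ℕ → ℂ) (C : ℝ), (∀ n, ‖c n‖ ≤ C) →
      (fun n => (c n * ((ε n : ℝ) : ℂ)) • (twistedProd K hK (dilate (ε n) a) b)) ∈ S := by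
    intro a b c C hC
    convert S.add_mem (S1 a b (fun n => c n * ((ε n : ℝ) : ℂ)) (C * E) fun n => by
        rw [norm_mul]
        exact mul_le_mul (hC n) (hE n) (norm_nonneg _) ((norm_nonneg _).trans (hC n)))
      (S2 b (fun n => c n * ((ε n : ℝ) : ℂ) * a 0) ?_) using 1
    · ext1 n
      simp [smul_sub, smul_smul]
    · have h1 : Tendsto (fun n => c n * ((ε n : ℝ) : ℂ)) atTop (𝓝 0) := by
        refine squeeze_zero_norm (fun n => ?_) (by simpa using hε'.norm.const_mul C)
        rw [norm_mul]; exact (mul_le_mul_of_nonneg_right (hC n) (norm_nonneg ((ε n : ℝ) : ℂ))).trans_eq (by simp)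
      simpa using h1.mul_const (a 0)
  rw [← tendsto_sub_nhds_zero_iff]
  refine schwartz_tendsto_zero_of_class (· ∈ S) ?_ ?_ ?_ ?_
  · intro f hf m
    induction hf using AddSubmonoid.closure_induction with
    | mem f hf =>
      rcases hf with ⟨a, b, c, C, hC, rfl⟩ | ⟨b, c, hc, rfl⟩
      · convert S.add_mem (S3 (∂_{m} a) b c C hC) (S1 a (∂_{m} b) c C hC) using 1
        ext1 n
        have h : lineDerivOpCLM ℂ 𝓢(V, ℂ) m (c n • (twistedProd K hK (dilate (ε n) a) b - a 0 • b)) =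
            c n • (lineDerivOpCLM ℂ 𝓢(V, ℂ) m (twistedProd K hK (dilate (ε n) a) b) -
              a 0 • lineDerivOpCLM ℂ 𝓢(V, ℂ) m b) := by rw [map_smul, map_sub, map_smul]
        simp only [lineDerivOpCLM_apply] at h
        refine h.trans ?_
        rw [lineDeriv_twistedProd, lineDeriv_dilate, twistedProd_smul_left]
        simp only [Pi.add_apply, smul_sub, smul_add, smul_smul]
        abel
      · convert S2 (∂_{m} b) c hc using 1
        ext1 n
        exact (lineDerivOpCLM ℂ 𝓢(V, ℂ) m).map_smul (c n) b
    | zero => 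
      convert S.zero_mem using 1
      ext1 i
      exact (lineDerivOpCLM ℂ 𝓢(V, ℂ) m).map_zero
    | add f g _ _ hf hg =>
      convert S.add_mem hf hg using 1
      ext1 i
      exact (lineDerivOpCLM ℂ 𝓢(V, ℂ) m).map_add _ _
  · intro f hf m
    induction hf using AddSubmonoid.closure_induction with
    | mem f hf =>
      rcases hf with ⟨a, b, c, C, hC, rfl⟩ | ⟨b, c, hc, rfl⟩
      · convert S.add_mem (S3 (∂_{K m} a) b (fun n => c n * (2 * Real.pi * Complex.I)⁻¹)
          (C * ‖(2 * Real.pi * Complex.I : ℂ)⁻¹‖) fun n => by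
            rw [norm_mul]; gcongr; exact hC n) (S1 a (coordMul m b) c C hC) using 1
        ext1 n
        simp only [map_smul, map_sub, coordMul_twistedProd, lineDeriv_dilate, twistedProd_smul_left,
          Pi.add_apply, smul_sub, smul_add, smul_smul]
        abel_nf
        simp only [mul_comm, mul_left_comm]
        abel
      · convert S2 (coordMul m b) c hc using 1
        ext1 n
        exact map_smul (coordMul m) (c n) b
    | zero => 
      convert S.zero_mem using 1
      ext1 i
      exact map_zero _
    | add f g _ _ hf hg =>
      convert S.add_mem hf hg using 1
      ext1 i
      exact map_add _ _ _
  · intro f hf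
    induction hf using AddSubmonoid.closure_induction with
    | mem f hf =>
      rcases hf with ⟨a, b, c, C, hC, rfl⟩ | ⟨b, c, hc, rfl⟩
      · obtain ⟨D, hD⟩ := norm_twistedProd_dilate_sub K hK a b
        have hD0 : 0 ≤ D := by
          have := (norm_nonneg _).trans (hD 1 0)
          simpa using this
        have hC0 : 0 ≤ C := (norm_nonneg _).trans (hC 0)
        have hlim : Tendsto (fun n => C * (|(ε n : ℝ)| * D)) atTop (𝓝 0) := by
          simpa using (hε.abs.mul_const D).const_mul C
        refine squeeze_zero (fun i => apply_nonneg _ _) (fun n => ?_) hlim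
        refine SchwartzMap.seminorm_le_bound ℝ _ _ _ (by positivity) fun x => ?_
        rw [pow_zero, one_mul, norm_iteratedFDeriv_zero, smul_apply, norm_smul, sub_apply, smul_apply,
          smul_eq_mul]
        exact mul_le_mul (hC n) (hD (ε n) x) (norm_nonneg _) hC0
      · have : ∀ n, SchwartzMap.seminorm ℝ 0 0 (c n • b) = ‖c n‖ * SchwartzMap.seminorm ℝ 0 0 b :=
          fun n => map_smul_eq_mul (SchwartzMap.seminorm ℂ 0 0 : Seminorm ℂ 𝓢(V, ℂ)) (c n) b
        simp only [this]
        simpa using hc.norm.mul_const (SchwartzMap.seminorm ℝ 0 0 b)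
    | zero => simp
    | add f g _ _ hf hg =>
      refine squeeze_zero (fun i => apply_nonneg _ _) (fun i => map_add_le_add _ _ _) ?_
      simpa using hf.add hg
  · have := S1 χ b (fun _ => 1) 1 (by simp)
    simpa [hχ] using this

variable (V) in
/-- Existence of approximate units for the twisted product. -/
theorem exists_approx_unit : ∃ u : ℕ → 𝓢(V, ℂ), ∀ (K : V →L[ℝ] V)
    (hK : ∀ v w, ⟪K v, w⟫ = -⟪v, K w⟫) (b : 𝓢(V, ℂ)),
    Tendsto (fun n => twistedProd K hK (u n) b) atTop (𝓝 b) ∧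
    Tendsto (fun n => twistedProd K hK b (schwartzConj (u n))) atTop (𝓝 b) := by
  obtain ⟨χ, hχ⟩ : ∃ χ : 𝓢(V, ℂ), χ 0 = 1 := by
    let f : ContDiffBump (0 : V) := ⟨1, 2, one_pos, one_lt_two⟩
    have hs : HasCompactSupport fun x => ((f x : ℝ) : ℂ) :=
      f.hasCompactSupport.comp_left (g := fun t : ℝ => (t : ℂ)) (by simp)
    refine ⟨hs.toSchwartzMap (Complex.ofRealCLM.contDiff.comp f.contDiff), ?_⟩
    have : f 0 = 1 := f.one_of_mem_closedBall (by simp [f])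
    change ((f 0 : ℝ) : ℂ) = 1
    rw [this]; simp
  let ε : ℕ → ℝˣ := fun n => Units.mk0 (1 / ((n : ℝ) + 1)) (by positivity)
  have hε : Tendsto (fun n => (ε n : ℝ)) atTop (𝓝 0) := tendsto_one_div_add_atTop_nhds_zero_nat
  refine ⟨fun n => dilate (ε n) χ, fun K hK b => ⟨tendsto_twistedProd_dilate K hK ε hε χ b hχ, ?_⟩⟩
  have h := (schwartzConj.continuous.tendsto _).comp
    (tendsto_twistedProd_dilate K hK ε hε χ (schwartzConj b) hχ)
  have hcc : ∀ b : 𝓢(V, ℂ), schwartzConj (schwartzConj b) = b := by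
    intro b; ext x; simp [schwartzConj_apply]
  simpa only [Function.comp_def, schwartzConj_twistedProd, hcc] using h

theorem exists_schwartz_tsum (d : ℕ → 𝓢(V, ℂ))
    (hd : ∀ k n, Summable fun i => SchwartzMap.seminorm ℝ k n (d i)) :
    ∃ s : 𝓢(V, ℂ), (∀ x, s x = ∑' i, d i x) ∧
      ∀ k n, SchwartzMap.seminorm ℝ k n s ≤ ∑' i, SchwartzMap.seminorm ℝ k n (d i) := by
  have hdec : ∀ k n x, ‖x‖ ^ k * ‖iteratedFDeriv ℝ n (fun x => ∑' i, d i x) x‖ ≤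
      ∑' i, SchwartzMap.seminorm ℝ k n (d i) := by
    intro k n x
    rw [iteratedFDeriv_tsum_apply (N := ⊤) (fun i => (d i).smooth ⊤) (fun n _ => hd 0 n)
      (fun n i x _ => (d i).norm_iteratedFDeriv_le_seminorm ℝ n x) le_top]
    have hs : Summable fun i => ‖iteratedFDeriv ℝ n (d i) x‖ :=
      Summable.of_nonneg_of_le (fun _ => norm_nonneg _)
        (fun i => (d i).norm_iteratedFDeriv_le_seminorm ℝ n x) (hd 0 n)
    calc _ ≤ ‖x‖ ^ k * ∑' i, ‖iteratedFDeriv ℝ n (d i) x‖ := by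
          gcongr; exact norm_tsum_le_tsum_norm hs
      _ = ∑' i, ‖x‖ ^ k * ‖iteratedFDeriv ℝ n (d i) x‖ := tsum_mul_left.symm
      _ ≤ _ := Summable.tsum_le_tsum (fun i => (d i).le_seminorm ℝ k n x) (hs.mul_left _) (hd k n)
  refine ⟨⟨fun x => ∑' i, d i x, contDiff_tsum (N := ⊤) (fun i => (d i).smooth ⊤) (fun n _ => hd 0 n)
      (fun n i x _ => (d i).norm_iteratedFDeriv_le_seminorm ℝ n x), fun k n => ⟨_, hdec k n⟩⟩,
    fun x => rfl, fun k n => SchwartzMap.seminorm_le_bound ℝ _ _ _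
      (tsum_nonneg fun i => apply_nonneg _ _) (hdec k n)⟩

/-- Schwartz space is complete. -/
instance schwartz_completeSpace : CompleteSpace 𝓢(V, ℂ) := by
  have : (uniformity 𝓢(V, ℂ)).IsCountablyGenerated := IsUniformAddGroup.uniformity_countably_generated
  let p : ℕ → Seminorm ℝ 𝓢(V, ℂ) := fun N =>
    (Finset.range (N + 1) ×ˢ Finset.range (N + 1)).sup (schwartzSeminormFamily ℝ V ℂ)
  have hp : ∀ k n N, k ≤ N → n ≤ N → ∀ f, SchwartzMap.seminorm ℝ k n f ≤ p N f := by
    intro k n N hk hn f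
    exact Seminorm.le_finset_sup_apply (p := schwartzSeminormFamily ℝ V ℂ) (i := (k, n))
      (by simp; omega)
  refine UniformSpace.complete_of_convergent_controlled_sequences
    (fun N => {q | p N (q.2 - q.1) < (1 / 2) ^ N}) (fun N => ?_) fun u hu => ?_
  · rw [uniformity_eq_comap_nhds_zero]
    refine ⟨{f | p N f < (1 / 2) ^ N}, ?_, fun q hq => hq⟩
    have hc : Continuous (p N) := by
      refine Seminorm.continuous_finsetSup ?_
      exact fun i _ => (schwartz_withSeminorms ℝ V ℂ).continuous_seminorm i
    exact (isOpen_lt hc continuous_const).mem_nhds (by simp)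
  · let d : ℕ → 𝓢(V, ℂ) := fun n => u (n + 1) - u n
    have hd : ∀ k n, Summable fun i => SchwartzMap.seminorm ℝ k n (d i) := by
      intro k n
      rw [← summable_nat_add_iff (max k n)]
      refine Summable.of_nonneg_of_le (fun _ => apply_nonneg _ _) (fun i => ?_)
        ((summable_nat_add_iff (max k n)).2 summable_geometric_two)
      refine (hp k n (i + max k n) (by omega) (by omega) _).trans (le_of_lt ?_)
      exact hu (i + max k n) (i + max k n) (i + max k n + 1) le_rfl (by omega)
    obtain ⟨s, hs, -⟩ := exists_schwartz_tsum d hd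
    refine ⟨u 0 + s, ?_⟩
    have ht : ∀ N, ∀ k n, SchwartzMap.seminorm ℝ k n (u N - (u 0 + s)) ≤
        ∑' i, SchwartzMap.seminorm ℝ k n (d (i + N)) := by
      intro N k n
      obtain ⟨t, ht, hb⟩ := exists_schwartz_tsum (fun i => d (i + N))
        (fun k n => (summable_nat_add_iff N).2 (hd k n))
      have : u N - (u 0 + s) = -t := by
        ext x
        have hsx : Summable fun i => d i x := Summable.of_norm_bounded (hd 0 0)
          fun i => (d i).norm_le_seminorm ℝ x
        have h1 := hsx.sum_add_tsum_nat_add N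
        have h2 : ∑ i ∈ Finset.range N, d i x = u N x - u 0 x := by
          have := Finset.sum_range_sub (fun i => u i x) N
          simpa [d] using this
        rw [h2, ← hs, ← ht] at h1
        simp only [sub_apply, add_apply, neg_apply]
        linear_combination h1
      rw [this, map_neg_eq_map]
      exact hb k n
    rw [(schwartz_withSeminorms ℝ V ℂ).tendsto_nhds]
    rintro ⟨k, n⟩ ε hε
    have := tendsto_sum_nat_add fun i => SchwartzMap.seminorm ℝ k n (d i)
    filter_upwards [this.eventually (gt_mem_nhds hε)] with N hN
    exact (ht N k n).trans_lt hN

instance schwartz_barrelledSpace : BarrelledSpace ℂ 𝓢(V, ℂ) := by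
  have : (uniformity 𝓢(V, ℂ)).IsCountablyGenerated := IsUniformAddGroup.uniformity_countably_generated
  have : BaireSpace 𝓢(V, ℂ) := inferInstance
  infer_instance

end TwistedProduct

/-! ### The Moyal product on Schwartz space -/

section Moyal

/-- Index set of the coordinates of `ℝ^{2N}`, grouped in `N` pairs. -/
abbrev MoyalIndex (N : ℕ) := Fin 2 × Fin N

/-- The underlying space `ℝ^{2N}`. -/
abbrev MoyalSpace (N : ℕ) := EuclideanSpace ℝ (MoyalIndex N)

/-- The matrix `Θ = θ diag(J, …, J)` with `J = (0, -1; 1, 0)`. -/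
def thetaMatrix (N : ℕ) (θ : ℝ) : Matrix (MoyalIndex N) (MoyalIndex N) ℝ :=
  θ • Matrix.blockDiagonal fun _ : Fin N => !![0, -1; 1, 0]

/-- The integral `(πθ)^{-2N} ∫∫ a(x+y) b(x+z) exp(-2i y Θ⁻¹ z) dy dz` defining the Moyal product. -/
def moyalIntegral {N : ℕ} (θ : ℝ) (a b : MoyalSpace N → ℂ) (x : MoyalSpace N) : ℂ :=
  (1 / (Real.pi * θ) ^ (2 * N) : ℝ) * ∫ y : MoyalSpace N, ∫ z : MoyalSpace N,
    a (x + y) * b (x + z) *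
      Complex.exp (-Complex.I * ((2 * (y.ofLp ⬝ᵥ (thetaMatrix N θ)⁻¹.mulVec z.ofLp) : ℝ) : ℂ))

variable {N : ℕ} (θ : ℝ)

theorem thetaMatrix_transpose : (thetaMatrix N θ).transpose = -thetaMatrix N θ := by
  have : (!![0, -1; 1, 0] : Matrix (Fin 2) (Fin 2) ℝ).transpose = -!![0, -1; 1, 0] := by
    ext i j; fin_cases i <;> fin_cases j <;> simp
  rw [thetaMatrix, Matrix.transpose_smul, Matrix.blockDiagonal_transpose, this, ← smul_neg,
    ← Matrix.blockDiagonal_neg]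
  rfl

theorem thetaMatrix_det : (thetaMatrix N θ).det = θ ^ (2 * N) := by
  simp [thetaMatrix, Matrix.det_fin_two_of, Matrix.det_blockDiagonal]

theorem thetaMatrix_isUnit_det [NeZero θ] : IsUnit (thetaMatrix N θ).det := by
  rw [thetaMatrix_det]; exact (pow_ne_zero _ (NeZero.ne θ)).isUnit

variable (N) in
/-- The skew-symmetric map `πΘ`. -/
def piTheta : MoyalSpace N →L[ℝ] MoyalSpace N :=
  Matrix.toEuclideanCLM (𝕜 := ℝ) (Real.pi • thetaMatrix N θ)

theorem piTheta_ofLp (v : MoyalSpace N) :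
    (piTheta N θ v).ofLp = Real.pi • (thetaMatrix N θ).mulVec v.ofLp := by
  simp [piTheta]

theorem piTheta_skew (v w : MoyalSpace N) : ⟪piTheta N θ v, w⟫ = -⟪v, piTheta N θ w⟫ := by
  simp only [EuclideanSpace.inner_eq_star_dotProduct, piTheta_ofLp, star_trivial]
  rw [dotProduct_smul, smul_dotProduct, Matrix.dotProduct_mulVec, ← Matrix.mulVec_transpose,
    thetaMatrix_transpose, Matrix.neg_mulVec, neg_dotProduct]
  simp

theorem piTheta_det : LinearMap.det (piTheta N θ : MoyalSpace N →ₗ[ℝ] MoyalSpace N) =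
    (Real.pi * θ) ^ (2 * N) := by
  have : (piTheta N θ : MoyalSpace N →ₗ[ℝ] MoyalSpace N) =
      Matrix.toLin (EuclideanSpace.basisFun _ ℝ).toBasis (EuclideanSpace.basisFun _ ℝ).toBasis
        (Real.pi • thetaMatrix N θ) := by
    rw [piTheta, Matrix.coe_toEuclideanCLM_eq_toEuclideanLin, Matrix.toEuclideanLin_eq_toLin_orthonormal]
  rw [this, LinearMap.det_toLin, Matrix.det_smul, thetaMatrix_det, mul_pow]
  simp [mul_comm]

theorem moyalIntegral_eq_twisted [NeZero θ] (a b : 𝓢(MoyalSpace N, ℂ)) (x : MoyalSpace N) :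
    moyalIntegral θ a b x = twisted (piTheta N θ) a b x := by
  set G : MoyalSpace N → MoyalSpace N → ℂ := fun y z => a (x + y) * b (x + z) *
      Complex.exp (-Complex.I * ((2 * (y.ofLp ⬝ᵥ (thetaMatrix N θ)⁻¹.mulVec z.ofLp) : ℝ) : ℂ)) with hG
  have hint : Integrable (Function.uncurry G) (volume.prod volume) := by
    have h1 : Integrable fun p : MoyalSpace N × MoyalSpace N => a (x + p.1) * b (x + p.2) :=
      (a.integrable.comp_add_left x).mul_prod (b.integrable.comp_add_left x)
    refine h1.mul_bdd (c := 1) (Continuous.aestronglyMeasurable ?_) (Eventually.of_forall fun p => ?_)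
    · have hp : Continuous fun p : MoyalSpace N × MoyalSpace N =>
          (p.1.ofLp ⬝ᵥ (thetaMatrix N θ)⁻¹.mulVec p.2.ofLp) := by
        refine Continuous.dotProduct (by fun_prop) (Continuous.matrix_mulVec (by fun_prop) (by fun_prop))
      fun_prop
    · rw [neg_mul, ← mul_neg, ← Complex.ofReal_neg, mul_comm, Complex.norm_exp_ofReal_mul_I]
  have hdet : LinearMap.det (piTheta N θ : MoyalSpace N →ₗ[ℝ] MoyalSpace N) ≠ 0 := by
    rw [piTheta_det]; exact pow_ne_zero _ (mul_ne_zero Real.pi_ne_zero (NeZero.ne θ))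
  have hpos : (0 : ℝ) < (Real.pi * θ) ^ (2 * N) := by
    rw [pow_mul]; exact pow_pos (sq_pos_of_ne_zero (mul_ne_zero Real.pi_ne_zero (NeZero.ne θ))) _
  have hsub : ∀ H : MoyalSpace N → ℂ, ∫ v, H (piTheta N θ v) =
      (1 / (Real.pi * θ) ^ (2 * N) : ℝ) * ∫ z, H z := by
    intro H
    have h1 := Measure.map_linearMap_addHaar_eq_smul_addHaar (volume : Measure (MoyalSpace N)) hdet
    let e : MoyalSpace N ≃L[ℝ] MoyalSpace N :=
      (LinearMap.equivOfDetNeZero _ hdet).toContinuousLinearEquiv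
    have he : MeasurableEmbedding (piTheta N θ : MoyalSpace N → MoyalSpace N) :=
      e.toHomeomorph.measurableEmbedding
    have h2 := he.integral_map (μ := volume) H
    rw [← h2]
    have h3 : Measure.map (piTheta N θ) volume =
        ENNReal.ofReal |((Real.pi * θ) ^ (2 * N))⁻¹| • (volume : Measure (MoyalSpace N)) := by
      rw [← piTheta_det]; exact h1
    rw [h3, integral_smul_measure, ENNReal.toReal_ofReal (abs_nonneg _), abs_of_pos (inv_pos.2 hpos),
      Complex.real_smul, one_div]
  have hstep : moyalIntegral θ a b x = ∫ v, ∫ y, G y (piTheta N θ v) := by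
    rw [hsub fun z => ∫ y, G y z, ← integral_integral_swap hint]
    rfl
  rw [hstep]
  unfold twisted
  congr 1; ext v
  have hph : ∀ y : MoyalSpace N, Complex.exp (-Complex.I * ((2 * (y.ofLp ⬝ᵥ
      (thetaMatrix N θ)⁻¹.mulVec (piTheta N θ v).ofLp) : ℝ) : ℂ)) = phase (-⟪y, v⟫) := by
    intro y
    rw [piTheta_ofLp, Matrix.mulVec_smul, Matrix.mulVec_mulVec,
      Matrix.nonsing_inv_mul _ (thetaMatrix_isUnit_det θ), Matrix.one_mulVec, dotProduct_smul, phase,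
      real_inner_comm, EuclideanSpace.inner_eq_star_dotProduct, star_trivial]
    congr 1
    push_cast [smul_eq_mul]
    ring
  simp only [hG, hph]
  rw [fourier_eq_integral_phase, ← integral_mul_const,
    ← integral_add_left_eq_self (fun y => phase (-⟪y, v⟫) * a y * (phase ⟪x, v⟫ * b (x + piTheta N θ v))) x]
  congr 1; ext y
  have : phase (-⟪x + y, v⟫) * phase ⟪x, v⟫ = phase (-⟪y, v⟫) := by
    rw [← phase_add]; congr 1; rw [inner_add_left]; ring
  rw [← this]; ring

/-- The Moyal product on Schwartz space. -/
def moyalStar [NeZero θ] (a b : 𝓢(MoyalSpace N, ℂ)) : 𝓢(MoyalSpace N, ℂ) where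
  toFun := moyalIntegral θ a b
  smooth' := by
    rw [funext (moyalIntegral_eq_twisted θ a b)]
    exact (twisted_schwartz _ (piTheta_skew θ) a b).1
  decay' := by
    rw [funext (moyalIntegral_eq_twisted θ a b)]
    exact (twisted_schwartz _ (piTheta_skew θ) a b).2

variable [NeZero θ]

theorem moyalStar_eq (a b : 𝓢(MoyalSpace N, ℂ)) :
    moyalStar θ a b = twistedProd (piTheta N θ) (piTheta_skew θ) a b := by
  ext x; exact moyalIntegral_eq_twisted θ a b x

theorem moyalStar_assoc (a b c : 𝓢(MoyalSpace N, ℂ)) :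
    moyalStar θ (moyalStar θ a b) c = moyalStar θ a (moyalStar θ b c) := by
  simp only [moyalStar_eq, twistedProd_assoc]

theorem integral_moyalStar (a b : 𝓢(MoyalSpace N, ℂ)) :
    ∫ x, moyalStar θ a b x = ∫ x, a x * b x := by
  rw [moyalStar_eq, integral_twistedProd]

theorem schwartzConj_moyalStar (a b : 𝓢(MoyalSpace N, ℂ)) :
    schwartzConj (moyalStar θ a b) = moyalStar θ (schwartzConj b) (schwartzConj a) := by
  simp only [moyalStar_eq, schwartzConj_twistedProd]

/-- The map `b ↦ a ⋆ b` on Schwartz space. -/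
def moyalMulLeft (a : 𝓢(MoyalSpace N, ℂ)) : 𝓢(MoyalSpace N, ℂ) →L[ℂ] 𝓢(MoyalSpace N, ℂ) where
  toFun := moyalStar θ a
  map_add' b b' := by simp only [moyalStar_eq, twistedProd_add_right]
  map_smul' c b := by simp only [moyalStar_eq, twistedProd_smul_right, RingHom.id_apply]
  cont := by
    rw [funext (moyalStar_eq θ a)]
    exact continuous_twistedProd_right _ _ a

/-- The map `b ↦ b ⋆ a` on Schwartz space. -/
def moyalMulRight (a : 𝓢(MoyalSpace N, ℂ)) : 𝓢(MoyalSpace N, ℂ) →L[ℂ] 𝓢(MoyalSpace N, ℂ) where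
  toFun b := moyalStar θ b a
  map_add' b b' := by simp only [moyalStar_eq, twistedProd_add_left]
  map_smul' c b := by simp only [moyalStar_eq, twistedProd_smul_left, RingHom.id_apply]
  cont := by
    rw [funext fun b => moyalStar_eq θ b a]
    exact continuous_twistedProd_left _ _ a

/-- `⟨T ⋆ a, b⟩ = ⟨T, a ⋆ b⟩` -/
def distStar (T : 𝓢'(MoyalSpace N, ℂ)) (a : 𝓢(MoyalSpace N, ℂ)) : 𝓢'(MoyalSpace N, ℂ) :=
  PointwiseConvergenceCLM.precomp ℂ (moyalMulLeft θ a) T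

/-- `⟨a ⋆ T, b⟩ = ⟨T, b ⋆ a⟩` -/
def starDist (a : 𝓢(MoyalSpace N, ℂ)) (T : 𝓢'(MoyalSpace N, ℂ)) : 𝓢'(MoyalSpace N, ℂ) :=
  PointwiseConvergenceCLM.precomp ℂ (moyalMulRight θ a) T

theorem distStar_apply (T : 𝓢'(MoyalSpace N, ℂ)) (a b : 𝓢(MoyalSpace N, ℂ)) :
    distStar θ T a b = T (moyalStar θ a b) := rfl

theorem starDist_apply (T : 𝓢'(MoyalSpace N, ℂ)) (a b : 𝓢(MoyalSpace N, ℂ)) :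
    starDist θ a T b = T (moyalStar θ b a) := rfl

variable (N) in
/-- The canonical embedding of Schwartz space into tempered distributions. -/
abbrev schwartzToDist : 𝓢(MoyalSpace N, ℂ) →L[ℂ] 𝓢'(MoyalSpace N, ℂ) :=
  SchwartzMap.toTemperedDistributionCLM (MoyalSpace N) ℂ volume

variable (N) in
/-- `M_L`: the tempered distributions `T` with `a ⋆ T ∈ 𝓢` for all `a ∈ 𝓢`. -/
def moyalML : Submodule ℂ 𝓢'(MoyalSpace N, ℂ) where
  carrier := {T | ∀ a, ∃ s, starDist θ a T = schwartzToDist N s}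
  add_mem' := by
    intro T U hT hU a
    obtain ⟨s, hs⟩ := hT a
    obtain ⟨t, ht⟩ := hU a
    exact ⟨s + t, by rw [map_add, ← hs, ← ht]; exact map_add (PointwiseConvergenceCLM.precomp ℂ _) T U⟩
  zero_mem' := fun a => ⟨0, by rw [map_zero]; exact map_zero (PointwiseConvergenceCLM.precomp ℂ _)⟩
  smul_mem' := by
    intro c T hT a
    obtain ⟨s, hs⟩ := hT a
    exact ⟨c • s, by rw [map_smul, ← hs]; exact map_smul (PointwiseConvergenceCLM.precomp ℂ _) c T⟩

variable (N) in
/-- `M_R`: the tempered distributions `T` with `T ⋆ a ∈ 𝓢` for all `a ∈ 𝓢`. -/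
def moyalMR : Submodule ℂ 𝓢'(MoyalSpace N, ℂ) where
  carrier := {T | ∀ a, ∃ s, distStar θ T a = schwartzToDist N s}
  add_mem' := by
    intro T U hT hU a
    obtain ⟨s, hs⟩ := hT a
    obtain ⟨t, ht⟩ := hU a
    exact ⟨s + t, by rw [map_add, ← hs, ← ht]; exact map_add (PointwiseConvergenceCLM.precomp ℂ _) T U⟩
  zero_mem' := fun a => ⟨0, by rw [map_zero]; exact map_zero (PointwiseConvergenceCLM.precomp ℂ _)⟩
  smul_mem' := by
    intro c T hT a
    obtain ⟨s, hs⟩ := hT a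
    exact ⟨c • s, by rw [map_smul, ← hs]; exact map_smul (PointwiseConvergenceCLM.precomp ℂ _) c T⟩

variable (N) in
/-- The Moyal algebra `M = M_L ∩ M_R`. -/
abbrev MoyalAlgebra := ↥(moyalML N θ ⊓ moyalMR N θ)

end Moyal

/-! ### The Moyal algebra as a `*`-algebra -/

section MoyalAlg

variable {N : ℕ}

theorem schwartzToDist_apply (s b : 𝓢(MoyalSpace N, ℂ)) :
    schwartzToDist N s b = ∫ x, b x * s x := by
  simp [SchwartzMap.toTemperedDistributionCLM_apply_apply]

theorem schwartzToDist_comm (s b : 𝓢(MoyalSpace N, ℂ)) :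
    schwartzToDist N s b = schwartzToDist N b s := by
  simp only [schwartzToDist_apply, mul_comm]

theorem schwartzToDist_injective : Function.Injective (schwartzToDist N) := by
  rw [injective_iff_map_eq_zero]
  intro s hs
  have h : ∫ x, schwartzConj s x * s x = 0 := by rw [← schwartzToDist_apply, hs]; rfl
  have h1 : ∀ x, schwartzConj s x * s x = ((‖s x‖ ^ 2 : ℝ) : ℂ) := by
    intro x
    rw [schwartzConj_apply]
    simpa using Complex.conj_mul' (s x)
  have hint : Integrable fun x => ‖s x‖ ^ 2 := by
    refine (schwartz_integrable_mul s (g := fun x => schwartzConj s x)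
      (schwartzConj s).continuous (C := SchwartzMap.seminorm ℝ 0 0 (schwartzConj s))
      (fun x => SchwartzMap.norm_le_seminorm ℝ _ x)).norm.congr (Eventually.of_forall fun x => ?_)
    simp [schwartzConj_apply, sq]
  simp only [h1] at h
  rw [integral_complex_ofReal, Complex.ofReal_eq_zero] at h
  have h2 := (integral_eq_zero_iff_of_nonneg (fun x => sq_nonneg _) hint).1 h
  have h3 : (fun x => ‖s x‖ ^ 2) = 0 :=
    (Continuous.ae_eq_iff_eq volume (by have := s.continuous; fun_prop) continuous_const).1 h2
  ext x
  simpa using congrFun h3 x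

theorem schwartz_ext_pairing {s t : 𝓢(MoyalSpace N, ℂ)}
    (h : ∀ b, schwartzToDist N s b = schwartzToDist N t b) : s = t :=
  schwartzToDist_injective (by ext b; exact h b)

theorem schwartzConj_conj (a : 𝓢(MoyalSpace N, ℂ)) : schwartzConj (schwartzConj a) = a := by
  ext x; simp [schwartzConj_apply]

theorem schwartzConj_smul (c : ℂ) (a : 𝓢(MoyalSpace N, ℂ)) :
    schwartzConj (c • a) = star c • schwartzConj a := by
  ext x; simp [schwartzConj_apply]

theorem schwartzToDist_conj (s b : 𝓢(MoyalSpace N, ℂ)) :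
    schwartzToDist N (schwartzConj s) b = star (schwartzToDist N s (schwartzConj b)) := by
  rw [schwartzToDist_apply, schwartzToDist_apply]
  change _ = (starRingEnd ℂ) _
  rw [← integral_conj]
  congr 1; ext x
  simp [schwartzConj_apply]

variable (θ : ℝ) [NeZero θ]

theorem schwartzToDist_star (a b c : 𝓢(MoyalSpace N, ℂ)) :
    schwartzToDist N c (moyalStar θ a b) = schwartzToDist N (moyalStar θ b c) a := by
  rw [schwartzToDist_apply, schwartzToDist_apply, ← integral_moyalStar θ, ← integral_moyalStar θ,
    moyalStar_assoc]

theorem schwartzToDist_star' (a b c : 𝓢(MoyalSpace N, ℂ)) :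
    schwartzToDist N c (moyalStar θ a b) = schwartzToDist N b (moyalStar θ c a) := by
  rw [schwartzToDist_comm, ← schwartzToDist_star]

variable {θ}

/-- The Schwartz function `T ⋆ a`. -/
def lact (T : MoyalAlgebra N θ) (a : 𝓢(MoyalSpace N, ℂ)) : 𝓢(MoyalSpace N, ℂ) := (T.2.2 a).choose

/-- The Schwartz function `a ⋆ T`. -/
def ract (T : MoyalAlgebra N θ) (a : 𝓢(MoyalSpace N, ℂ)) : 𝓢(MoyalSpace N, ℂ) := (T.2.1 a).choose

theorem lact_spec (T : MoyalAlgebra N θ) (a b : 𝓢(MoyalSpace N, ℂ)) :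
    schwartzToDist N (lact T a) b = T.1 (moyalStar θ a b) := by
  rw [← distStar_apply, (T.2.2 a).choose_spec]; rfl

theorem ract_spec (T : MoyalAlgebra N θ) (a b : 𝓢(MoyalSpace N, ℂ)) :
    schwartzToDist N (ract T a) b = T.1 (moyalStar θ b a) := by
  rw [← starDist_apply, (T.2.1 a).choose_spec]; rfl

theorem lact_star (T : MoyalAlgebra N θ) (a b : 𝓢(MoyalSpace N, ℂ)) :
    lact T (moyalStar θ a b) = moyalStar θ (lact T a) b := by
  refine schwartz_ext_pairing fun c => ?_
  rw [lact_spec, moyalStar_assoc, ← lact_spec, schwartzToDist_comm, ← schwartzToDist_star,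
    schwartzToDist_comm]

theorem ract_star (T : MoyalAlgebra N θ) (a b : 𝓢(MoyalSpace N, ℂ)) :
    ract T (moyalStar θ b a) = moyalStar θ b (ract T a) := by
  refine schwartz_ext_pairing fun c => ?_
  rw [ract_spec, ← moyalStar_assoc, ← ract_spec, ← schwartzToDist_star]

theorem star_lact (T : MoyalAlgebra N θ) (a b : 𝓢(MoyalSpace N, ℂ)) :
    moyalStar θ a (lact T b) = moyalStar θ (ract T a) b := by
  refine schwartz_ext_pairing fun c => ?_
  rw [← schwartzToDist_star, lact_spec, ← moyalStar_assoc, ← ract_spec,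
    schwartzToDist_star']
  exact schwartzToDist_comm _ _

theorem lact_add_right (T : MoyalAlgebra N θ) (a b : 𝓢(MoyalSpace N, ℂ)) :
    lact T (a + b) = lact T a + lact T b := by
  refine schwartz_ext_pairing fun c => ?_
  have := lact_spec T (a + b) c
  rw [this, moyalStar_eq, twistedProd_add_left, map_add, map_add, ← moyalStar_eq, ← moyalStar_eq,
    ← lact_spec, ← lact_spec]
  rfl

theorem lact_smul_right (T : MoyalAlgebra N θ) (r : ℂ) (a : 𝓢(MoyalSpace N, ℂ)) :
    lact T (r • a) = r • lact T a := by
  refine schwartz_ext_pairing fun c => ?_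
  rw [lact_spec, moyalStar_eq, twistedProd_smul_left, map_smul, map_smul, ← moyalStar_eq,
    ← lact_spec]
  rfl

theorem lact_add_left (S T : MoyalAlgebra N θ) (a : 𝓢(MoyalSpace N, ℂ)) :
    lact (S + T) a = lact S a + lact T a := by
  refine schwartz_ext_pairing fun c => ?_
  rw [lact_spec, map_add]
  change S.1 _ + T.1 _ = schwartzToDist N (lact S a) c + schwartzToDist N (lact T a) c
  rw [lact_spec, lact_spec]

theorem lact_smul_left (r : ℂ) (T : MoyalAlgebra N θ) (a : 𝓢(MoyalSpace N, ℂ)) :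
    lact (r • T) a = r • lact T a := by
  refine schwartz_ext_pairing fun c => ?_
  rw [lact_spec, map_smul]
  change r • T.1 _ = r • schwartzToDist N (lact T a) c
  rw [lact_spec]

/-- A sequence of approximate units. -/
def approxUnit (N : ℕ) : ℕ → 𝓢(MoyalSpace N, ℂ) := (exists_approx_unit (MoyalSpace N)).choose

theorem tendsto_approxUnit_star (b : 𝓢(MoyalSpace N, ℂ)) :
    Tendsto (fun n => moyalStar θ (approxUnit N n) b) atTop (𝓝 b) := by
  simp only [moyalStar_eq]
  exact ((exists_approx_unit (MoyalSpace N)).choose_spec _ (piTheta_skew θ) b).1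

theorem tendsto_star_approxUnit (b : 𝓢(MoyalSpace N, ℂ)) :
    Tendsto (fun n => moyalStar θ b (schwartzConj (approxUnit N n))) atTop (𝓝 b) := by
  simp only [moyalStar_eq]
  exact ((exists_approx_unit (MoyalSpace N)).choose_spec _ (piTheta_skew θ) b).2

variable (θ) in
theorem dist_ext_star {S T : 𝓢'(MoyalSpace N, ℂ)}
    (h : ∀ a b, S (moyalStar θ a b) = T (moyalStar θ a b)) : S = T := by
  ext b
  have h1 := ((map_continuous S).tendsto b).comp (tendsto_approxUnit_star (θ := θ) b)
  have h2 := ((map_continuous T).tendsto b).comp (tendsto_approxUnit_star (θ := θ) b)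
  simp only [Function.comp_def, h] at h1
  exact tendsto_nhds_unique h1 h2

theorem moyal_ext {S T : MoyalAlgebra N θ} (h : ∀ a, lact S a = lact T a) : S = T := by
  refine Subtype.ext (dist_ext_star θ fun a b => ?_)
  rw [← lact_spec, ← lact_spec, h]

theorem continuous_lact (S T : MoyalAlgebra N θ) : Continuous fun b => S.1 (lact T b) := by
  let g : ℕ → 𝓢(MoyalSpace N, ℂ) →L[ℂ] ℂ := fun n =>
    (PointwiseConvergenceCLM.precomp ℂ
      (moyalMulRight θ (ract S (schwartzConj (approxUnit N n)))) T.1 : 𝓢'(MoyalSpace N, ℂ))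
  have hg : Tendsto (fun n b => g n b) atTop (𝓝 fun b => S.1 (lact T b)) := by
    rw [tendsto_pi_nhds]
    intro b
    have h1 := ((map_continuous S.1).tendsto _).comp
      (tendsto_star_approxUnit (θ := θ) (lact T b))
    refine h1.congr fun n => ?_
    change S.1 (moyalStar θ (lact T b) _) = T.1 (moyalStar θ b (ract S _))
    rw [← ract_spec, ← lact_spec, schwartzToDist_comm]
  exact (continuousLinearMapOfTendsto g hg).continuous

/-- The Moyal product of `S, T ∈ M` as a distribution: `⟨S ⋆ T, b⟩ = ⟨S, T ⋆ b⟩`. -/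
def moyalMulDist (S T : MoyalAlgebra N θ) : 𝓢'(MoyalSpace N, ℂ) :=
  ContinuousLinearMap.toPointwiseConvergenceCLM _ _ _ _
    { toFun := fun b => S.1 (lact T b)
      map_add' := fun a b => by rw [lact_add_right, map_add]
      map_smul' := fun r a => by rw [lact_smul_right, map_smul, RingHom.id_apply]
      cont := continuous_lact S T }

theorem moyalMulDist_apply (S T : MoyalAlgebra N θ) (b : 𝓢(MoyalSpace N, ℂ)) :
    moyalMulDist S T b = S.1 (lact T b) := rfl

theorem moyalMulDist_mem (S T : MoyalAlgebra N θ) :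
    moyalMulDist S T ∈ moyalML N θ ⊓ moyalMR N θ := by
  refine ⟨fun a => ⟨ract T (ract S a), ?_⟩, fun a => ⟨lact S (lact T a), ?_⟩⟩
  · ext b
    rw [starDist_apply, ract_spec, moyalMulDist_apply, lact_star, ← ract_spec, ← lact_spec,
      schwartzToDist_comm]
  · ext b
    rw [distStar_apply, lact_spec, moyalMulDist_apply, lact_star]

/-- The Moyal product on `M`. -/
instance : Mul (MoyalAlgebra N θ) := ⟨fun S T => ⟨moyalMulDist S T, moyalMulDist_mem S T⟩⟩

theorem moyal_mul_apply (S T : MoyalAlgebra N θ) (b : 𝓢(MoyalSpace N, ℂ)) :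
    (S * T).1 b = S.1 (lact T b) := rfl

theorem lact_mul (S T : MoyalAlgebra N θ) (a : 𝓢(MoyalSpace N, ℂ)) :
    lact (S * T) a = lact S (lact T a) := by
  refine schwartz_ext_pairing fun c => ?_
  rw [lact_spec, moyal_mul_apply, lact_star, lact_spec]

theorem ract_mul (S T : MoyalAlgebra N θ) (a : 𝓢(MoyalSpace N, ℂ)) :
    ract (S * T) a = ract T (ract S a) := by
  refine schwartz_ext_pairing fun c => ?_
  rw [ract_spec, moyal_mul_apply, lact_star, ← ract_spec, schwartzToDist_comm, lact_spec,
    ← ract_spec]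

variable (N) in
/-- The distribution of the constant function `1`. -/
def oneDist : 𝓢'(MoyalSpace N, ℂ) :=
  (Function.HasTemperateGrowth.const (1 : ℂ)).toTemperedDistribution volume

theorem oneDist_apply (b : 𝓢(MoyalSpace N, ℂ)) : oneDist N b = ∫ x, b x := by
  simp [oneDist]

theorem oneDist_mem : oneDist N ∈ moyalML N θ ⊓ moyalMR N θ := by
  refine ⟨fun a => ⟨a, ?_⟩, fun a => ⟨a, ?_⟩⟩
  · ext b
    rw [starDist_apply, oneDist_apply, integral_moyalStar, schwartzToDist_apply]
  · ext b
    rw [distStar_apply, oneDist_apply, integral_moyalStar, schwartzToDist_comm,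
      schwartzToDist_apply]

instance : One (MoyalAlgebra N θ) := ⟨⟨oneDist N, oneDist_mem⟩⟩

theorem lact_one (a : 𝓢(MoyalSpace N, ℂ)) : lact (1 : MoyalAlgebra N θ) a = a := by
  refine schwartz_ext_pairing fun c => ?_
  rw [lact_spec]
  change oneDist N _ = _
  rw [oneDist_apply, integral_moyalStar, schwartzToDist_comm, schwartzToDist_apply]

instance : Ring (MoyalAlgebra N θ) :=
  { (inferInstance : AddCommGroup (MoyalAlgebra N θ)) with
    mul := (· * ·)
    one := 1
    left_distrib := fun S T U => moyal_ext fun a => by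
      simp only [lact_mul, lact_add_left, lact_add_right]
    right_distrib := fun S T U => moyal_ext fun a => by
      simp only [lact_mul, lact_add_left]
    zero_mul := fun S => Subtype.ext (by ext b; rfl)
    mul_zero := fun S => moyal_ext fun a => by
      have h0 : lact (0 : MoyalAlgebra N θ) a = 0 := by
        simpa using lact_smul_left (0 : ℂ) (0 : MoyalAlgebra N θ) a
      have h1 : lact S 0 = 0 := by simpa using lact_smul_right S (0 : ℂ) 0
      rw [lact_mul, h0, h1]
    mul_assoc := fun S T U => moyal_ext fun a => by simp only [lact_mul]
    one_mul := fun S => moyal_ext fun a => by rw [lact_mul, lact_one]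
    mul_one := fun S => moyal_ext fun a => by rw [lact_mul, lact_one] }

instance : Algebra ℂ (MoyalAlgebra N θ) :=
  Algebra.ofModule
    (fun r S T => moyal_ext fun a => by simp only [lact_mul, lact_smul_left])
    (fun r S T => moyal_ext fun a => by simp only [lact_mul, lact_smul_left, lact_smul_right])

/-- The involution of tempered distributions, `⟨T†, b⟩ = conj ⟨T, conj b⟩`. -/
def distConj (T : 𝓢'(MoyalSpace N, ℂ)) : 𝓢'(MoyalSpace N, ℂ) :=
  ContinuousLinearMap.toPointwiseConvergenceCLM _ _ _ _
    { toFun := fun b => star (T (schwartzConj b))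
      map_add' := fun a b => by rw [map_add, map_add, star_add]
      map_smul' := fun r a => by
        rw [schwartzConj_smul, map_smul, smul_eq_mul, star_mul', star_star]; rfl
      cont := continuous_star.comp ((map_continuous T).comp schwartzConj.continuous) }

theorem distConj_apply (T : 𝓢'(MoyalSpace N, ℂ)) (b : 𝓢(MoyalSpace N, ℂ)) :
    distConj T b = star (T (schwartzConj b)) := rfl

theorem distConj_star (T : MoyalAlgebra N θ) (a b : 𝓢(MoyalSpace N, ℂ)) :
    distConj T.1 (moyalStar θ a b) = schwartzToDist N (schwartzConj (ract T (schwartzConj a))) b := by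
  rw [distConj_apply, schwartzConj_moyalStar, schwartzToDist_conj, ract_spec]

theorem distConj_mem (T : MoyalAlgebra N θ) : distConj T.1 ∈ moyalML N θ ⊓ moyalMR N θ := by
  refine ⟨fun a => ⟨schwartzConj (lact T (schwartzConj a)), ?_⟩,
    fun a => ⟨schwartzConj (ract T (schwartzConj a)), ?_⟩⟩
  · ext b
    rw [starDist_apply, distConj_apply, schwartzConj_moyalStar, schwartzToDist_conj, lact_spec]
  · ext b
    rw [distStar_apply, distConj_star]

instance : Star (MoyalAlgebra N θ) := ⟨fun T => ⟨distConj T.1, distConj_mem T⟩⟩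

theorem lact_conj (T : MoyalAlgebra N θ) (a : 𝓢(MoyalSpace N, ℂ)) :
    lact (star T) a = schwartzConj (ract T (schwartzConj a)) := by
  refine schwartz_ext_pairing fun c => ?_
  rw [lact_spec]
  exact distConj_star T a c

instance : StarRing (MoyalAlgebra N θ) where
  star_involutive T := Subtype.ext <| by
    ext b
    change star (star (T.1 (schwartzConj (schwartzConj b)))) = _
    rw [star_star, schwartzConj_conj]
  star_mul S T := moyal_ext fun a => by
    simp only [lact_mul, lact_conj, ract_mul, schwartzConj_conj]
  star_add S T := Subtype.ext <| by
    ext b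
    exact star_add (S.1 _) (T.1 _)

instance : StarModule ℂ (MoyalAlgebra N θ) where
  star_smul r T := Subtype.ext <| by
    ext b
    exact star_mul' r (T.1 _)

end MoyalAlg

/-! ### Coordinates, derivatives and polynomials in the Moyal algebra -/

section MoyalPoly

variable {N : ℕ} {θ : ℝ} [NeZero θ]

/-- Multiplication of a tempered distribution by the linear function `⟨·, m⟩`. -/
def coordDist (m : MoyalSpace N) (T : 𝓢'(MoyalSpace N, ℂ)) : 𝓢'(MoyalSpace N, ℂ) :=
  PointwiseConvergenceCLM.precomp ℂ (coordMul m) T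

theorem coordDist_apply (m : MoyalSpace N) (T : 𝓢'(MoyalSpace N, ℂ)) (b : 𝓢(MoyalSpace N, ℂ)) :
    coordDist m T b = T (coordMul m b) := rfl

theorem schwartzToDist_coordMul (m : MoyalSpace N) (s b : 𝓢(MoyalSpace N, ℂ)) :
    schwartzToDist N s (coordMul m b) = schwartzToDist N (coordMul m s) b := by
  simp only [schwartzToDist_apply, coordMul_apply]
  congr 1; ext x; ring

theorem schwartzToDist_lineDeriv (m : MoyalSpace N) (s b : 𝓢(MoyalSpace N, ℂ)) :
    schwartzToDist N s (∂_{m} b) = -schwartzToDist N (∂_{m} s) b := by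
  simp only [schwartzToDist_apply]
  rw [SchwartzMap.integral_mul_lineDerivOp_right_eq_neg_left]
  simp

theorem lineDeriv_coordMul (m n : MoyalSpace N) (b : 𝓢(MoyalSpace N, ℂ)) :
    ∂_{m} (coordMul n b) = ((⟪m, n⟫ : ℝ) : ℂ) • b + coordMul n (∂_{m} b) := by
  ext x
  have h1 : HasFDerivAt (fun y : MoyalSpace N => ((⟪y, n⟫ : ℝ) : ℂ))
      (Complex.ofRealCLM.comp ((innerSL ℝ).flip n)) x :=
    Complex.ofRealCLM.hasFDerivAt.comp x ((innerSL ℝ).flip n).hasFDerivAt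
  have h2 := h1.mul (b.differentiable x).hasFDerivAt
  have h3 : (coordMul n b : MoyalSpace N → ℂ) = fun y => ((⟪y, n⟫ : ℝ) : ℂ) * b y := by
    ext y; exact coordMul_apply n b y
  rw [SchwartzMap.lineDerivOp_apply_eq_fderiv, h3]
  erw [h2.fderiv]
  simp only [add_apply, smul_apply, coordMul_apply,
    SchwartzMap.lineDerivOp_apply_eq_fderiv]
  have h4 : innerSL ℝ n m = ⟪m, n⟫ := real_inner_comm m n
  simp
  rw [h4]
  ring

theorem coordMul_star (a b : 𝓢(MoyalSpace N, ℂ)) (m : MoyalSpace N) :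
    coordMul m (moyalStar θ a b) = moyalStar θ a (coordMul m b) +
      (2 * Real.pi * Complex.I)⁻¹ • moyalStar θ (∂_{piTheta N θ m} a) b := by
  simp only [moyalStar_eq]; exact coordMul_twistedProd _ _ a b m

theorem lineDeriv_star (a b : 𝓢(MoyalSpace N, ℂ)) (m : MoyalSpace N) :
    ∂_{m} (moyalStar θ a b) = moyalStar θ (∂_{m} a) b + moyalStar θ a (∂_{m} b) := by
  simp only [moyalStar_eq]; exact lineDeriv_twistedProd _ _ a b m

theorem coordDist_star (m : MoyalSpace N) (T : MoyalAlgebra N θ) (a b : 𝓢(MoyalSpace N, ℂ)) :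
    coordDist m T.1 (moyalStar θ a b) = schwartzToDist N (coordMul m (lact T a) +
      (2 * Real.pi * Complex.I)⁻¹ • lact T (∂_{piTheta N θ m} a)) b := by
  rw [coordDist_apply, coordMul_star, map_add, map_smul, ← lact_spec, ← lact_spec,
    schwartzToDist_coordMul, map_add, map_smul]
  rfl

theorem coordDist_mem (m : MoyalSpace N) (T : MoyalAlgebra N θ) :
    coordDist m T.1 ∈ moyalML N θ ⊓ moyalMR N θ := by
  refine ⟨fun a => ⟨ract T (coordMul m a) -
    (2 * Real.pi * Complex.I)⁻¹ • ∂_{piTheta N θ m} (ract T a), ?_⟩, fun a => ⟨coordMul m (lact T a) +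
      (2 * Real.pi * Complex.I)⁻¹ • lact T (∂_{piTheta N θ m} a), ?_⟩⟩
  rotate_left 1
  · ext b; exact coordDist_star m T a b
  · ext b
    rw [starDist_apply, coordDist_apply, coordMul_star, map_add, map_smul, ← ract_spec,
      ← ract_spec, schwartzToDist_lineDeriv, map_sub, map_smul, smul_neg, ← sub_eq_add_neg]
    rfl

/-- Multiplication by the linear function `⟨·, m⟩` on `M`. -/
def moyalCoord (m : MoyalSpace N) (T : MoyalAlgebra N θ) : MoyalAlgebra N θ :=
  ⟨coordDist m T.1, coordDist_mem m T⟩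

theorem lact_moyalCoord (m : MoyalSpace N) (T : MoyalAlgebra N θ) (a : 𝓢(MoyalSpace N, ℂ)) :
    lact (moyalCoord m T) a = coordMul m (lact T a) +
      (2 * Real.pi * Complex.I)⁻¹ • lact T (∂_{piTheta N θ m} a) := by
  refine schwartz_ext_pairing fun b => ?_
  rw [lact_spec]
  exact coordDist_star m T a b

theorem moyalDeriv_star (m : MoyalSpace N) (T : MoyalAlgebra N θ) (a b : 𝓢(MoyalSpace N, ℂ)) :
    (∂_{m} T.1) (moyalStar θ a b) =
      schwartzToDist N (∂_{m} (lact T a) - lact T (∂_{m} a)) b := by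
  rw [TemperedDistribution.lineDerivOp_apply_apply, lineDeriv_star, map_neg, map_add, ← lact_spec,
    ← lact_spec, schwartzToDist_lineDeriv, map_sub]
  change _ = schwartzToDist N (∂_{m} (lact T a)) b - schwartzToDist N (lact T (∂_{m} a)) b
  ring

theorem moyalDeriv_mem (m : MoyalSpace N) (T : MoyalAlgebra N θ) :
    (∂_{m} T.1) ∈ moyalML N θ ⊓ moyalMR N θ := by
  refine ⟨fun a => ⟨∂_{m} (ract T a) - ract T (∂_{m} a), ?_⟩, fun a => ⟨∂_{m} (lact T a) - lact T (∂_{m} a), ?_⟩⟩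
  rotate_left 1
  · ext b; exact moyalDeriv_star m T a b
  · ext b
    rw [starDist_apply, TemperedDistribution.lineDerivOp_apply_apply, lineDeriv_star, map_neg,
      map_add, ← ract_spec, ← ract_spec, schwartzToDist_lineDeriv, map_sub]
    change _ = schwartzToDist N (∂_{m} (ract T a)) b - schwartzToDist N (ract T (∂_{m} a)) b
    ring

/-- The derivative in direction `m` on `M`. -/
def moyalDeriv (m : MoyalSpace N) (T : MoyalAlgebra N θ) : MoyalAlgebra N θ :=
  ⟨∂_{m} T.1, moyalDeriv_mem m T⟩

theorem lact_moyalDeriv (m : MoyalSpace N) (T : MoyalAlgebra N θ) (a : 𝓢(MoyalSpace N, ℂ)) :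
    lact (moyalDeriv m T) a = ∂_{m} (lact T a) - lact T (∂_{m} a) := by
  refine schwartz_ext_pairing fun b => ?_
  rw [lact_spec]
  exact moyalDeriv_star m T a b

theorem lact_coordMul (m : MoyalSpace N) (T : MoyalAlgebra N θ) (a : 𝓢(MoyalSpace N, ℂ)) :
    lact T (coordMul m a) = coordMul m (lact T a) - (2 * Real.pi * Complex.I)⁻¹ •
      lact (moyalDeriv (piTheta N θ m) T) a := by
  refine schwartz_ext_pairing fun b => ?_
  have h : moyalStar θ (coordMul m a) b = coordMul m (moyalStar θ a b) +
      (2 * Real.pi * Complex.I)⁻¹ • moyalStar θ a (∂_{piTheta N θ m} b) := by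
    have h1 := congrArg schwartzConj
      (coordMul_star (θ := θ) (schwartzConj b) (schwartzConj a) m)
    have h2 : ∀ s : 𝓢(MoyalSpace N, ℂ), schwartzConj (coordMul m s) = coordMul m (schwartzConj s) := by
      intro s; ext x; simp [schwartzConj_apply, coordMul_apply]
    have h3 : ∀ (n : MoyalSpace N) (s : 𝓢(MoyalSpace N, ℂ)),
        schwartzConj (∂_{n} s) = ∂_{n} (schwartzConj s) := by
      intro n s; ext x
      have h4 : (schwartzConj s : MoyalSpace N → ℂ) = fun y => Complex.conjCLE (s y) := by
        ext y; simp [schwartzConj_apply]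
      rw [schwartzConj_apply, SchwartzMap.lineDerivOp_apply_eq_fderiv,
        SchwartzMap.lineDerivOp_apply_eq_fderiv, h4]
      erw [((Complex.conjCLE : ℂ →L[ℝ] ℂ).hasFDerivAt.comp x
        (s.differentiable x).hasFDerivAt).fderiv]
      simp
    have h5 : star ((2 * Real.pi * Complex.I)⁻¹ : ℂ) = -(2 * Real.pi * Complex.I)⁻¹ := by
      simp
    rw [h2, schwartzConj_moyalStar, map_add, schwartzConj_smul, schwartzConj_moyalStar,
      schwartzConj_moyalStar, h2, h3, h5, schwartzConj_conj, schwartzConj_conj] at h1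
    rw [h1]; simp
  rw [lact_spec, h, map_add, map_smul, ← lact_spec, schwartzToDist_lineDeriv, map_sub, map_smul,
    lact_moyalDeriv, map_sub]
  rw [← coordDist_apply, coordDist_star, map_add, map_smul]
  have e1 : ∀ f g : 𝓢'(MoyalSpace N, ℂ), (f + g) b = f b + g b := fun _ _ => rfl
  have e2 : ∀ f g : 𝓢'(MoyalSpace N, ℂ), (f - g) b = f b - g b := fun _ _ => rfl
  have e3 : ∀ (r : ℂ) (f : 𝓢'(MoyalSpace N, ℂ)), (r • f) b = r * f b := fun _ _ => rfl
  simp only [e1, e2, e3, smul_eq_mul]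
  ring

theorem moyalCoord_one_mul (m : MoyalSpace N) (T : MoyalAlgebra N θ) :
    moyalCoord m 1 * T = moyalCoord m T +
      (2 * Real.pi * Complex.I)⁻¹ • moyalDeriv (piTheta N θ m) T := by
  refine moyal_ext fun a => ?_
  rw [lact_mul, lact_moyalCoord, lact_one, lact_one, lact_add_left, lact_smul_left,
    lact_moyalCoord, lact_moyalDeriv, smul_sub]
  abel

theorem mul_moyalCoord_one (m : MoyalSpace N) (T : MoyalAlgebra N θ) :
    T * moyalCoord m 1 = moyalCoord m T -
      (2 * Real.pi * Complex.I)⁻¹ • moyalDeriv (piTheta N θ m) T := by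
  refine moyal_ext fun a => ?_
  have : ∀ S U : MoyalAlgebra N θ, ∀ r : ℂ, lact (S - r • U) a = lact S a - r • lact U a := by
    intro S U r
    rw [sub_eq_add_neg, ← neg_smul, lact_add_left, lact_smul_left, neg_smul, sub_eq_add_neg]
  rw [lact_mul, lact_moyalCoord, lact_one, lact_one, this, lact_add_right, lact_smul_right,
    lact_moyalCoord, lact_coordMul]
  abel

theorem moyalDeriv_moyalCoord (m n : MoyalSpace N) (T : MoyalAlgebra N θ) :
    moyalDeriv m (moyalCoord n T) = ((⟪m, n⟫ : ℝ) : ℂ) • T + moyalCoord n (moyalDeriv m T) := by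
  refine Subtype.ext ?_
  ext b
  change T.1 (coordMul n (-∂_{m} b)) = ((⟪m, n⟫ : ℝ) : ℂ) • T.1 b + T.1 (-∂_{m} (coordMul n b))
  rw [lineDeriv_coordMul, map_neg, map_neg, map_neg, map_add, map_smul]
  abel

theorem moyalDeriv_one (m : MoyalSpace N) : moyalDeriv m (1 : MoyalAlgebra N θ) = 0 := by
  refine moyal_ext fun a => ?_
  have h0 : lact (0 : MoyalAlgebra N θ) a = 0 := by
    simpa using lact_smul_left (0 : ℂ) (0 : MoyalAlgebra N θ) a
  rw [lact_moyalDeriv, lact_one, lact_one, h0, sub_self]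

end MoyalPoly

section MoyalPoly

variable {N : ℕ}

/-- The polynomial function on `ℝ^{2N}` given by `p`. -/
def polyFun (p : MvPolynomial (MoyalIndex N) ℂ) (x : MoyalSpace N) : ℂ :=
  MvPolynomial.eval (fun i => ((x i : ℝ) : ℂ)) p

theorem polyFun_temperate (p : MvPolynomial (MoyalIndex N) ℂ) :
    (polyFun p).HasTemperateGrowth := by
  induction p using MvPolynomial.induction_on with
  | C a =>
    have : polyFun (N := N) (MvPolynomial.C a) = fun _ => a := by ext x; simp [polyFun]
    rw [this]; exact .const a
  | add p q hp hq =>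
    have : polyFun (p + q) = polyFun p + polyFun q := by ext x; simp [polyFun]
    rw [this]; exact hp.add hq
  | mul_X p i hp =>
    have : polyFun (p * MvPolynomial.X i) = polyFun p *
        fun x : MoyalSpace N => (Complex.ofRealCLM.comp (EuclideanSpace.proj i)) x := by
      ext x; simp [polyFun]
    rw [this]; exact hp.mul (ContinuousLinearMap.hasTemperateGrowth _)

/-- The tempered distribution of a polynomial function. -/
def polyDist (p : MvPolynomial (MoyalIndex N) ℂ) : 𝓢'(MoyalSpace N, ℂ) :=
  (polyFun_temperate p).toTemperedDistribution volume

theorem polyDist_apply (p : MvPolynomial (MoyalIndex N) ℂ) (b : 𝓢(MoyalSpace N, ℂ)) :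
    polyDist p b = ∫ x, b x * polyFun p x := by
  simp [polyDist]

theorem integrable_mul_polyFun (p : MvPolynomial (MoyalIndex N) ℂ) (b : 𝓢(MoyalSpace N, ℂ)) :
    Integrable fun x => b x * polyFun p x := by
  refine (SchwartzMap.smulLeftCLM ℂ (polyFun p) b).integrable.congr (Eventually.of_forall fun x => ?_)
  rw [SchwartzMap.smulLeftCLM_apply_apply (polyFun_temperate p), smul_eq_mul, mul_comm]

theorem polyDist_add (p q : MvPolynomial (MoyalIndex N) ℂ) :
    polyDist (p + q) = polyDist p + polyDist q := by
  ext b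
  change _ = polyDist p b + polyDist q b
  simp only [polyDist_apply]
  rw [← integral_add (integrable_mul_polyFun p b) (integrable_mul_polyFun q b)]
  congr 1; ext x; simp [polyFun, mul_add]

theorem polyDist_smul (c : ℂ) (p : MvPolynomial (MoyalIndex N) ℂ) :
    polyDist (c • p) = c • polyDist p := by
  ext b
  change _ = c * polyDist p b
  simp only [polyDist_apply]
  rw [← integral_const_mul]
  congr 1; ext x; simp [polyFun, MvPolynomial.smul_eval]; ring

theorem polyDist_mul_X (p : MvPolynomial (MoyalIndex N) ℂ) (i : MoyalIndex N) :
    polyDist (p * MvPolynomial.X i) = coordDist (EuclideanSpace.single i 1) (polyDist p) := by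
  ext b
  rw [coordDist_apply, polyDist_apply, polyDist_apply]
  congr 1; ext x
  simp [polyFun, coordMul_apply, EuclideanSpace.inner_single_right]
  ring

theorem polyDist_one : polyDist (1 : MvPolynomial (MoyalIndex N) ℂ) = oneDist N := by
  ext b
  rw [polyDist_apply, oneDist_apply]
  simp [polyFun]

variable (θ : ℝ) [NeZero θ]

theorem polyDist_mem (p : MvPolynomial (MoyalIndex N) ℂ) :
    polyDist p ∈ moyalML N θ ⊓ moyalMR N θ := by
  induction p using MvPolynomial.induction_on with
  | C a =>
    rw [MvPolynomial.C_eq_smul_one, polyDist_smul, polyDist_one]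
    exact Submodule.smul_mem _ a oneDist_mem
  | add p q hp hq => rw [polyDist_add]; exact Submodule.add_mem _ hp hq
  | mul_X p i hp => rw [polyDist_mul_X]; exact coordDist_mem _ ⟨_, hp⟩

/-- Polynomial functions as elements of `M`. -/
def moyalPoly : MvPolynomial (MoyalIndex N) ℂ →ₗ[ℂ] MoyalAlgebra N θ where
  toFun p := ⟨polyDist p, polyDist_mem θ p⟩
  map_add' p q := Subtype.ext (polyDist_add p q)
  map_smul' c p := Subtype.ext (polyDist_smul c p)

theorem moyalPoly_one : moyalPoly θ (1 : MvPolynomial (MoyalIndex N) ℂ) = 1 :=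
  Subtype.ext polyDist_one

theorem moyalPoly_mul_X (p : MvPolynomial (MoyalIndex N) ℂ) (i : MoyalIndex N) :
    moyalPoly θ (p * MvPolynomial.X i) =
      moyalCoord (EuclideanSpace.single i 1) (moyalPoly θ p) :=
  Subtype.ext (polyDist_mul_X p i)

theorem moyalPoly_X (i : MoyalIndex N) : moyalPoly θ (MvPolynomial.X i) =
    moyalCoord (EuclideanSpace.single i 1) (1 : MoyalAlgebra N θ) := by
  rw [← moyalPoly_one, ← moyalPoly_mul_X, one_mul]

theorem moyalPoly_injective : Function.Injective (moyalPoly (N := N) θ) := by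
  rw [injective_iff_map_eq_zero]
  intro p hp
  have h1 : polyDist p = 0 := congrArg Subtype.val hp
  have hc : Continuous (polyFun p) := (polyFun_temperate p).1.continuous
  have h2 : ∀ᵐ x, polyFun p x = 0 := by
    refine ae_eq_zero_of_integral_contDiff_smul_eq_zero hc.locallyIntegrable fun g hg hs => ?_
    have hs' : HasCompactSupport fun x => ((g x : ℝ) : ℂ) :=
      hs.comp_left (g := fun t : ℝ => (t : ℂ)) (by simp)
    have h3 := polyDist_apply p (hs'.toSchwartzMap (Complex.ofRealCLM.contDiff.comp hg))
    rw [h1] at h3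
    have h4 : ∫ x, ((g x : ℝ) : ℂ) * polyFun p x = 0 := h3.symm
    simpa [Complex.real_smul] using h4
  have h5 : polyFun p = 0 := (Continuous.ae_eq_iff_eq volume hc continuous_const).1 h2
  refine MvPolynomial.funext_set (fun _ => Set.range ((↑) : ℝ → ℂ))
    (fun _ => Set.infinite_range_of_injective Complex.ofReal_injective) fun x hx => ?_
  choose y hy using fun i => hx i trivial
  have h6 := congrFun h5 (WithLp.toLp 2 y)
  have h7 : x = fun i => ((y i : ℝ) : ℂ) := funext fun i => (hy i).symm
  rw [h7]
  simpa [polyFun] using h6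

theorem moyalDeriv_add (m : MoyalSpace N) (S T : MoyalAlgebra N θ) :
    moyalDeriv m (S + T) = moyalDeriv m S + moyalDeriv m T := Subtype.ext rfl

theorem moyalDeriv_smul (m : MoyalSpace N) (c : ℂ) (T : MoyalAlgebra N θ) :
    moyalDeriv m (c • T) = c • moyalDeriv m T := Subtype.ext rfl

theorem moyalDeriv_moyalPoly (m : MoyalSpace N) (p : MvPolynomial (MoyalIndex N) ℂ) :
    moyalDeriv m (moyalPoly θ p) =
      moyalPoly θ (∑ i, ((m i : ℝ) : ℂ) • MvPolynomial.pderiv i p) := by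
  induction p using MvPolynomial.induction_on with
  | C a =>
    rw [MvPolynomial.C_eq_smul_one, map_smul, moyalPoly_one, moyalDeriv_smul, moyalDeriv_one]
    simp
  | add p q hp hq =>
    rw [map_add, moyalDeriv_add, hp, hq, ← map_add, ← Finset.sum_add_distrib]
    simp only [map_add, smul_add]
  | mul_X p i hp =>
    rw [moyalPoly_mul_X, moyalDeriv_moyalCoord, hp, ← moyalPoly_mul_X, ← map_smul, ← map_add]
    congr 1
    simp only [MvPolynomial.pderiv_mul, smul_add, Finset.sum_add_distrib, MvPolynomial.pderiv_X,
      Finset.sum_mul, smul_mul_assoc]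
    rw [add_comm]
    congr 1
    rw [Finset.sum_eq_single i]
    · simp [EuclideanSpace.inner_single_right]
    · intro j _ hj; simp [hj.symm]
    · simp

/-- The space of polynomial functions of degree at most `d` in `M`. -/
def polyLE (N : ℕ) (d : ℕ) : Submodule ℂ (MoyalAlgebra N θ) :=
  (MvPolynomial.restrictTotalDegree (MoyalIndex N) ℂ d).map (moyalPoly θ)

variable {θ}

theorem mem_polyLE {d : ℕ} {T : MoyalAlgebra N θ} :
    T ∈ polyLE θ N d ↔ ∃ p : MvPolynomial (MoyalIndex N) ℂ, p.totalDegree ≤ d ∧ moyalPoly θ p = T := by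
  simp only [polyLE, Submodule.mem_map, MvPolynomial.mem_restrictTotalDegree]

theorem polyLE_mono {d e : ℕ} (h : d ≤ e) : polyLE θ N d ≤ polyLE θ N e := by
  intro T hT
  obtain ⟨p, hp, rfl⟩ := mem_polyLE.1 hT
  exact mem_polyLE.2 ⟨p, hp.trans h, rfl⟩

theorem one_mem_polyLE (d : ℕ) : (1 : MoyalAlgebra N θ) ∈ polyLE θ N d :=
  mem_polyLE.2 ⟨1, by simp, moyalPoly_one θ⟩

theorem moyalDeriv_mem_polyLE {d : ℕ} (m : MoyalSpace N) {T : MoyalAlgebra N θ}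
    (hT : T ∈ polyLE θ N d) : moyalDeriv m T ∈ polyLE θ N (d - 1) := by
  obtain ⟨p, hp, rfl⟩ := mem_polyLE.1 hT
  rw [moyalDeriv_moyalPoly, map_sum]
  refine Submodule.sum_mem _ fun i _ => ?_
  rw [map_smul]
  refine Submodule.smul_mem _ _ (mem_polyLE.2 ⟨_, ?_, rfl⟩)
  refine Finset.sup_le fun s hs => ?_
  rw [MvPolynomial.mem_support_iff, MvPolynomial.coeff_pderiv] at hs
  have h1 := MvPolynomial.le_totalDegree (MvPolynomial.mem_support_iff.2 (left_ne_zero_of_mul hs))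
  have h2 : ((s + Finsupp.single i 1).sum fun _ e => e) = (s.sum fun _ e => e) + 1 := by
    rw [Finsupp.sum_add_index' (by simp) (by simp)]; simp
  omega

/-- The generators `x_i` of the polynomial functions. -/
def moyalX (θ : ℝ) [NeZero θ] (i : MoyalIndex N) : MoyalAlgebra N θ := moyalPoly θ (MvPolynomial.X i)

theorem moyalX_mul (i : MoyalIndex N) (T : MoyalAlgebra N θ) :
    moyalX θ i * T = moyalCoord (EuclideanSpace.single i 1) T +
      (2 * Real.pi * Complex.I)⁻¹ • moyalDeriv (piTheta N θ (EuclideanSpace.single i 1)) T := by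
  rw [moyalX, moyalPoly_X, moyalCoord_one_mul]

theorem mul_moyalX (i : MoyalIndex N) (T : MoyalAlgebra N θ) :
    T * moyalX θ i = moyalCoord (EuclideanSpace.single i 1) T -
      (2 * Real.pi * Complex.I)⁻¹ • moyalDeriv (piTheta N θ (EuclideanSpace.single i 1)) T := by
  rw [moyalX, moyalPoly_X, mul_moyalCoord_one]

theorem moyalX_lie (i : MoyalIndex N) (T : MoyalAlgebra N θ) :
    moyalX θ i * T - T * moyalX θ i = (2 * (2 * Real.pi * Complex.I)⁻¹ : ℂ) •
      moyalDeriv (piTheta N θ (EuclideanSpace.single i 1)) T := by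
  rw [moyalX_mul, mul_moyalX, mul_smul, two_smul]
  abel

theorem moyalCoord_mem_polyLE {d : ℕ} (i : MoyalIndex N) {T : MoyalAlgebra N θ}
    (hT : T ∈ polyLE θ N d) :
    moyalCoord (EuclideanSpace.single i 1) T ∈ polyLE θ N (d + 1) := by
  obtain ⟨p, hp, rfl⟩ := mem_polyLE.1 hT
  rw [← moyalPoly_mul_X]
  refine mem_polyLE.2 ⟨_, (MvPolynomial.totalDegree_mul _ _).trans ?_, rfl⟩
  rw [MvPolynomial.totalDegree_X]
  omega

theorem moyalX_mul_mem {d : ℕ} (i : MoyalIndex N) {T : MoyalAlgebra N θ} (hT : T ∈ polyLE θ N d) :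
    moyalX θ i * T ∈ polyLE θ N (d + 1) := by
  rw [moyalX_mul]
  exact Submodule.add_mem _ (moyalCoord_mem_polyLE i hT)
    (Submodule.smul_mem _ _ (polyLE_mono (by omega) (moyalDeriv_mem_polyLE _ hT)))

theorem mul_moyalX_mem {d : ℕ} (i : MoyalIndex N) {T : MoyalAlgebra N θ} (hT : T ∈ polyLE θ N d) :
    T * moyalX θ i ∈ polyLE θ N (d + 1) := by
  rw [mul_moyalX]
  exact Submodule.sub_mem _ (moyalCoord_mem_polyLE i hT)
    (Submodule.smul_mem _ _ (polyLE_mono (by omega) (moyalDeriv_mem_polyLE _ hT)))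

theorem moyalX_lie_mem {d : ℕ} (i : MoyalIndex N) {T : MoyalAlgebra N θ} (hT : T ∈ polyLE θ N d) :
    moyalX θ i * T - T * moyalX θ i ∈ polyLE θ N (d - 1) := by
  rw [moyalX_lie]
  exact Submodule.smul_mem _ _ (moyalDeriv_mem_polyLE _ hT)

theorem exists_eq_add_single (s : MoyalIndex N →₀ ℕ) (hs : s ≠ 0) :
    ∃ i t, s = t + Finsupp.single i 1 ∧ (s.sum fun _ e => e) = (t.sum fun _ e => e) + 1 := by
  obtain ⟨i, hi⟩ := Finsupp.ne_iff.1 hs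
  have h : s = (s - Finsupp.single i 1) + Finsupp.single i 1 := by
    rw [tsub_add_cancel_of_le]
    rw [Finsupp.single_le_iff]
    exact Nat.one_le_iff_ne_zero.2 hi
  refine ⟨i, s - Finsupp.single i 1, h, ?_⟩
  conv_lhs => rw [h]
  rw [Finsupp.sum_add_index' (by simp) (by simp)]; simp

theorem polyLE_succ_le {d : ℕ} {W : Submodule ℂ (MoyalAlgebra N θ)} (h1 : 1 ∈ W)
    (h2 : ∀ i, ∀ T ∈ polyLE θ N d, moyalX θ i * T ∈ W)
    (h3 : polyLE θ N d ≤ W) : polyLE θ N (d + 1) ≤ W := by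
  intro T hT
  obtain ⟨p, hp, rfl⟩ := mem_polyLE.1 hT
  rw [p.as_sum, map_sum]
  refine Submodule.sum_mem _ fun s hs => ?_
  have hd := (MvPolynomial.le_totalDegree hs).trans hp
  rcases eq_or_ne s 0 with rfl | hs0
  · rw [MvPolynomial.monomial_zero', MvPolynomial.C_eq_smul_one, map_smul, moyalPoly_one]
    exact Submodule.smul_mem _ _ h1
  · obtain ⟨i, t, rfl, ht⟩ := exists_eq_add_single s hs0
    have h4 : MvPolynomial.monomial (t + Finsupp.single i 1) (p.coeff (t + Finsupp.single i 1)) =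
        MvPolynomial.monomial t (p.coeff (t + Finsupp.single i 1)) * MvPolynomial.X i := by
      simp [MvPolynomial.X, MvPolynomial.monomial_mul]
    set U := moyalPoly θ (MvPolynomial.monomial t (p.coeff (t + Finsupp.single i 1)))
    have hU : U ∈ polyLE θ N d := mem_polyLE.2 ⟨_, (MvPolynomial.totalDegree_monomial_le _ _).trans
      (by change (t.sum fun _ e => e) ≤ d; omega), rfl⟩
    rw [h4, moyalPoly_mul_X, eq_sub_of_add_eq (moyalX_mul i U).symm]
    exact Submodule.sub_mem _ (h2 i U hU) (Submodule.smul_mem _ _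
      (h3 (polyLE_mono (by omega) (moyalDeriv_mem_polyLE _ hU))))

theorem lie_mem_polyLE_two {S T : MoyalAlgebra N θ} (hS : S ∈ polyLE θ N 2)
    (hT : T ∈ polyLE θ N 2) : S * T - T * S ∈ polyLE θ N 2 := by
  let W : Submodule ℂ (MoyalAlgebra N θ) :=
    (polyLE θ N 2).comap (LinearMap.mulLeft ℂ T - LinearMap.mulRight ℂ T)
  have hW : ∀ U : MoyalAlgebra N θ, U ∈ W ↔ T * U - U * T ∈ polyLE θ N 2 := fun U => Iff.rfl
  have hl : ∀ (i : MoyalIndex N) (U : MoyalAlgebra N θ), 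
      T * (moyalX θ i * U) - moyalX θ i * U * T =
        (T * moyalX θ i - moyalX θ i * T) * U + moyalX θ i * (T * U - U * T) := by
    intro i U
    rw [sub_mul, mul_sub]
    simp only [mul_assoc]
    abel
  have h1 : (1 : MoyalAlgebra N θ) ∈ W := by
    rw [hW, mul_one, one_mul, sub_self]; exact Submodule.zero_mem _
  have hx : ∀ i : MoyalIndex N, T * moyalX θ i - moyalX θ i * T ∈ polyLE θ N 1 := by
    intro i
    have h := Submodule.neg_mem _ (moyalX_lie_mem i hT)
    rwa [neg_sub] at h
  let W0 : Submodule ℂ (MoyalAlgebra N θ) := Submodule.span ℂ {1}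
  have p0 : polyLE θ N 0 ≤ W0 := by
    intro U hU
    obtain ⟨p, hp, rfl⟩ := mem_polyLE.1 hU
    rw [MvPolynomial.totalDegree_eq_zero_iff_eq_C.1 (Nat.le_zero.1 hp), MvPolynomial.C_eq_smul_one,
      map_smul, moyalPoly_one]
    exact Submodule.smul_mem _ _ (Submodule.mem_span_singleton_self _)
  let W1 : Submodule ℂ (MoyalAlgebra N θ) := Submodule.span ℂ ({1} ∪ Set.range (moyalX θ))
  have p1 : polyLE θ N 1 ≤ W1 := by
    refine polyLE_succ_le (Submodule.subset_span (by simp)) ?_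
      (p0.trans (Submodule.span_mono (by simp)))
    intro i U hU
    obtain ⟨c, rfl⟩ := Submodule.mem_span_singleton.1 (p0 hU)
    rw [mul_smul_comm, mul_one]
    exact Submodule.smul_mem _ _ (Submodule.subset_span (Or.inr ⟨i, rfl⟩))
  have w1 : W1 ≤ W := by
    refine Submodule.span_le.2 ?_
    rintro _ (rfl | ⟨i, rfl⟩)
    · exact h1
    · exact polyLE_mono (by omega) (hx i)
  have p2 : polyLE θ N 2 ≤ W := by
    refine polyLE_succ_le h1 ?_ (p1.trans w1)
    intro i U hU
    refine Submodule.span_induction (p := fun U _ => moyalX θ i * U ∈ W) ?_ ?_ ?_ ?_ (p1 hU)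
    · rintro _ (rfl | ⟨j, rfl⟩)
      · rw [mul_one]; exact polyLE_mono (by omega) (hx i)
      · rw [hW, hl]
        exact Submodule.add_mem _ (mul_moyalX_mem j (hx i)) (moyalX_mul_mem i (hx j))
    · rw [mul_zero]; exact Submodule.zero_mem _
    · intro U V _ _ hU hV; rw [mul_add]; exact Submodule.add_mem _ hU hV
    · intro c U _ hU; rw [mul_smul_comm]; exact Submodule.smul_mem _ _ hU
  have h := Submodule.neg_mem _ ((hW S).1 (p2 hS))
  rwa [neg_sub] at h

end MoyalPoly

/-! ### Derivations and connections -/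

section Connections

attribute [local instance 100] LieRing.ofAssociativeRing

variable (A : Type*) [Ring A] [Algebra ℂ A]

/-- The Lie algebra of derivations of an associative algebra. -/
def algDer : LieSubalgebra ℂ (Module.End ℂ A) where
  carrier := {X | ∀ a b, X (a * b) = X a * b + a * X b}
  add_mem' := by
    intro X Y hX hY a b
    simp only [LinearMap.add_apply, hX a b, hY a b, add_mul, mul_add]; abel
  zero_mem' := by intro a b; simp
  smul_mem' := by
    intro c X hX a b
    simp only [LinearMap.smul_apply, hX a b, smul_add, smul_mul_assoc, mul_smul_comm]
  lie_mem' := by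
    intro X Y hX hY a b
    simp only [LieRing.of_associative_ring_bracket, LinearMap.sub_apply, Module.End.mul_apply,
      hX a b, hY a b, map_add, hX _ _, hY _ _, sub_mul, mul_sub]
    abel

variable {A}

/-- The inner derivation `ad_a : b ↦ [a, b]`. -/
def innerDer (a : A) : Module.End ℂ A := LinearMap.mulLeft ℂ a - LinearMap.mulRight ℂ a

theorem innerDer_apply (a b : A) : innerDer a b = a * b - b * a := rfl

theorem innerDer_mem_algDer (a : A) : innerDer a ∈ algDer A := by
  intro b c
  simp only [innerDer_apply, sub_mul, mul_sub, mul_assoc]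
  abel

theorem lie_innerDer (a b : A) : ⁅innerDer a, innerDer b⁆ = innerDer (a * b - b * a) := by
  ext c
  simp only [LieRing.of_associative_ring_bracket, LinearMap.sub_apply, Module.End.mul_apply,
    innerDer_apply, sub_mul, mul_sub, mul_assoc]
  abel

variable [StarRing A]

/-- A derivation is real if it commutes with the involution. -/
def IsRealDer (X : Module.End ℂ A) : Prop := ∀ a, star (X a) = X (star a)

/-- The canonical hermitean structure `h₀(m₁, m₂) = ∑ᵢ m₁ᵢ† m₂ᵢ` on `Aⁿ`. -/
def hermStructure {n : ℕ} (m₁ m₂ : Fin n → A) : A := ∑ i, star (m₁ i) * m₂ i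

/-- A noncommutative connection on the right `A`-module `Aⁿ`, for the differential calculus based
on the Lie algebra `G` of derivations of `A`. -/
structure NCConnection (G : LieSubalgebra ℂ (Module.End ℂ A)) (n : ℕ) where
  /-- The map `X ↦ ∇_X`. -/
  toFun : G →ₗ[ℂ] ((Fin n → A) →ₗ[ℂ] (Fin n → A))
  leibniz : ∀ (X : G) (m : Fin n → A) (a : A) (i : Fin n),
    toFun X (fun j => m j * a) i = m i * X.1 a + toFun X m i * a
  map_center : ∀ f ∈ Subalgebra.center ℂ A, ∀ X Y : G, (∀ a, Y.1 a = f * X.1 a) →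
    ∀ (m : Fin n → A) (i : Fin n), toFun Y m i = toFun X m i * f

namespace NCConnection

variable {G : LieSubalgebra ℂ (Module.End ℂ A)} {n : ℕ}

instance : CoeFun (NCConnection G n) fun _ => G → ((Fin n → A) →ₗ[ℂ] (Fin n → A)) :=
  ⟨fun D => D.toFun⟩

/-- Hermitean connections, with respect to the canonical hermitean structure. -/
def IsHermitean (D : NCConnection G n) : Prop :=
  ∀ X : G, IsRealDer X.1 → ∀ m₁ m₂ : Fin n → A,
    X.1 (hermStructure m₁ m₂) = hermStructure (D X m₁) m₂ + hermStructure m₁ (D X m₂)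

/-- The curvature `R(X, Y) = [∇_X, ∇_Y] - ∇_[X, Y]`. -/
def curvature (D : NCConnection G n) (X Y : G) : (Fin n → A) →ₗ[ℂ] (Fin n → A) :=
  D X ∘ₗ D Y - D Y ∘ₗ D X - D ⁅X, Y⁆

/-- The map `∇^inv_X(m) = X(m) - η(X) m` attached to a `1`-form `η`. -/
def canonical (n : ℕ) (η : G → A) (X : G) : (Fin n → A) →ₗ[ℂ] (Fin n → A) :=
  LinearMap.pi fun i => (X.1 - LinearMap.mulLeft ℂ (η X)) ∘ₗ LinearMap.proj i

theorem canonical_apply (η : G → A) (X : G) (m : Fin n → A) (i : Fin n) :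
    canonical n η X m i = X.1 (m i) - η X * m i := rfl

/-- The matrix of an endomorphism of the right `A`-module `Aⁿ` in the canonical basis. -/
def toMat (f : (Fin n → A) →ₗ[ℂ] (Fin n → A)) : Matrix (Fin n) (Fin n) A :=
  Matrix.of fun i j => f (Pi.single j 1) i

/-- The matrix of the tensor form `𝒜(X) = ∇_X - ∇^inv_X`. -/
def tensorForm (D : NCConnection G n) (η : G → A) (X : G) : Matrix (Fin n) (Fin n) A :=
  toMat (D X - canonical n η X)

/-- The matrix `F(X, Y)` of the `2`-form curvature. -/
def curvatureForm (D : NCConnection G n) (X Y : G) : Matrix (Fin n) (Fin n) A :=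
  toMat (D.curvature X Y)

end NCConnection

/-- The matrix `∑_A c^A T^A` with entries in `A`, for a family `T^A` of complex matrices. -/
def expandIn {n : ℕ} {ι : Type*} [Fintype ι] (T : ι → Matrix (Fin n) (Fin n) ℂ) (c : ι → A) :
    Matrix (Fin n) (Fin n) A :=
  Matrix.of fun i j => ∑ k, T k i j • c k

end Connections

/-! ### The extended differential calculus on the Moyal algebra -/

section Extended

attribute [local instance 100] LieRing.ofAssociativeRing

variable (N : ℕ) (θ : ℝ) [NeZero θ]

/-- The Lie algebra `G₂` of the inner derivations `ad_P` with `P` polynomial of degree at most 2. -/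
def moyalG2 : LieSubalgebra ℂ (Module.End ℂ (MoyalAlgebra N θ)) where
  carrier := {X | ∃ p : MvPolynomial (MoyalIndex N) ℂ, p.totalDegree ≤ 2 ∧
    innerDer (moyalPoly θ p) = X}
  add_mem' := by
    rintro _ _ ⟨p, hp, rfl⟩ ⟨q, hq, rfl⟩
    refine ⟨p + q, (MvPolynomial.totalDegree_add _ _).trans (max_le hp hq), ?_⟩
    ext T : 1
    simp only [map_add, innerDer_apply, LinearMap.add_apply, add_mul, mul_add]
    abel
  zero_mem' := by
    refine ⟨0, by simp, ?_⟩
    ext T : 1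
    simp only [map_zero, innerDer_apply, zero_mul, mul_zero, sub_self, LinearMap.zero_apply]
  smul_mem' := by
    rintro c _ ⟨p, hp, rfl⟩
    refine ⟨c • p, (MvPolynomial.totalDegree_smul_le _ _).trans hp, ?_⟩
    ext T : 1
    simp only [map_smul, innerDer_apply, LinearMap.smul_apply, smul_mul_assoc, mul_smul_comm,
      smul_sub]
  lie_mem' := by
    rintro _ _ ⟨p, hp, rfl⟩ ⟨q, hq, rfl⟩
    obtain ⟨r, hr, h⟩ := mem_polyLE.1 (lie_mem_polyLE_two (θ := θ) (mem_polyLE.2 ⟨p, hp, rfl⟩)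
      (mem_polyLE.2 ⟨q, hq, rfl⟩))
    exact ⟨r, hr, by rw [h, lie_innerDer]⟩

theorem moyalG2_le_algDer : moyalG2 N θ ≤ algDer (MoyalAlgebra N θ) := by
  rintro _ ⟨p, _, rfl⟩
  exact innerDer_mem_algDer _

variable {N θ}

theorem piTheta_surjective : Function.Surjective (piTheta N θ) := by
  intro v
  refine ⟨WithLp.toLp 2 (Real.pi⁻¹ • (thetaMatrix N θ)⁻¹.mulVec v.ofLp), ?_⟩
  apply WithLp.ofLp_injective 2
  rw [piTheta_ofLp, Matrix.mulVec_smul, Matrix.mulVec_mulVec,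
    Matrix.mul_nonsing_inv _ (thetaMatrix_isUnit_det θ), Matrix.one_mulVec, smul_smul,
    mul_inv_cancel₀ Real.pi_ne_zero, one_smul]

theorem eq_C_of_innerDer_eq_zero {p : MvPolynomial (MoyalIndex N) ℂ}
    (h : innerDer (moyalPoly θ p) = 0) : p = MvPolynomial.C (MvPolynomial.eval 0 p) := by
  have h1 : ∀ m : MoyalSpace N, moyalDeriv m (moyalPoly θ p) = 0 := by
    intro m
    obtain ⟨v, rfl⟩ := piTheta_surjective (θ := θ) m
    have h2 : moyalPoly θ p * moyalCoord v 1 - moyalCoord v 1 * moyalPoly θ p = 0 := by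
      rw [← innerDer_apply, h]; rfl
    rw [moyalCoord_one_mul, mul_moyalCoord_one] at h2
    set D := moyalDeriv (piTheta N θ v) (moyalPoly θ p)
    have h3 : (-2 * (2 * Real.pi * Complex.I)⁻¹ : ℂ) • D = 0 := by
      rw [← h2, mul_smul, neg_smul, two_smul]; abel
    refine (smul_eq_zero.1 h3).resolve_left (mul_ne_zero (by norm_num) (inv_ne_zero ?_))
    simp [Real.pi_ne_zero]
  have h2 : ∀ i, MvPolynomial.pderiv i p = 0 := by
    intro i
    have h3 := h1 (EuclideanSpace.single i 1)
    rw [moyalDeriv_moyalPoly] at h3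
    have h4 := moyalPoly_injective θ (h3.trans (map_zero _).symm)
    rw [Finset.sum_eq_single i] at h4
    · simpa using h4
    · intro j _ hj; simp [hj]
    · simp
  have h3 : ∀ s, s ≠ 0 → p.coeff s = 0 := by
    intro s hs
    obtain ⟨i, t, rfl, -⟩ := exists_eq_add_single s hs
    have h4 := MvPolynomial.coeff_pderiv (i := i) p t
    rw [h2 i, MvPolynomial.coeff_zero] at h4
    exact (mul_eq_zero.1 h4.symm).resolve_right (by norm_cast)
  have h4 : p = MvPolynomial.C (p.coeff 0) := by
    ext s
    rw [MvPolynomial.coeff_C]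
    split_ifs with hs
    · rw [hs]
    · exact h3 s fun h => hs h.symm
  conv_rhs => rw [h4, MvPolynomial.eval_C]
  exact h4

/-- The `1`-form `η(ad_P) = P - P(0)` on `G₂`. -/
def moyalEta (X : moyalG2 N θ) : MoyalAlgebra N θ :=
  moyalPoly θ (X.2.choose - MvPolynomial.C (MvPolynomial.eval 0 X.2.choose))

theorem moyalEta_eq (X : moyalG2 N θ) {p : MvPolynomial (MoyalIndex N) ℂ}
    (h : X.1 = innerDer (moyalPoly θ p)) :
    moyalEta X = moyalPoly θ (p - MvPolynomial.C (MvPolynomial.eval 0 p)) := by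
  have h1 := X.2.choose_spec.2
  set q := X.2.choose with hq
  have h2 : innerDer (moyalPoly θ (q - p)) = 0 := by
    have h3 : innerDer (moyalPoly θ q) = innerDer (moyalPoly θ p) := h1.trans h
    ext T : 1
    have h4 := LinearMap.congr_fun h3 T
    rw [innerDer_apply, innerDer_apply] at h4
    rw [innerDer_apply, map_sub, sub_mul, mul_sub, sub_sub_sub_comm, h4, sub_self]
    rfl
  have h3 := eq_C_of_innerDer_eq_zero h2
  rw [map_sub, map_sub] at h3
  change moyalPoly θ (q - _) = _
  congr 1
  linear_combination h3

variable (θ)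

/-- The polynomial `ξ_μ = -Θ⁻¹_{μν} x_ν`. -/
def xiPoly (μ : MoyalIndex N) : MvPolynomial (MoyalIndex N) ℂ :=
  -∑ ν, MvPolynomial.C (((thetaMatrix N θ)⁻¹ μ ν : ℝ) : ℂ) * MvPolynomial.X ν

theorem totalDegree_xiPoly (μ : MoyalIndex N) : (xiPoly θ μ).totalDegree ≤ 1 := by
  rw [xiPoly, MvPolynomial.totalDegree_neg]
  refine MvPolynomial.totalDegree_finsetSum_le fun ν _ => ?_
  refine (MvPolynomial.totalDegree_mul _ _).trans ?_
  simp

/-- The derivation `∂_μ = ad_{iξ_μ}`. -/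
def moyalPartial (μ : MoyalIndex N) : moyalG2 N θ :=
  ⟨innerDer (moyalPoly θ (MvPolynomial.C Complex.I * xiPoly θ μ)), _, by
    refine (MvPolynomial.totalDegree_mul _ _).trans ?_
    rw [MvPolynomial.totalDegree_C]
    have := totalDegree_xiPoly θ μ
    omega, rfl⟩

/-- The derivation `X_(μν) = ad_{iξ_μξ_ν}`, where `ξ_μξ_ν` is the pointwise product. -/
def moyalX2 (μ ν : MoyalIndex N) : moyalG2 N θ :=
  ⟨innerDer (moyalPoly θ (MvPolynomial.C Complex.I * (xiPoly θ μ * xiPoly θ ν))), _, by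
    refine (MvPolynomial.totalDegree_mul _ _).trans ?_
    rw [MvPolynomial.totalDegree_C]
    have h1 := totalDegree_xiPoly θ μ
    have h2 := totalDegree_xiPoly θ ν
    have h3 := MvPolynomial.totalDegree_mul (xiPoly θ μ) (xiPoly θ ν)
    omega, rfl⟩

theorem moyalDeriv_add_left (v w : MoyalSpace N) (T : MoyalAlgebra N θ) :
    moyalDeriv (v + w) T = moyalDeriv v T + moyalDeriv w T :=
  Subtype.ext (lineDerivOp_left_add v w T.1)

theorem moyalDeriv_smul_left (r : ℝ) (v : MoyalSpace N) (T : MoyalAlgebra N θ) :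
    moyalDeriv (r • v) T = (r : ℂ) • moyalDeriv v T :=
  Subtype.ext (lineDerivOp_left_smul r v T.1)

theorem moyalDeriv_sum_left {ι : Type*} (s : Finset ι) (r : ι → ℝ) (v : ι → MoyalSpace N)
    (T : MoyalAlgebra N θ) :
    ∑ i ∈ s, (r i : ℂ) • moyalDeriv (v i) T = moyalDeriv (∑ i ∈ s, r i • v i) T := by
  classical
  induction s using Finset.induction_on with
  | empty =>
    have := moyalDeriv_smul_left θ 0 0 T
    simpa using this.symm
  | insert i s hi ih =>
    rw [Finset.sum_insert hi, Finset.sum_insert hi, moyalDeriv_add_left, moyalDeriv_smul_left, ih]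

/-- `∂_μ = ad_{iξ_μ}` is the partial derivative. -/
theorem moyalPartial_apply (μ : MoyalIndex N) (T : MoyalAlgebra N θ) :
    (moyalPartial θ μ).1 T = moyalDeriv (EuclideanSpace.single μ 1) T := by
  have h0 : moyalPoly θ (MvPolynomial.C Complex.I * xiPoly θ μ) =
      ∑ ν, (-(Complex.I * (((thetaMatrix N θ)⁻¹ μ ν : ℝ) : ℂ))) • moyalX θ ν := by
    rw [xiPoly, mul_neg, Finset.mul_sum, ← Finset.sum_neg_distrib, map_sum]
    refine Finset.sum_congr rfl fun ν _ => ?_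
    rw [moyalX, ← map_smul, ← mul_assoc, ← map_mul, MvPolynomial.C_mul', neg_smul]
  change moyalPoly θ _ * T - T * moyalPoly θ _ = _
  rw [h0, Finset.sum_mul, Finset.mul_sum, ← Finset.sum_sub_distrib]
  simp only [smul_mul_assoc, mul_smul_comm, ← smul_sub, moyalX_lie, smul_smul]
  have h1 : ∀ ν, -(Complex.I * (((thetaMatrix N θ)⁻¹ μ ν : ℝ) : ℂ)) *
      (2 * (2 * Real.pi * Complex.I)⁻¹) = ((-((thetaMatrix N θ)⁻¹ μ ν / Real.pi) : ℝ) : ℂ) := by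
    intro ν
    have := Real.pi_ne_zero
    push_cast
    field_simp
  simp only [h1, moyalDeriv_sum_left]
  congr 1
  ext ρ
  have h2 : ∀ ν, piTheta N θ (EuclideanSpace.single ν 1) ρ = -(Real.pi * thetaMatrix N θ ν ρ) := by
    intro ν
    rw [piTheta_ofLp]
    have h3 := congrFun (congrFun (thetaMatrix_transpose (N := N) θ) ν) ρ
    rw [Matrix.transpose_apply, Matrix.neg_apply] at h3
    simp [h3]
  have h4 := congrFun (congrFun (Matrix.nonsing_inv_mul _ (thetaMatrix_isUnit_det (N := N) θ)) μ) ρ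
  rw [Matrix.mul_apply] at h4
  simp only [WithLp.ofLp_sum, Finset.sum_apply, PiLp.smul_apply, h2, smul_eq_mul]
  rw [PiLp.single_apply, show (if ρ = μ then (1 : ℝ) else 0) =
    (1 : Matrix (MoyalIndex N) (MoyalIndex N) ℝ) μ ρ by simp [Matrix.one_apply, eq_comm], ← h4]
  refine Finset.sum_congr rfl fun ν _ => ?_
  have := Real.pi_ne_zero
  simp
  field_simp

/-- The entries of `Θ⁻¹` as complex numbers. -/
def thetaInv (μ ν : MoyalIndex N) : ℂ := (((thetaMatrix N θ)⁻¹ μ ν : ℝ) : ℂ)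

variable {θ} {n : ℕ}

/-- The component `𝒜_μ = 𝒜(∂_μ)` of the tensor form of a connection on `Mⁿ`. -/
def tensorOne (D : NCConnection (moyalG2 N θ) n) (μ : MoyalIndex N) :
    Matrix (Fin n) (Fin n) (MoyalAlgebra N θ) :=
  D.tensorForm moyalEta (moyalPartial θ μ)

/-- The component `𝒜_(μν) = 𝒜(X_(μν))` of the tensor form of a connection on `Mⁿ`. -/
def tensorTwo (D : NCConnection (moyalG2 N θ) n) (μ ν : MoyalIndex N) :
    Matrix (Fin n) (Fin n) (MoyalAlgebra N θ) :=
  D.tensorForm moyalEta (moyalX2 θ μ ν)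

/-- `B = ∑_A b^A T^A` with antihermitean coefficients `b^A ∈ M`. -/
def IsUnValued (T : Fin (n ^ 2) → selfAdjoint (Matrix (Fin n) (Fin n) ℂ))
    (B : Matrix (Fin n) (Fin n) (MoyalAlgebra N θ)) : Prop :=
  ∃ b : Fin (n ^ 2) → MoyalAlgebra N θ, (∀ k, star (b k) = -b k) ∧
    B = expandIn (fun k => (T k : Matrix (Fin n) (Fin n) ℂ)) b

end Extended

end

/-! ### Connections on free right modules over an arbitrary complex algebra. -/

section GeneralConnections

attribute [local instance] LieRing.ofAssociativeRing

variable {A : Type*} [Ring A] {n : ℕ}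

namespace NCConnection

/-! In the canonical basis of `Aⁿ` a connection reads `∇_X = X + Γ_X`, where `X` acts componentwise
and `Γ_X` is a matrix acting from the left. Hence `𝒜(X) = Γ_X + η(X)·1`, and the curvature is the
matrix `X(Γ_Y) - Y(Γ_X) + [Γ_X, Γ_Y] - Γ_[X,Y]`. The derivations of interest are inner, `X =
ad_{η(X)}`, so letting `X` act on the entries of a matrix is the same as taking the commutator with
the scalar matrix `η(X)`. The derivative terms are thus absorbed into a commutator of the shifted
matrices `𝒜`, and

`F(X, Y) = [𝒜(X), 𝒜(Y)] - 𝒜([X, Y]) + (η([X, Y]) - [η(X), η(Y)])·1`,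

which is `curvatureForm_eq`. It remains to compute the brackets of the generators of `G₂` and the
scalar defect of `η` on them.

Two facts about the Moyal product give the brackets. The commutator with `iξ_μ` is the partial
derivative (`lie_moyalXi`), and the pointwise product with a linear function is half an
anticommutator (`moyalXi_mul_add`). They reduce commutators of quadratic polynomials to those of a
linear with a quadratic one (`lie_moyalXi2_moyalXi2`). As for the defect, `η` discards constant
terms. The commutator `[iξ_μ, iξ_ν] = iΘ⁻¹_{μν}` is nothing but a constant: the `∂_μ` commute as
derivations, and the defect produces the term `-iΘ⁻¹_{μν}`. The commutators that involve a quadratic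
generator are homogeneous of degree one or two in the `ξ`, so there the defect vanishes.

For the values in `𝔲(n)`, hermiticity tested on basis vectors says that `Γ_X` is antihermitean for
real `X` (`star_tensorForm`). The elements `iξ_μ` and `iξ_μξ_ν` are antihermitean, so the generators
are real and their tensor forms are antihermitean; the explicit formulas pass this on to the
curvature. Finally, an antihermitean matrix over a `*`-algebra has antihermitean coefficients in any
real basis of the hermitian matrices (`exists_eq_expandIn`). -/

theorem eq_sum_single_mul (m : Fin n → A) :
    m = ∑ j, fun i => (Pi.single j 1 : Fin n → A) i * m j := by
  ext i
  rw [Finset.sum_apply, Finset.sum_eq_single i]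
  · simp
  · intro j _ hj; simp [hj.symm]
  · simp

variable [Algebra ℂ A]

/-- A right-linear endomorphism of `Aⁿ` acts as its matrix. -/
theorem eq_toMat_mulVec (f : (Fin n → A) →ₗ[ℂ] (Fin n → A))
    (hf : ∀ (m : Fin n → A) (a : A) (i : Fin n), f (fun j => m j * a) i = f m i * a)
    (m : Fin n → A) : f m = (toMat f).mulVec m := by
  ext i
  conv_lhs => rw [eq_sum_single_mul m]
  rw [map_sum, Finset.sum_apply]
  simp only [hf]
  rfl

variable {G : LieSubalgebra ℂ (Module.End ℂ A)}

theorem leibniz_eq (D : NCConnection G n) (X : G) (m : Fin n → A) (a : A) :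
    D X (fun j => m j * a) = (fun i => m i * X.1 a) + fun i => D X m i * a :=
  funext fun i => D.leibniz X m a i

/-- A connection is determined by its values on the canonical basis. -/
theorem apply_eq (D : NCConnection G n) (X : G) (m : Fin n → A) (i : Fin n) :
    D X m i = X.1 (m i) + (toMat (D X)).mulVec m i := by
  conv_lhs => rw [eq_sum_single_mul m]
  rw [map_sum, Finset.sum_apply]
  simp only [D.leibniz, Finset.sum_add_distrib]
  congr 1
  rw [Finset.sum_eq_single i]
  · simp
  · intro j _ hj; simp [hj.symm]
  · simp

/-- Both maps obey the same Leibniz rule, so the terms `m X(a)` cancel in their difference, which is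
therefore right linear, that is, a matrix. For the canonical map the rule needs `X` to be a
derivation, supplied by `hG`; left multiplication by `η X` is right linear anyway. -/
theorem apply_eq_canonical_add (hG : G ≤ algDer A) (D : NCConnection G n) (η : G → A) (X : G)
    (m : Fin n → A) : D X m = canonical n η X m + (D.tensorForm η X).mulVec m := by
  have h := eq_toMat_mulVec (D X - canonical n η X) (fun m a i => by
    have h1 : X.1 (m i * a) = X.1 (m i) * a + m i * X.1 a := hG X.2 _ _
    simp only [LinearMap.sub_apply, Pi.sub_apply, D.leibniz, canonical_apply, h1]
    simp only [sub_mul, mul_assoc]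
    abel) m
  rw [tensorForm, ← h, LinearMap.sub_apply]
  abel

/-- The mixed terms `∇_X(m) Y(a)` and `∇_Y(m) X(a)` are symmetric in `X` and `Y` and drop out of the
commutator. The remaining inhomogeneous part is `m [X, Y](a)`, which `∇_[X,Y]` removes. -/
theorem curvature_eq_mulVec (D : NCConnection G n) (X Y : G) (m : Fin n → A) :
    D.curvature X Y m = (D.curvatureForm X Y).mulVec m := by
  refine eq_toMat_mulVec _ (fun m a i => ?_) m
  have h1 : (⁅X, Y⁆ : G).1 a = X.1 (Y.1 a) - Y.1 (X.1 a) := rfl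
  simp only [curvature, LinearMap.sub_apply, LinearMap.comp_apply, leibniz_eq, map_add,
    Pi.sub_apply, Pi.add_apply, h1, mul_sub, sub_mul]
  abel

/-- A derivation kills `1`, so on basis vectors the canonical map is just multiplication by `-η X`.
-/
theorem tensorForm_eq (hG : G ≤ algDer A) (D : NCConnection G n) (η : G → A) (X : G) :
    D.tensorForm η X = toMat (D X) + Matrix.scalar (Fin n) (η X) := by
  have h1 : X.1 (1 : A) = 0 := by
    have h : X.1 ((1 : A) * 1) = X.1 1 * 1 + 1 * X.1 1 := hG X.2 _ _
    simpa using h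
  ext i j
  change D X (Pi.single j 1) i - (X.1 ((Pi.single j 1 : Fin n → A) i) -
    η X * (Pi.single j 1 : Fin n → A) i) = D X (Pi.single j 1) i + _
  rw [sub_eq_add_neg]
  congr 1
  by_cases h : i = j
  · subst h; simp [h1]
  · simp [h]

/-- The structure equation for the potential `toMat (D X)`: by `apply_eq`, `∇_X` differentiates each
column of `toMat (D Y)` entrywise and multiplies it by `toMat (D X)`. -/
theorem curvatureForm_apply (D : NCConnection G n) (X Y : G) :
    D.curvatureForm X Y = (toMat (D Y)).map X.1 - (toMat (D X)).map Y.1 +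
      (toMat (D X) * toMat (D Y) - toMat (D Y) * toMat (D X)) - toMat (D ⁅X, Y⁆) := by
  ext i j
  change D X (D Y (Pi.single j 1)) i - D Y (D X (Pi.single j 1)) i - D ⁅X, Y⁆ (Pi.single j 1) i =
    _
  rw [apply_eq D X (D Y _), apply_eq D Y (D X _)]
  change X.1 (toMat (D Y) i j) + (toMat (D X) * toMat (D Y)) i j -
    (Y.1 (toMat (D X) i j) + (toMat (D Y) * toMat (D X)) i j) - toMat (D ⁅X, Y⁆) i j = _
  simp only [Matrix.add_apply, Matrix.sub_apply, Matrix.map_apply]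
  abel

/-- The curvature in terms of the tensor form, for a `1`-form `η` which implements `X` and `Y`
as inner derivations. -/
theorem curvatureForm_eq (hG : G ≤ algDer A) (D : NCConnection G n) (η : G → A) (X Y : G)
    (hX : X.1 = innerDer (η X)) (hY : Y.1 = innerDer (η Y)) :
    D.curvatureForm X Y = (D.tensorForm η X * D.tensorForm η Y -
      D.tensorForm η Y * D.tensorForm η X) - D.tensorForm η ⁅X, Y⁆ +
        Matrix.scalar (Fin n) (η ⁅X, Y⁆ - (η X * η Y - η Y * η X)) := by
  -- An inner derivation acting entrywise is a commutator with a scalar matrix; this is where the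
  -- derivative terms of the structure equation become algebraic.
  have h : ∀ (a : A) (M : Matrix (Fin n) (Fin n) A), M.map (innerDer a) =
      Matrix.scalar (Fin n) a * M - M * Matrix.scalar (Fin n) a := by
    intro a M
    ext i j
    simp [innerDer_apply]
  rw [curvatureForm_apply D]
  simp only [tensorForm_eq hG, hX, hY, h, map_sub, map_mul]
  -- With `𝒜 = Γ + η`, both sides equal `[η_X, Γ_Y] - [η_Y, Γ_X] + [Γ_X, Γ_Y] - Γ_[X,Y]`.
  noncomm_ring

/-- Here `η` is a bare function, so additivity is asked only at the pair in question; the rest is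
linearity of `X ↦ ∇_X`. Together with `tensorForm_smul` this yields `tensorFormLin`. -/
theorem tensorForm_add {η : G → A} (D : NCConnection G n) {X Y Z : G} (hZ : Z = X + Y)
    (hη : η Z = η X + η Y) :
    D.tensorForm η Z = D.tensorForm η X + D.tensorForm η Y := by
  subst hZ
  ext i j
  simp only [tensorForm, toMat, Matrix.of_apply, Matrix.add_apply, LinearMap.sub_apply,
    Pi.sub_apply, canonical_apply, map_add, LinearMap.add_apply, Pi.add_apply, hη, add_mul]
  change _ + _ - (X.1 _ + Y.1 _ - _) = _
  abel

theorem tensorForm_smul {η : G → A} (D : NCConnection G n) {c : ℂ} {X Z : G} (hZ : Z = c • X)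
    (hη : η Z = c • η X) : D.tensorForm η Z = c • D.tensorForm η X := by
  subst hZ
  ext i j
  simp only [tensorForm, toMat, Matrix.of_apply, Matrix.smul_apply, LinearMap.sub_apply,
    Pi.sub_apply, canonical_apply, map_smul, LinearMap.smul_apply, Pi.smul_apply, hη,
    smul_mul_assoc, smul_sub]
  rfl

/-- The tensor form of a hermitean connection is antihermitean on real derivations. -/
theorem star_tensorForm [StarRing A] (hG : G ≤ algDer A) (D : NCConnection G n)
    (hD : D.IsHermitean) {η : G → A} {X : G} (hX : IsRealDer X.1) (hη : star (η X) = -η X) :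
    (D.tensorForm η X).conjTranspose = -D.tensorForm η X := by
  have h1 : X.1 (1 : A) = 0 := by
    have h : X.1 ((1 : A) * 1) = X.1 1 * 1 + 1 * X.1 1 := hG X.2 _ _
    simpa using h
  rw [tensorForm_eq hG]
  ext i j
  -- Writing `Γ = toMat (D X)`, hermiticity on the basis vectors `e_j`, `e_i` reads `X(δ_ij) = Γ_ij†
  -- + Γ_ji`, and the left side vanishes because `X(1) = 0`.
  have h2 := hD X hX (Pi.single j 1) (Pi.single i 1)
  have h3 : hermStructure (D X (Pi.single j 1)) (Pi.single i 1) = star (toMat (D X) i j) := by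
    rw [hermStructure, Finset.sum_eq_single i]
    · simp [toMat]
    · intro k _ hk; simp [hk]
    · simp
  have h4 : hermStructure (Pi.single j 1) (D X (Pi.single i 1)) = toMat (D X) j i := by
    rw [hermStructure, Finset.sum_eq_single j]
    · simp [toMat]
    · intro k _ hk; simp [hk]
    · simp
  have h5 : X.1 (hermStructure (Pi.single j (1 : A)) (Pi.single i 1)) = 0 := by
    rw [hermStructure, Finset.sum_eq_single j]
    · by_cases h : j = i
      · subst h; simp [h1]
      · simp [h]
    · intro k _ hk; simp [hk]
    · simp
  rw [h3, h4, h5] at h2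
  have h6 : star (toMat (D X) j i) = -toMat (D X) i j := by
    rw [← star_inj, star_star, star_neg]
    exact eq_neg_of_add_eq_zero_right h2.symm
  simp only [Matrix.conjTranspose_apply, Matrix.add_apply, star_add, h6, Matrix.neg_apply, neg_add]
  congr 1
  by_cases h : i = j
  · subst h; simp [hη]
  · simp [h, Ne.symm h]

end NCConnection

/-! ### Antihermitean matrices expanded in a real basis of the hermitian ones. -/

open ComplexStarModule in
/-- An antihermitean matrix over a complex `*`-algebra expands in a real basis of the hermitian
matrices, with antihermitean coefficients. -/
theorem exists_eq_expandIn [Algebra ℂ A] [StarRing A] [StarModule ℂ A] {ι : Type*} [Fintype ι]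
    (T : Module.Basis ι ℝ (selfAdjoint (Matrix (Fin n) (Fin n) ℂ)))
    {B : Matrix (Fin n) (Fin n) A} (hB : B.conjTranspose = -B) :
    ∃ b : ι → A, (∀ k, star (b k) = -b k) ∧
      B = expandIn (fun k => (T k : Matrix (Fin n) (Fin n) ℂ)) b := by
  classical
  let E : Fin n → Fin n → Matrix (Fin n) (Fin n) ℂ := fun i j => Matrix.single i j 1
  -- The hermitian matrices are a real form of `M_n(ℂ)`: the complex coordinates of a matrix unit
  -- are obtained by expanding its real and imaginary parts, both hermitian, in `T`.
  let c : ι → Fin n → Fin n → ℂ := fun k i j =>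
    (T.repr (realPart (E i j)) k : ℂ) + Complex.I * (T.repr (imaginaryPart (E i j)) k : ℂ)
  have hE : ∀ i j, ∑ k, c k i j • (T k : Matrix (Fin n) (Fin n) ℂ) = E i j := by
    intro i j
    have hs : ∀ S : selfAdjoint (Matrix (Fin n) (Fin n) ℂ),
        ∑ k, (T.repr S k : ℂ) • (T k : Matrix (Fin n) (Fin n) ℂ) = S := by
      intro S
      rw [← congrArg Subtype.val (T.sum_repr S), AddSubgroup.val_finsetSum]
      rfl
    simp only [c, add_smul, Finset.sum_add_distrib, mul_smul, ← Finset.smul_sum, hs]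
    exact realPart_add_I_smul_imaginaryPart _
  have hEs : ∀ i j, star (E i j) = E j i := by
    intro i j
    simp [E, Matrix.star_eq_conjTranspose, Matrix.conjTranspose_single]
  -- Passing to the adjoint keeps the real part and reverses the imaginary part, so it conjugates
  -- the coordinates; and the adjoint of `E i j` is `E j i`.
  have hc : ∀ k i j, star (c k i j) = c k j i := by
    intro k i j
    have hr : realPart (E j i) = realPart (E i j) := by
      ext1; rw [realPart_apply_coe, realPart_apply_coe, ← hEs i j, star_star, add_comm]
    have hi : imaginaryPart (E j i) = -imaginaryPart (E i j) := by
      ext1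
      rw [AddSubgroup.coe_neg, imaginaryPart_apply_coe, imaginaryPart_apply_coe, ← hEs i j,
        star_star, ← smul_neg, ← smul_neg, neg_sub]
    simp [c, hr, hi]
  -- These coefficients come from inserting the expansion of each `E i j` into `B = ∑ E_ij ⊗ B_ij`.
  -- The star exchanges `i` and `j` both in `c` and in `B`, the latter with a sign, so swapping the
  -- two sums gives antihermiticity.
  refine ⟨fun k => ∑ i, ∑ j, c k i j • B i j, fun k => ?_, ?_⟩
  · have hB' : ∀ i j, star (B i j) = -B j i := fun i j => congrFun (congrFun hB j) i
    simp only [star_sum, star_smul, hc, hB', smul_neg, Finset.sum_neg_distrib]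
    rw [Finset.sum_comm]
  · ext p q
    have h : ∀ i j, ∑ k, (c k i j * (T k : Matrix (Fin n) (Fin n) ℂ) p q) = E i j p q := by
      intro i j
      rw [← hE i j, Matrix.sum_apply]
      rfl
    simp only [expandIn, Matrix.of_apply, Finset.smul_sum, smul_smul]
    rw [Finset.sum_comm]
    have h2 : ∀ i, ∑ k, ∑ j, ((T k : Matrix (Fin n) (Fin n) ℂ) p q * c k i j) • B i j =
        ∑ j, E i j p q • B i j := by
      intro i
      rw [Finset.sum_comm]
      refine Finset.sum_congr rfl fun j _ => ?_
      rw [← h, Finset.sum_smul]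
      simp only [mul_comm]
    simp only [h2, E]
    rw [Finset.sum_eq_single p, Finset.sum_eq_single q]
    · simp
    · intro j _ hj; simp [hj]
    · simp
    · intro i _ hi; simp [hi]
    · simp

end GeneralConnections

/-! ### The polynomials `ξ_μ`, the involution and real inner derivations. -/

noncomputable section

section MoyalCurvature

attribute [local instance] LieRing.ofAssociativeRing

variable {N n : ℕ} (θ : ℝ)

theorem eval_zero_xiPoly (μ : MoyalIndex N) : MvPolynomial.eval 0 (xiPoly θ μ) = 0 := by
  simp [xiPoly]

/-- The coefficients are entries of the real matrix `Θ⁻¹`. This is the source of the reality of the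
derivations `∂_μ` and `X_(μν)`. -/
theorem map_conj_xiPoly (μ : MoyalIndex N) :
    MvPolynomial.map (starRingEnd ℂ) (xiPoly θ μ) = xiPoly θ μ := by
  simp [xiPoly]

theorem pderiv_xiPoly (μ ν : MoyalIndex N) :
    MvPolynomial.pderiv μ (xiPoly θ ν) = MvPolynomial.C (-thetaInv θ ν μ) := by
  simp only [xiPoly, map_neg, map_sum, MvPolynomial.pderiv_C_mul, MvPolynomial.pderiv_X]
  rw [Finset.sum_eq_single μ]
  · simp [thetaInv]
  · intro j _ hj; simp [hj]
  · simp

theorem star_thetaInv (μ ν : MoyalIndex N) : star (thetaInv θ μ ν) = thetaInv θ μ ν :=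
  Complex.conj_ofReal _

variable {θ} [NeZero θ]

/-- The polynomial functions are evaluated at real points, where conjugating the value amounts to
conjugating the coefficients. -/
theorem star_moyalPoly (p : MvPolynomial (MoyalIndex N) ℂ) :
    star (moyalPoly θ p) = moyalPoly θ (MvPolynomial.map (starRingEnd ℂ) p) := by
  refine Subtype.ext ?_
  ext b
  change star (polyDist p (schwartzConj b)) = polyDist _ b
  rw [polyDist_apply, polyDist_apply]
  refine integral_conj.symm.trans (integral_congr_ae (Eventually.of_forall fun x => ?_))
  have h : polyFun (MvPolynomial.map (starRingEnd ℂ) p) x = star (polyFun p x) := by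
    rw [polyFun, polyFun, MvPolynomial.eval_map]
    -- Evaluation is rewritten as `eval₂` along the identity so that `eval₂_comp_left` can move the
    -- conjugation inside.
    change _ = starRingEnd ℂ (MvPolynomial.eval₂ (RingHom.id ℂ) _ p)
    rw [MvPolynomial.eval₂_comp_left]
    simp [Function.comp_def]
  change starRingEnd ℂ (schwartzConj b x * polyFun p x) = b x * polyFun _ x
  rw [h, schwartzConj_apply]
  simp

theorem innerDer_add {A : Type*} [Ring A] [Algebra ℂ A] (a b : A) :
    innerDer (a + b) = innerDer a + innerDer b := by
  ext c
  simp only [innerDer_apply, LinearMap.add_apply, add_mul, mul_add]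
  abel

theorem innerDer_smul {A : Type*} [Ring A] [Algebra ℂ A] (r : ℂ) (a : A) :
    innerDer (r • a) = r • innerDer a := by
  ext c
  simp only [innerDer_apply, LinearMap.smul_apply, smul_mul_assoc, mul_smul_comm, smul_sub]

/-- The adjoint of `[a, b]` is `[b†, a†]`, which equals `[a, b†]` when `a† = -a`. -/
theorem isRealDer_innerDer {A : Type*} [Ring A] [Algebra ℂ A] [StarRing A] {a : A}
    (ha : star a = -a) : IsRealDer (innerDer a) := by
  intro b
  simp only [innerDer_apply, star_sub, star_mul, ha, neg_mul, mul_neg]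
  abel

/-- The two signs cancel in each product, while the adjoint reverses the order of the factors. -/
theorem conjTranspose_commutator {A : Type*} [Ring A] [StarRing A]
    {B C : Matrix (Fin n) (Fin n) A} (hB : B.conjTranspose = -B) (hC : C.conjTranspose = -C) :
    (B * C - C * B).conjTranspose = -(B * C - C * B) := by
  rw [Matrix.conjTranspose_sub, Matrix.conjTranspose_mul, Matrix.conjTranspose_mul, hB, hC]
  noncomm_ring

variable (θ)

/-- The element `ξ_μ` of the Moyal algebra. -/
def moyalXi (μ : MoyalIndex N) : MoyalAlgebra N θ := moyalPoly θ (xiPoly θ μ)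

/-- The element `ξ_μξ_ν` (pointwise product) of the Moyal algebra. -/
def moyalXi2 (μ ν : MoyalIndex N) : MoyalAlgebra N θ :=
  moyalPoly θ (xiPoly θ μ * xiPoly θ ν)

/-- The transpose of `Θ⁻¹` is the inverse of `-Θ`, hence `-Θ⁻¹`. -/
theorem thetaInv_swap (μ ν : MoyalIndex N) : thetaInv θ ν μ = -thetaInv θ μ ν := by
  have h : ((thetaMatrix N θ)⁻¹).transpose = -(thetaMatrix N θ)⁻¹ := by
    rw [Matrix.transpose_nonsing_inv, thetaMatrix_transpose]
    refine Matrix.inv_eq_left_inv ?_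
    rw [neg_mul_neg, Matrix.nonsing_inv_mul _ (thetaMatrix_isUnit_det θ)]
  have h2 := congrFun (congrFun h μ) ν
  rw [Matrix.transpose_apply, Matrix.neg_apply] at h2
  simp [thetaInv, h2]

theorem moyalPartial_val (μ : MoyalIndex N) :
    (moyalPartial θ μ).1 = innerDer (Complex.I • moyalXi θ μ) := by
  rw [moyalXi, ← map_smul, MvPolynomial.smul_eq_C_mul]; rfl

theorem moyalX2_val (μ ν : MoyalIndex N) :
    (moyalX2 θ μ ν).1 = innerDer (Complex.I • moyalXi2 θ μ ν) := by
  rw [moyalXi2, ← map_smul, MvPolynomial.smul_eq_C_mul]; rfl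

/-- The polynomial `iξ_μ` vanishes at the origin, so `η` returns it without any correction; the same
happens in `moyalEta_X2`. -/
theorem moyalEta_partial (μ : MoyalIndex N) :
    moyalEta (moyalPartial θ μ) = Complex.I • moyalXi θ μ := by
  rw [moyalEta_eq (moyalPartial θ μ) (p := MvPolynomial.C Complex.I * xiPoly θ μ) rfl, moyalXi,
    ← map_smul, MvPolynomial.smul_eq_C_mul, map_mul, eval_zero_xiPoly]
  simp

theorem moyalEta_X2 (μ ν : MoyalIndex N) :
    moyalEta (moyalX2 θ μ ν) = Complex.I • moyalXi2 θ μ ν := by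
  rw [moyalEta_eq (moyalX2 θ μ ν) (p := MvPolynomial.C Complex.I * (xiPoly θ μ * xiPoly θ ν)) rfl,
    moyalXi2, ← map_smul, MvPolynomial.smul_eq_C_mul, map_mul,
    map_mul (MvPolynomial.eval 0) (xiPoly θ μ), eval_zero_xiPoly]
  simp

/-! ### Linearity of `η` and of the tensor form. -/

theorem moyalPoly_sub_eval_add (p q : MvPolynomial (MoyalIndex N) ℂ) :
    moyalPoly θ (p + q - MvPolynomial.C (MvPolynomial.eval 0 (p + q))) =
      moyalPoly θ (p - MvPolynomial.C (MvPolynomial.eval 0 p)) +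
        moyalPoly θ (q - MvPolynomial.C (MvPolynomial.eval 0 q)) := by
  rw [← (moyalPoly θ).map_add, map_add (MvPolynomial.eval 0), MvPolynomial.C_add,
    add_sub_add_comm]

theorem moyalPoly_sub_eval_smul (c : ℂ) (p : MvPolynomial (MoyalIndex N) ℂ) :
    moyalPoly θ (c • p - MvPolynomial.C (MvPolynomial.eval 0 (c • p))) =
      c • moyalPoly θ (p - MvPolynomial.C (MvPolynomial.eval 0 p)) := by
  rw [← (moyalPoly θ).map_smul, MvPolynomial.smul_eval, smul_sub, MvPolynomial.C_mul,
    MvPolynomial.C_mul']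

variable {θ} in
theorem exists_eq_innerDer (X : moyalG2 N θ) :
    ∃ p : MvPolynomial (MoyalIndex N) ℂ, X.1 = innerDer (moyalPoly θ p) :=
  let ⟨p, _, hp⟩ := X.2
  ⟨p, hp.symm⟩

-- Since `moyalEta` is built from a chosen polynomial, its linearity is not automatic. By
-- `moyalEta_eq` any polynomial implementing the derivation may be used, and a sum of
-- representatives implements the sum, even if it is not the chosen representative.
variable {θ} in
theorem moyalEta_add (X Y : moyalG2 N θ) : moyalEta (X + Y) = moyalEta X + moyalEta Y := by
  obtain ⟨p, hp⟩ := exists_eq_innerDer X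
  obtain ⟨q, hq⟩ := exists_eq_innerDer Y
  have h1 : moyalPoly θ (p + q) = moyalPoly θ p + moyalPoly θ q := map_add _ _ _
  have h2 : (X + Y).1 = X.1 + Y.1 := rfl
  have h : (X + Y).1 = innerDer (moyalPoly θ (p + q)) := by
    rw [h2, h1, innerDer_add, ← hp, ← hq]
  rw [moyalEta_eq X hp, moyalEta_eq Y hq, moyalEta_eq (X + Y) h]
  exact moyalPoly_sub_eval_add θ p q

variable {θ} in
theorem moyalEta_smul (c : ℂ) (X : moyalG2 N θ) : moyalEta (c • X) = c • moyalEta X := by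
  obtain ⟨p, hp⟩ := exists_eq_innerDer X
  have h1 : moyalPoly θ (c • p) = c • moyalPoly θ p := map_smul _ _ _
  have h2 : (c • X).1 = c • X.1 := rfl
  have h : (c • X).1 = innerDer (moyalPoly θ (c • p)) := by
    rw [h2, h1, innerDer_smul, ← hp]
  rw [moyalEta_eq X hp, moyalEta_eq (c • X) h]
  exact moyalPoly_sub_eval_smul θ c p

variable {θ} in
/-- The tensor form of a connection for the form `η`, as a linear map. -/
def tensorFormLin (D : NCConnection (moyalG2 N θ) n) :
    moyalG2 N θ →ₗ[ℂ] Matrix (Fin n) (Fin n) (MoyalAlgebra N θ) where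
  toFun X := D.tensorForm moyalEta X
  map_add' X Y := D.tensorForm_add rfl (moyalEta_add X Y)
  map_smul' c X := D.tensorForm_smul rfl (moyalEta_smul c X)

/-! ### Moyal commutators of the elements `ξ_μ` and `ξ_μξ_ν`. -/

/-- This is the identity of `ad_{iξ_μ}` with the partial derivative, divided by `i` and evaluated on
polynomials. All the commutators below are derived from it. -/
theorem lie_moyalXi (μ : MoyalIndex N) (p : MvPolynomial (MoyalIndex N) ℂ) :
    moyalXi θ μ * moyalPoly θ p - moyalPoly θ p * moyalXi θ μ =
      -Complex.I • moyalPoly θ (MvPolynomial.pderiv μ p) := by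
  have h := moyalPartial_apply θ μ (moyalPoly θ p)
  rw [moyalPartial_val, innerDer_apply, moyalDeriv_moyalPoly, smul_mul_assoc, mul_smul_comm,
    ← smul_sub, Finset.sum_eq_single μ (fun j _ hj => by simp [hj]) (by simp)] at h
  simp only [PiLp.single_apply, if_true, Complex.ofReal_one, one_smul] at h
  rw [← h, smul_smul]
  simp

theorem lie_moyalXi_moyalXi (μ ν : MoyalIndex N) :
    moyalXi θ μ * moyalXi θ ν - moyalXi θ ν * moyalXi θ μ =
      (-Complex.I * thetaInv θ μ ν) • (1 : MoyalAlgebra N θ) := by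
  -- Only `ξ_ν` is unfolded to a polynomial, so that `lie_moyalXi` matches with `ξ_μ` left folded.
  conv_lhs => rw [moyalXi.eq_1 θ ν]
  rw [lie_moyalXi, pderiv_xiPoly, MvPolynomial.C_eq_smul_one, map_smul, moyalPoly_one,
    thetaInv_swap, neg_neg, smul_smul]

/-- The commutator with `ξ_μ` is a derivative, so the product rule for the pointwise product
applies. Antisymmetry turns the derivative `-Θ⁻¹_{ρμ}` of `ξ_ρ` into `Θ⁻¹_{μρ}`. -/
theorem lie_moyalXi_moyalXi2 (μ ρ σ : MoyalIndex N) :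
    moyalXi θ μ * moyalXi2 θ ρ σ - moyalXi2 θ ρ σ * moyalXi θ μ =
      -Complex.I • (thetaInv θ μ ρ • moyalXi θ σ + thetaInv θ μ σ • moyalXi θ ρ) := by
  rw [moyalXi2, lie_moyalXi, MvPolynomial.pderiv_mul, pderiv_xiPoly, pderiv_xiPoly,
    thetaInv_swap θ μ ρ, thetaInv_swap θ μ σ, neg_neg, neg_neg, mul_comm (xiPoly θ ρ),
    ← MvPolynomial.smul_eq_C_mul, ← MvPolynomial.smul_eq_C_mul, map_add, map_smul, map_smul]
  rfl

/-- Left and right Moyal multiplication by a coordinate are pointwise multiplication plus,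
respectively minus, the same first-order derivative term (`moyalX_mul`, `mul_moyalX`), which cancels
in the anticommutator. This makes pointwise products with linear functions accessible to pure
algebra in `M`. -/
theorem moyalXi_mul_add (μ : MoyalIndex N) (p : MvPolynomial (MoyalIndex N) ℂ) :
    moyalXi θ μ * moyalPoly θ p + moyalPoly θ p * moyalXi θ μ =
      (2 : ℂ) • moyalPoly θ (xiPoly θ μ * p) := by
  have h1 : ∀ i, moyalX θ i * moyalPoly θ p + moyalPoly θ p * moyalX θ i =
      (2 : ℂ) • moyalPoly θ (MvPolynomial.X i * p) := by
    intro i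
    rw [moyalX_mul, mul_moyalX, mul_comm (MvPolynomial.X i), moyalPoly_mul_X, two_smul]
    abel
  have h2 : moyalXi θ μ = ∑ ν, (-thetaInv θ μ ν) • moyalX θ ν := by
    rw [moyalXi, xiPoly, map_neg, map_sum, ← Finset.sum_neg_distrib]
    refine Finset.sum_congr rfl fun ν _ => ?_
    rw [MvPolynomial.C_mul', map_smul, neg_smul]; rfl
  have h3 : xiPoly θ μ * p = ∑ ν, (-thetaInv θ μ ν) • (MvPolynomial.X ν * p) := by
    rw [xiPoly, neg_mul, Finset.sum_mul, ← Finset.sum_neg_distrib]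
    refine Finset.sum_congr rfl fun ν _ => ?_
    rw [MvPolynomial.C_mul', neg_smul, smul_mul_assoc]; rfl
  rw [h2, h3, map_sum, Finset.sum_mul, Finset.mul_sum, ← Finset.sum_add_distrib, Finset.smul_sum]
  refine Finset.sum_congr rfl fun ν _ => ?_
  rw [smul_mul_assoc, mul_smul_comm, ← smul_add, h1, map_smul, smul_comm]

/-- By `moyalXi_mul_add`, `ξ_μξ_ν` is the symmetrised Moyal product of its factors. The commutator
with `ξ_ρξ_σ` acts on it by the Leibniz rule, replacing one factor by a combination of `ξ_ρ` and
`ξ_σ`. The outcome is again symmetrised, hence a combination of pointwise products, and no ordering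
constants arise. -/
theorem lie_moyalXi2_moyalXi2 (μ ν ρ σ : MoyalIndex N) :
    moyalXi2 θ μ ν * moyalXi2 θ ρ σ - moyalXi2 θ ρ σ * moyalXi2 θ μ ν =
      -Complex.I • (thetaInv θ μ ρ • moyalXi2 θ ν σ + thetaInv θ μ σ • moyalXi2 θ ν ρ +
        thetaInv θ ν ρ • moyalXi2 θ μ σ + thetaInv θ ν σ • moyalXi2 θ μ ρ) := by
  have h : ∀ α β : MoyalIndex N, moyalXi θ α * moyalXi θ β + moyalXi θ β * moyalXi θ α =
      (2 : ℂ) • moyalXi2 θ α β := fun α β => moyalXi_mul_add θ α (xiPoly θ β)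
  -- The Leibniz rule, with `2 ξ_μξ_ν` replaced by the anticommutator of `ξ_μ` and `ξ_ν`.
  have hl : (2 : ℂ) • (moyalXi2 θ μ ν * moyalXi2 θ ρ σ - moyalXi2 θ ρ σ * moyalXi2 θ μ ν) =
      (moyalXi θ μ * (moyalXi θ ν * moyalXi2 θ ρ σ - moyalXi2 θ ρ σ * moyalXi θ ν) +
      (moyalXi θ ν * moyalXi2 θ ρ σ - moyalXi2 θ ρ σ * moyalXi θ ν) * moyalXi θ μ) +
      (moyalXi θ ν * (moyalXi θ μ * moyalXi2 θ ρ σ - moyalXi2 θ ρ σ * moyalXi θ μ) +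
      (moyalXi θ μ * moyalXi2 θ ρ σ - moyalXi2 θ ρ σ * moyalXi θ μ) * moyalXi θ ν) := by
    rw [smul_sub, ← smul_mul_assoc, ← mul_smul_comm, ← h μ ν]
    noncomm_ring
  -- Each anticommutator is converted back to pointwise products with the same factor `2`, which is
  -- cancelled at the end.
  have hr : ∀ (α β γ : MoyalIndex N) (r s : ℂ),
      moyalXi θ α * (-Complex.I • (r • moyalXi θ β + s • moyalXi θ γ)) +
        (-Complex.I • (r • moyalXi θ β + s • moyalXi θ γ)) * moyalXi θ α =
      (2 : ℂ) • (-Complex.I • (r • moyalXi2 θ α β + s • moyalXi2 θ α γ)) := by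
    intro α β γ r s
    rw [mul_smul_comm, smul_mul_assoc, ← smul_add, smul_comm (2 : ℂ), smul_add (2 : ℂ),
      smul_comm (2 : ℂ), smul_comm (2 : ℂ), ← h, ← h]
    simp only [mul_add, add_mul, mul_smul_comm, smul_mul_assoc, smul_add]
    abel
  rw [lie_moyalXi_moyalXi2, lie_moyalXi_moyalXi2, hr, hr, ← smul_add] at hl
  rw [smul_right_injective (MoyalAlgebra N θ) (two_ne_zero (α := ℂ)) hl, ← smul_add]
  congr 1
  abel

theorem star_I_smul_moyalXi (μ : MoyalIndex N) :
    star (Complex.I • moyalXi θ μ) = -(Complex.I • moyalXi θ μ) := by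
  rw [star_smul, moyalXi, star_moyalPoly, map_conj_xiPoly]
  simp

theorem star_I_smul_moyalXi2 (μ ν : MoyalIndex N) :
    star (Complex.I • moyalXi2 θ μ ν) = -(Complex.I • moyalXi2 θ μ ν) := by
  rw [star_smul, moyalXi2, star_moyalPoly, map_mul, map_conj_xiPoly, map_conj_xiPoly]
  simp

/-- The rescaling from `ξ` to `iξ` that makes the structure constants of the generators real:
`i·i·(-i) = i`. -/
theorem lie_I_smul {A : Type*} [Ring A] [Algebra ℂ A] {a b c : A}
    (h : a * b - b * a = -Complex.I • c) :
    (Complex.I • a) * (Complex.I • b) - (Complex.I • b) * (Complex.I • a) = Complex.I • c := by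
  rw [smul_mul_smul_comm, smul_mul_smul_comm, ← smul_sub, h, smul_smul]
  simp

/-! ### Brackets of the generators of `G₂` and the scalar defect of `η`. -/

/-- The commutator of `iξ_μ` and `iξ_ν` is a multiple of `1`, so the inner derivation it defines is
zero although the commutator itself need not be. -/
theorem lie_moyalPartial_moyalPartial (μ ν : MoyalIndex N) :
    ⁅moyalPartial θ μ, moyalPartial θ ν⁆ = 0 := by
  refine Subtype.ext ?_
  change ⁅(moyalPartial θ μ).1, (moyalPartial θ ν).1⁆ = 0
  rw [moyalPartial_val, moyalPartial_val, lie_innerDer,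
    lie_I_smul ((lie_moyalXi_moyalXi θ μ ν).trans (mul_smul _ _ _))]
  ext T : 1
  simp [innerDer_apply]

theorem lie_moyalPartial_moyalX2 (μ ρ σ : MoyalIndex N) :
    ⁅moyalPartial θ μ, moyalX2 θ ρ σ⁆ =
      thetaInv θ μ ρ • moyalPartial θ σ + thetaInv θ μ σ • moyalPartial θ ρ := by
  refine Subtype.ext ?_
  change ⁅(moyalPartial θ μ).1, (moyalX2 θ ρ σ).1⁆ =
    thetaInv θ μ ρ • (moyalPartial θ σ).1 + thetaInv θ μ σ • (moyalPartial θ ρ).1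
  simp only [moyalPartial_val, moyalX2_val]
  rw [lie_innerDer, lie_I_smul (lie_moyalXi_moyalXi2 θ μ ρ σ)]
  simp only [← innerDer_smul, ← innerDer_add, smul_add, smul_comm Complex.I]

theorem lie_moyalX2_moyalX2 (μ ν ρ σ : MoyalIndex N) :
    ⁅moyalX2 θ μ ν, moyalX2 θ ρ σ⁆ =
      thetaInv θ μ ρ • moyalX2 θ ν σ + thetaInv θ μ σ • moyalX2 θ ν ρ +
        thetaInv θ ν ρ • moyalX2 θ μ σ + thetaInv θ ν σ • moyalX2 θ μ ρ := by
  refine Subtype.ext ?_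
  change ⁅(moyalX2 θ μ ν).1, (moyalX2 θ ρ σ).1⁆ =
    thetaInv θ μ ρ • (moyalX2 θ ν σ).1 + thetaInv θ μ σ • (moyalX2 θ ν ρ).1 +
      thetaInv θ ν ρ • (moyalX2 θ μ σ).1 + thetaInv θ ν σ • (moyalX2 θ μ ρ).1
  simp only [moyalX2_val]
  rw [lie_innerDer, lie_I_smul (lie_moyalXi2_moyalXi2 θ μ ν ρ σ)]
  simp only [← innerDer_smul, ← innerDer_add, smul_add, smul_comm Complex.I]

/-- There is no defect here, since the commutator of `iξ_μ` with `iξ_ρξ_σ` is a combination of the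
`ξ` alone and `η` has no constant term to discard. In `moyalEta_lie_X2_X2` the commutator is
likewise a combination of the `ξ_αξ_β`. -/
theorem moyalEta_lie_partial_X2 (μ ρ σ : MoyalIndex N) :
    moyalEta ⁅moyalPartial θ μ, moyalX2 θ ρ σ⁆ =
      moyalEta (moyalPartial θ μ) * moyalEta (moyalX2 θ ρ σ) -
        moyalEta (moyalX2 θ ρ σ) * moyalEta (moyalPartial θ μ) := by
  rw [lie_moyalPartial_moyalX2]
  simp only [moyalEta_add, moyalEta_smul, moyalEta_partial, moyalEta_X2]
  rw [lie_I_smul (lie_moyalXi_moyalXi2 θ μ ρ σ), smul_add, smul_comm Complex.I,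
    smul_comm Complex.I]

theorem moyalEta_lie_X2_X2 (μ ν ρ σ : MoyalIndex N) :
    moyalEta ⁅moyalX2 θ μ ν, moyalX2 θ ρ σ⁆ =
      moyalEta (moyalX2 θ μ ν) * moyalEta (moyalX2 θ ρ σ) -
        moyalEta (moyalX2 θ ρ σ) * moyalEta (moyalX2 θ μ ν) := by
  rw [lie_moyalX2_moyalX2]
  simp only [moyalEta_add, moyalEta_smul, moyalEta_X2]
  rw [lie_I_smul (lie_moyalXi2_moyalXi2 θ μ ν ρ σ)]
  simp only [smul_add, smul_comm Complex.I]

/-- Together with `moyalX2_eq_innerDer_eta`, this is the condition under which `curvatureForm_eq`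
applies to the generators. -/
theorem moyalPartial_eq_innerDer_eta (μ : MoyalIndex N) :
    (moyalPartial θ μ).1 = innerDer (moyalEta (moyalPartial θ μ)) := by
  rw [moyalEta_partial, moyalPartial_val]

theorem moyalX2_eq_innerDer_eta (μ ν : MoyalIndex N) :
    (moyalX2 θ μ ν).1 = innerDer (moyalEta (moyalX2 θ μ ν)) := by
  rw [moyalEta_X2, moyalX2_val]

/-! ### The components of the curvature. -/

variable {θ} (D : NCConnection (moyalG2 N θ) n)

/-- The bracket of the two derivations vanishes, so besides the commutator only the defect `η(0) -
[iξ_μ, iξ_ν] = -iΘ⁻¹_{μν}` survives. -/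
theorem curvatureForm_partial_partial (μ ν : MoyalIndex N) :
    D.curvatureForm (moyalPartial θ μ) (moyalPartial θ ν) =
      (tensorOne D μ * tensorOne D ν - tensorOne D ν * tensorOne D μ) -
        (Complex.I * thetaInv θ μ ν) • (1 : Matrix (Fin n) (Fin n) (MoyalAlgebra N θ)) := by
  have h0 : D.tensorForm moyalEta 0 = 0 := map_zero (tensorFormLin D)
  have h1 : moyalEta (0 : moyalG2 N θ) = 0 := by simpa using moyalEta_smul 0 (0 : moyalG2 N θ)
  rw [D.curvatureForm_eq (moyalG2_le_algDer N θ) moyalEta _ _ (moyalPartial_eq_innerDer_eta θ μ)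
    (moyalPartial_eq_innerDer_eta θ ν), lie_moyalPartial_moyalPartial, h0, h1, moyalEta_partial,
    moyalEta_partial, lie_I_smul ((lie_moyalXi_moyalXi θ μ ν).trans (mul_smul _ _ _)), sub_zero,
    sub_eq_add_neg _ ((Complex.I * _) • _), smul_smul, zero_sub]
  congr 1
  ext i j
  by_cases h : i = j
  · subst h; simp
  · simp [h]

/-- The defect is zero, and linearity of the tensor form distributes `𝒜([X, Y])` over the generators
occurring in the bracket. -/
theorem curvatureForm_partial_X2 (μ ρ σ : MoyalIndex N) :
    D.curvatureForm (moyalPartial θ μ) (moyalX2 θ ρ σ) =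
      (tensorOne D μ * tensorTwo D ρ σ - tensorTwo D ρ σ * tensorOne D μ) -
        thetaInv θ μ ρ • tensorOne D σ - thetaInv θ μ σ • tensorOne D ρ := by
  have h0 : D.tensorForm moyalEta ⁅moyalPartial θ μ, moyalX2 θ ρ σ⁆ =
      thetaInv θ μ ρ • tensorOne D σ + thetaInv θ μ σ • tensorOne D ρ := by
    change tensorFormLin D _ = _
    rw [lie_moyalPartial_moyalX2, map_add, map_smul, map_smul]
    rfl
  rw [D.curvatureForm_eq (moyalG2_le_algDer N θ) moyalEta _ _ (moyalPartial_eq_innerDer_eta θ μ)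
    (moyalX2_eq_innerDer_eta θ ρ σ), h0, moyalEta_lie_partial_X2, sub_self, map_zero, add_zero,
    ← sub_sub]
  rfl

/-- As for the mixed components, only the commutator and `-𝒜([X, Y])` remain. The plus signs result
from exchanging the indices of the antisymmetric `Θ⁻¹`. -/
theorem curvatureForm_X2_X2 (μ ν ρ σ : MoyalIndex N) :
    D.curvatureForm (moyalX2 θ μ ν) (moyalX2 θ ρ σ) =
      (tensorTwo D μ ν * tensorTwo D ρ σ - tensorTwo D ρ σ * tensorTwo D μ ν) +
        thetaInv θ ρ ν • tensorTwo D μ σ + thetaInv θ σ ν • tensorTwo D μ ρ +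
        thetaInv θ ρ μ • tensorTwo D ν σ + thetaInv θ σ μ • tensorTwo D ν ρ := by
  have h0 : D.tensorForm moyalEta ⁅moyalX2 θ μ ν, moyalX2 θ ρ σ⁆ =
      thetaInv θ μ ρ • tensorTwo D ν σ + thetaInv θ μ σ • tensorTwo D ν ρ +
        thetaInv θ ν ρ • tensorTwo D μ σ + thetaInv θ ν σ • tensorTwo D μ ρ := by
    change tensorFormLin D _ = _
    simp only [lie_moyalX2_moyalX2, map_add, map_smul]
    rfl
  rw [D.curvatureForm_eq (moyalG2_le_algDer N θ) moyalEta _ _ (moyalX2_eq_innerDer_eta θ μ ν)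
    (moyalX2_eq_innerDer_eta θ ρ σ), h0, moyalEta_lie_X2_X2, sub_self, map_zero, add_zero,
    thetaInv_swap θ ν ρ, thetaInv_swap θ ν σ, thetaInv_swap θ μ ρ, thetaInv_swap θ μ σ]
  simp only [neg_smul]
  change tensorTwo D μ ν * tensorTwo D ρ σ - tensorTwo D ρ σ * tensorTwo D μ ν - _ = _
  abel

/-! ### Antihermiticity of the tensor form and of the curvature. -/

variable {D}

/-- Antihermiticity of `iξ_μ` is used twice: it makes `∂_μ` a real derivation, to which hermiticity
of the connection applies, and it makes the shift by `η(∂_μ)` antihermitean. -/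
theorem conjTranspose_tensorOne (hD : D.IsHermitean) (μ : MoyalIndex N) :
    (tensorOne D μ).conjTranspose = -tensorOne D μ := by
  have h : star (moyalEta (moyalPartial θ μ)) = -moyalEta (moyalPartial θ μ) := by
    rw [moyalEta_partial, star_I_smul_moyalXi]
  refine D.star_tensorForm (moyalG2_le_algDer N θ) hD ?_ h
  rw [moyalPartial_eq_innerDer_eta]
  exact isRealDer_innerDer h

theorem conjTranspose_tensorTwo (hD : D.IsHermitean) (μ ν : MoyalIndex N) :
    (tensorTwo D μ ν).conjTranspose = -tensorTwo D μ ν := by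
  have h : star (moyalEta (moyalX2 θ μ ν)) = -moyalEta (moyalX2 θ μ ν) := by
    rw [moyalEta_X2, star_I_smul_moyalXi2]
  refine D.star_tensorForm (moyalG2_le_algDer N θ) hD ?_ h
  rw [moyalX2_eq_innerDer_eta]
  exact isRealDer_innerDer h

theorem conjTranspose_thetaInv_smul {B : Matrix (Fin n) (Fin n) (MoyalAlgebra N θ)}
    (hB : B.conjTranspose = -B) (μ ν : MoyalIndex N) :
    (thetaInv θ μ ν • B).conjTranspose = -(thetaInv θ μ ν • B) := by
  rw [Matrix.conjTranspose_smul, star_thetaInv, hB, smul_neg]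

/-- Read off from the explicit formula: the commutator of antihermitean matrices is antihermitean,
and `iΘ⁻¹_{μν}` is purely imaginary. The other two types of components contain real multiples of the
tensor form instead. -/
theorem conjTranspose_curvature_partial_partial (hD : D.IsHermitean) (μ ν : MoyalIndex N) :
    (D.curvatureForm (moyalPartial θ μ) (moyalPartial θ ν)).conjTranspose =
      -D.curvatureForm (moyalPartial θ μ) (moyalPartial θ ν) := by
  rw [curvatureForm_partial_partial, Matrix.conjTranspose_sub, conjTranspose_commutator
    (conjTranspose_tensorOne hD μ) (conjTranspose_tensorOne hD ν), Matrix.conjTranspose_smul,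
    star_mul', star_thetaInv, Matrix.conjTranspose_one, Complex.star_def, Complex.conj_I,
    neg_mul, neg_smul]
  abel

theorem conjTranspose_curvature_partial_X2 (hD : D.IsHermitean) (μ ρ σ : MoyalIndex N) :
    (D.curvatureForm (moyalPartial θ μ) (moyalX2 θ ρ σ)).conjTranspose =
      -D.curvatureForm (moyalPartial θ μ) (moyalX2 θ ρ σ) := by
  rw [curvatureForm_partial_X2, Matrix.conjTranspose_sub, Matrix.conjTranspose_sub,
    conjTranspose_commutator (conjTranspose_tensorOne hD μ) (conjTranspose_tensorTwo hD ρ σ),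
    conjTranspose_thetaInv_smul (conjTranspose_tensorOne hD σ),
    conjTranspose_thetaInv_smul (conjTranspose_tensorOne hD ρ)]
  abel

theorem conjTranspose_curvature_X2_X2 (hD : D.IsHermitean) (μ ν ρ σ : MoyalIndex N) :
    (D.curvatureForm (moyalX2 θ μ ν) (moyalX2 θ ρ σ)).conjTranspose =
      -D.curvatureForm (moyalX2 θ μ ν) (moyalX2 θ ρ σ) := by
  rw [curvatureForm_X2_X2]
  simp only [Matrix.conjTranspose_add]
  rw [conjTranspose_commutator (conjTranspose_tensorTwo hD μ ν) (conjTranspose_tensorTwo hD ρ σ),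
    conjTranspose_thetaInv_smul (conjTranspose_tensorTwo hD μ σ),
    conjTranspose_thetaInv_smul (conjTranspose_tensorTwo hD μ ρ),
    conjTranspose_thetaInv_smul (conjTranspose_tensorTwo hD ν σ),
    conjTranspose_thetaInv_smul (conjTranspose_tensorTwo hD ν ρ)]
  abel

end MoyalCurvature

end

/-! ### The main theorem, assembled from the parts above. -/

theorem mainTheorem2 (N : ℕ) (θ : ℝ) [NeZero θ] (n : ℕ)
    (T : Module.Basis (Fin (n ^ 2)) ℝ (selfAdjoint (Matrix (Fin n) (Fin n) ℂ)))
    (D : NCConnection (moyalG2 N θ) n) (hD : D.IsHermitean) :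
    -- the connection is the canonical connection plus its tensor form
    (∀ (X : moyalG2 N θ) (m : Fin n → MoyalAlgebra N θ),
      D X m = NCConnection.canonical n moyalEta X m + (D.tensorForm moyalEta X).mulVec m) ∧
    -- the curvature is the action of its matrix
    (∀ (X Y : moyalG2 N θ) (m : Fin n → MoyalAlgebra N θ),
      D.curvature X Y m = (D.curvatureForm X Y).mulVec m) ∧
    -- the components of the tensor form and of the curvature take values in `𝔲(n)`
    (∀ μ, IsUnValued T (tensorOne D μ)) ∧
    (∀ μ ν, IsUnValued T (tensorTwo D μ ν)) ∧
    (∀ μ ν, IsUnValued T (D.curvatureForm (moyalPartial θ μ) (moyalPartial θ ν))) ∧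
    (∀ μ ρ σ, IsUnValued T (D.curvatureForm (moyalPartial θ μ) (moyalX2 θ ρ σ))) ∧
    (∀ μ ν ρ σ, IsUnValued T (D.curvatureForm (moyalX2 θ μ ν) (moyalX2 θ ρ σ))) ∧
    -- the components of the curvature
    (∀ μ ν, D.curvatureForm (moyalPartial θ μ) (moyalPartial θ ν) =
      (tensorOne D μ * tensorOne D ν - tensorOne D ν * tensorOne D μ) -
        (Complex.I * thetaInv θ μ ν) • (1 : Matrix (Fin n) (Fin n) (MoyalAlgebra N θ))) ∧
    (∀ μ ρ σ, D.curvatureForm (moyalPartial θ μ) (moyalX2 θ ρ σ) =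
      (tensorOne D μ * tensorTwo D ρ σ - tensorTwo D ρ σ * tensorOne D μ) -
        thetaInv θ μ ρ • tensorOne D σ - thetaInv θ μ σ • tensorOne D ρ) ∧
    (∀ μ ν ρ σ, D.curvatureForm (moyalX2 θ μ ν) (moyalX2 θ ρ σ) =
      (tensorTwo D μ ν * tensorTwo D ρ σ - tensorTwo D ρ σ * tensorTwo D μ ν) +
        thetaInv θ ρ ν • tensorTwo D μ σ + thetaInv θ σ ν • tensorTwo D μ ρ +
        thetaInv θ ρ μ • tensorTwo D ν σ + thetaInv θ σ μ • tensorTwo D ν ρ) :=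
  ⟨D.apply_eq_canonical_add (moyalG2_le_algDer N θ) moyalEta, D.curvature_eq_mulVec,
    fun μ => exists_eq_expandIn T (conjTranspose_tensorOne hD μ),
    fun μ ν => exists_eq_expandIn T (conjTranspose_tensorTwo hD μ ν),
    fun μ ν => exists_eq_expandIn T (conjTranspose_curvature_partial_partial hD μ ν),
    fun μ ρ σ => exists_eq_expandIn T (conjTranspose_curvature_partial_X2 hD μ ρ σ),
    fun μ ν ρ σ => exists_eq_expandIn T (conjTranspose_curvature_X2_X2 hD μ ν ρ σ),
    curvatureForm_partial_partial D, curvatureForm_partial_X2 D, curvatureForm_X2_X2 D⟩
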